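/- Let $m\ge 2$. The double affine Hecke algebra $\ddot H_{q,t}(m)$ is the $\mathbb C[q^{\pm1},t^{\pm1}]$-algebra generated by $T_0,\dots,T_{m-1}$, $\pi^{\pm1}$, $X_1^{\pm1},\dots,X_m^{\pm1}$ subject to: $(T_i-q)(T_i+1)=0$; $T_iT_jT_i=T_jT_iT_j$ if $m>2$ and $j\equiv i\pm1 \bmod m$; $T_iT_j=T_jT_i$ if $j\not\equiv i\pm1 \bmod m$; $T_iX_iT_i=qX_{i+1}$ for $1\le i\le m-1$ and $T_0X_mT_0=t^{-1}qX_1$; $T_iX_j=X_jT_i$ if $j\not\equiv i,i+1 \bmod m$; $\pi X_i\pi^{-1}=X_{i+1}$ for $1\le i\le m-1$ and $\pi X_m\pi^{-1}=t^{-1}X_1$; $\pi T_i\pi^{-1}=T_{i+1}$ with indices modulo $m$; $X_iX_j=X_jX_i$. For integers $K,N>0$ and $a,b$ with $aN-bK=m$, let $\mathrm{DPT}(K,N,a,b)$ be the set of surjective maps $\sigma:\mathbb Z^2\to\mathbb Z$ with $\sigma(x+K,y-N)=\sigma(x,y)$ and $\sigma(x+a,y-b)=\sigma(x,y)+m$ that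 are strictly increasing in $x$ and in $y$. Let $\zeta$ be a primitive $(K+N)$-th root of unity, put $w_\sigma(i)=\zeta^{x-y}$ where $\sigma(x,y)=i$, and let $W_{(K,N,a,b)}$ be the complex vector space with basis $\nu_\sigma$, $\sigma\in\mathrm{DPT}(K,N,a,b)$. On it let $q$ act as $\zeta$, $t$ as $\zeta^{-a-b}$, $X_i\nu_\sigma=w_\sigma(i)\nu_\sigma$ for $1\le i\le m$, $\pi\nu_\sigma=\nu_{\sigma+1}$, and for $0\le i\le m-1$ $$T_i\nu_\sigma=\begin{cases}\zeta\,\nu_\sigma & \text{if } i \text{ is immediately to the left of } i+1 \ (\sigma(x,y)=i,\ \sigma(x+1,y)=i+1 \text{ for some } x,y),\\ -\nu_\sigma & \text{if } i \text{ is immediately on top of } i+1\ (\sigma(x,y)=i,\ \sigma(x,y+1)=i+1 \text{ for some } x,y),\\ -\dfrac{1-\zeta}{1-u}\,\nu_\sigma+\dfrac{1-\zeta u}{1-u}\,\nu_{s_i\circ\sigma} & \text{otherwise, with } u=w_\sigma(i)\,w_\sigma(i+1)^{-1},\end{cases}$$ where $s_i:\mathbb Z\to\mathbb Z$ sends $j$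 to $j+1$ if $j\equiv i$, to $j-1$ if $j\equiv i+1$, and to $j$ otherwise (modulo $m$). Let $S$ be a set of quadruples $(K,N,a,b)$ with $K,N,a,b>0$ and $aN-bK=m$ which, for all $K,N>0$, contains exactly one representative of each class modulo $\mathbb Z(K,N)$ of integer vectors $(a,b)$ with $aN-bK=m$. For each quadruple choose a primitive $(K+N)$-th root of unity $\zeta_{(K,N,a,b)}$, arbitrarily. Then the formulas above define an action of $\ddot H_{q,t}(m)$ on $$\mathcal W=\bigoplus_{(K,N,a,b)\in S}W_{(K,N,a,b)},$$ and $\mathcal W$ is a faithful representation: no nonzero element of $\ddot H_{q,t}(m)$ acts on $\mathcal W$ as zero. -/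

import Mathlib

open scoped DirectSum

namespace DoublyPeriodic

noncomputable section

/-! ### The double affine Hecke algebra of type `GL_m` -/

/-- The ring `ℂ[q^{±1}, t^{±1}]`, as Laurent polynomials in `t` over `ℂ[q^{±1}]`. -/
abbrev Base : Type := LaurentPolynomial (LaurentPolynomial ℂ)

/-- The parameter `q`. -/
def qParam : Base := LaurentPolynomial.C (LaurentPolynomial.T 1)

/-- The parameter `t`. -/
def tParam : Base := LaurentPolynomial.T 1

/-- The inverse parameter `t⁻¹`. -/
def tParamInv : Base := LaurentPolynomial.T (-1)

/-- Generators of the double affine Hecke algebra. All indices are residues modulo `m`;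
`T i` is the generator `T_i` with `0 ≤ i ≤ m - 1`, while `X i` is the generator `X_i` with
`1 ≤ i ≤ m`, so that `X 0` stands for `X_m`. -/
inductive Gen (m : ℕ) : Type
  | T (i : ZMod m) : Gen m
  | X (i : ZMod m) : Gen m
  | Xinv (i : ZMod m) : Gen m
  | pi : Gen m
  | piInv : Gen m

section Relations

variable (m : ℕ)

/-- The generator `T_i` in the free algebra. -/
def fT (i : ZMod m) : FreeAlgebra Base (Gen m) := FreeAlgebra.ι Base (Gen.T i)

/-- The generator `X_i` in the free algebra (`X_m` for `i = 0`). -/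
def fX (i : ZMod m) : FreeAlgebra Base (Gen m) := FreeAlgebra.ι Base (Gen.X i)

/-- The generator `X_i⁻¹` in the free algebra (`X_m⁻¹` for `i = 0`). -/
def fXinv (i : ZMod m) : FreeAlgebra Base (Gen m) := FreeAlgebra.ι Base (Gen.Xinv i)

/-- The generator `π` in the free algebra. -/
def fPi : FreeAlgebra Base (Gen m) := FreeAlgebra.ι Base Gen.pi

/-- The generator `π⁻¹` in the free algebra. -/
def fPiInv : FreeAlgebra Base (Gen m) := FreeAlgebra.ι Base Gen.piInv

/-- The defining relations of the double affine Hecke algebra (`m ≥ 2`). The braid relation is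
imposed only for `m > 2`. -/
inductive Rel : FreeAlgebra Base (Gen m) → FreeAlgebra Base (Gen m) → Prop
  | X_mul_inv (i : ZMod m) : Rel (fX m i * fXinv m i) 1
  | X_inv_mul (i : ZMod m) : Rel (fXinv m i * fX m i) 1
  | pi_mul_inv : Rel (fPi m * fPiInv m) 1
  | pi_inv_mul : Rel (fPiInv m * fPi m) 1
  | hecke (i : ZMod m) :
      Rel ((fT m i - algebraMap Base _ qParam) * (fT m i + 1)) 0
  | braid (i j : ZMod m) (hm : 2 < m) (hij : j = i + 1 ∨ j = i - 1) :
      Rel (fT m i * fT m j * fT m i) (fT m j * fT m i * fT m j)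
  | T_comm (i j : ZMod m) (hij : ¬ (j = i + 1 ∨ j = i - 1)) :
      Rel (fT m i * fT m j) (fT m j * fT m i)
  | T_X_T (i : ZMod m) (hi : i ≠ 0) :
      Rel (fT m i * fX m i * fT m i) (qParam • fX m (i + 1))
  | T_X_T_zero :
      Rel (fT m 0 * fX m 0 * fT m 0) ((tParamInv * qParam) • fX m 1)
  | T_X_comm (i j : ZMod m) (h₁ : j ≠ i) (h₂ : j ≠ i + 1) :
      Rel (fT m i * fX m j) (fX m j * fT m i)
  | pi_X (i : ZMod m) (hi : i ≠ 0) :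
      Rel (fPi m * fX m i * fPiInv m) (fX m (i + 1))
  | pi_X_zero : Rel (fPi m * fX m 0 * fPiInv m) (tParamInv • fX m 1)
  | pi_T (i : ZMod m) : Rel (fPi m * fT m i * fPiInv m) (fT m (i + 1))
  | X_comm (i j : ZMod m) : Rel (fX m i * fX m j) (fX m j * fX m i)

/-- The double affine Hecke algebra of type `GL_m` over `ℂ[q^{±1}, t^{±1}]`. -/
abbrev DAHA : Type := RingQuot (Rel m)

/-- The class in the algebra of a generator. -/
def gen (g : Gen m) : DAHA m := RingQuot.mkAlgHom Base (Rel m) (FreeAlgebra.ι Base g)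

end Relations

/-! ### Doubly periodic tableaux -/

/-- Integers `K, N > 0` and `a, b` with `a N - b K = m`. -/
structure Datum (m : ℕ) where
  K : ℤ
  N : ℤ
  a : ℤ
  b : ℤ
  K_pos : 0 < K
  N_pos : 0 < N
  det : a * N - b * K = m

variable {m : ℕ}

/-- Two data are equivalent if they have the same `K, N` and their vectors `(a, b)` agree modulo
integer multiples of `(K, N)`. -/
def Datum.Equivalent (D D' : Datum m) : Prop :=
  D'.K = D.K ∧ D'.N = D.N ∧ ∃ r : ℤ, D'.a = D.a + r * D.K ∧ D'.b = D.b + r * D.N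

/-- `S` consists of data with `a, b` positive, and has exactly one member in every equivalence
class. -/
def IsTransversal (S : Set (Datum m)) : Prop :=
  (∀ D ∈ S, 0 < D.a ∧ 0 < D.b) ∧ ∀ D : Datum m, ∃! D' : Datum m, D' ∈ S ∧ D.Equivalent D'

/-- Standard doubly periodic tableaux with respect to `(K, N, a, b)`. -/
structure DPT (D : Datum m) where
  toFun : ℤ × ℤ → ℤ
  surjective : Function.Surjective toFun
  periodic : ∀ x y, toFun (x + D.K, y - D.N) = toFun (x, y)
  shift : ∀ x y, toFun (x + D.a, y - D.b) = toFun (x, y) + m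
  lt_right : ∀ x y, toFun (x, y) < toFun (x + 1, y)
  lt_down : ∀ x y, toFun (x, y) < toFun (x, y + 1)

namespace DPT

variable {D : Datum m}

/-- A cell with label `i`. It is unique up to multiples of `(K, -N)`. -/
def cell (σ : DPT D) (i : ℤ) : ℤ × ℤ := Function.surjInv σ.surjective i

/-- The weight `w_σ(i) = ζ^{x - y}`, where `σ(x, y) = i`. As `ζ` will be a root of unity of order
`K + N`, it does not depend on the choice of the cell `(x, y)`. -/
def weight (ζ : ℂ) (σ : DPT D) (i : ℤ) : ℂ := ζ ^ ((σ.cell i).1 - (σ.cell i).2)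

/-- `i` is (immediately) to the left of `i + 1`. -/
def IsLeft (σ : DPT D) (i : ℤ) : Prop :=
  ∃ x y, σ.toFun (x, y) = i ∧ σ.toFun (x + 1, y) = i + 1

/-- `i` is (immediately) on top of `i + 1`. -/
def IsTop (σ : DPT D) (i : ℤ) : Prop :=
  ∃ x y, σ.toFun (x, y) = i ∧ σ.toFun (x, y + 1) = i + 1

/-- The tableau `π σ`, with `(π σ)(x, y) = σ(x, y) + 1`. -/
def rotate (σ : DPT D) : DPT D where
  toFun c := σ.toFun c + 1
  surjective n := by
    obtain ⟨c, hc⟩ := σ.surjective (n - 1)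
    exact ⟨c, by simp [hc]⟩
  periodic x y := by simp [σ.periodic]
  shift x y := by simp only [σ.shift]; ring
  lt_right x y := by simpa using σ.lt_right x y
  lt_down x y := by simpa using σ.lt_down x y

open Classical in
/-- The simple affine transposition `s_i` of `ℤ`. -/
def simpleRefl (m : ℕ) (i z : ℤ) : ℤ :=
  if (m : ℤ) ∣ z - i then z + 1 else if (m : ℤ) ∣ z - (i + 1) then z - 1 else z

theorem simpleRefl_surjective (m : ℕ) (i : ℤ) : Function.Surjective (simpleRefl m i) := by
  intro n
  unfold simpleRefl
  by_cases h1 : (m : ℤ) ∣ 1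
  · refine ⟨n - 1, ?_⟩
    rw [if_pos (h1.trans (one_dvd _))]
    ring
  by_cases h2 : (m : ℤ) ∣ n - i
  · refine ⟨n + 1, ?_⟩
    have h3 : ¬ (m : ℤ) ∣ n + 1 - i := fun h => h1 (by
      have := dvd_sub h h2
      ring_nf at this
      exact this)
    have h4 : (m : ℤ) ∣ n + 1 - (i + 1) := by
      have : n + 1 - (i + 1) = n - i := by ring
      rwa [this]
    rw [if_neg h3, if_pos h4]
    ring
  by_cases h3 : (m : ℤ) ∣ n - (i + 1)
  · refine ⟨n - 1, ?_⟩
    have h4 : (m : ℤ) ∣ n - 1 - i := by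
      have : n - 1 - i = n - (i + 1) := by ring
      rwa [this]
    rw [if_pos h4]
    ring
  · exact ⟨n, by rw [if_neg h2, if_neg h3]⟩

theorem simpleRefl_add (m : ℕ) (i z : ℤ) : simpleRefl m i (z + m) = simpleRefl m i z + m := by
  have h : ∀ k : ℤ, (m : ℤ) ∣ z + m - k ↔ (m : ℤ) ∣ z - k := fun k => by
    have : z + m - k = (z - k) + m := by ring
    rw [this, dvd_add_self_right]
  unfold simpleRefl
  simp only [h]
  split_ifs <;> ring

/-- `s_i` preserves the order of two integers unless they are congruent to `i, i + 1` and
consecutive. -/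
theorem simpleRefl_lt (m : ℕ) (i : ℤ) {c d : ℤ} (h : c < d)
    (hne : ¬ ((m : ℤ) ∣ c - i ∧ d = c + 1)) : simpleRefl m i c < simpleRefl m i d := by
  unfold simpleRefl
  by_cases hc : (m : ℤ) ∣ c - i
  · have hd : d ≠ c + 1 := fun e => hne ⟨hc, e⟩
    rw [if_pos hc]
    split_ifs with h1 h2
    · omega
    · have : d ≠ c + 2 := by
        rintro rfl
        apply h1
        have h3 := dvd_sub h2 hc
        ring_nf at h3
        exact h3.trans (one_dvd _)
      omega
    · omega
  · rw [if_neg hc]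
    split_ifs with h1 h2 h3 h4
    · omega
    · omega
    · omega
    · omega
    · have : d ≠ c + 1 := by
        rintro rfl
        apply hc
        have : c + 1 - (i + 1) = c - i := by ring
        rwa [← this]
      omega
    · omega

theorem toFun_add_mul (σ : DPT D) (r x y : ℤ) :
    σ.toFun (x + r * D.a, y - r * D.b) = σ.toFun (x, y) + r * m := by
  induction r with
  | zero => simp
  | succ k ih =>
    have := σ.shift (x + k * D.a) (y - k * D.b)
    rw [ih] at this
    rw [show x + (k + 1 : ℤ) * D.a = x + k * D.a + D.a by ring,
      show y - (k + 1 : ℤ) * D.b = y - k * D.b - D.b by ring, this]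
    ring
  | pred k ih =>
    have := σ.shift (x + (-k - 1 : ℤ) * D.a) (y - (-k - 1 : ℤ) * D.b)
    rw [show x + (-k - 1 : ℤ) * D.a + D.a = x + (-k : ℤ) * D.a by ring,
      show y - (-k - 1 : ℤ) * D.b - D.b = y - (-k : ℤ) * D.b by ring, ih] at this
    linarith

/-- The tableau `s_i σ`, with `(s_i σ)(x, y) = s_i(σ(x, y))`. It is standard because `i` is neither
to the left nor on top of `i + 1`. -/
def swap (σ : DPT D) (i : ℤ) (hl : ¬ σ.IsLeft i) (ht : ¬ σ.IsTop i) : DPT D where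
  toFun c := simpleRefl m i (σ.toFun c)
  surjective := (simpleRefl_surjective m i).comp σ.surjective
  periodic x y := by rw [σ.periodic]
  shift x y := by rw [σ.shift, simpleRefl_add]
  lt_right x y := by
    refine simpleRefl_lt m i (σ.lt_right x y) ?_
    rintro ⟨⟨k, hk⟩, h⟩
    refine hl ⟨x + (-k) * D.a, y - (-k) * D.b, ?_, ?_⟩
    · rw [toFun_add_mul]; linarith
    · rw [show x + (-k) * D.a + 1 = x + 1 + (-k) * D.a by ring, toFun_add_mul, h]; linarith
  lt_down x y := by
    refine simpleRefl_lt m i (σ.lt_down x y) ?_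
    rintro ⟨⟨k, hk⟩, h⟩
    refine ht ⟨x + (-k) * D.a, y - (-k) * D.b, ?_, ?_⟩
    · rw [toFun_add_mul]; linarith
    · rw [show y - (-k) * D.b + 1 = y + 1 - (-k) * D.b by ring, toFun_add_mul, h]; linarith

end DPT

/-! ### The operators on tableau modules -/

/-- The complex vector space `W_{(K,N,a,b)}` with basis the standard doubly periodic tableaux. -/
abbrev W (D : Datum m) : Type := DPT D →₀ ℂ

/-- The basis vector `ν_σ`. -/
def nu {D : Datum m} (σ : DPT D) : W D := Finsupp.single σ 1

/-- `X_i ν_σ = w_σ(i) ν_σ`. -/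
def opX (D : Datum m) (ζ : ℂ) (i : ℤ) : Module.End ℂ (W D) :=
  Finsupp.linearCombination ℂ fun σ : DPT D => σ.weight ζ i • nu σ

/-- `π ν_σ = ν_{π σ}`. -/
def opPi (D : Datum m) : Module.End ℂ (W D) :=
  Finsupp.linearCombination ℂ fun σ : DPT D => nu σ.rotate

open Classical in
/-- `T_i ν_σ` is `ζ ν_σ` if `i` is to the left of `i + 1`, it is `- ν_σ` if `i` is on top of
`i + 1`, and otherwise it is
`- (1 - ζ) / (1 - u) ν_σ + (1 - ζ u) / (1 - u) ν_{s_i σ}` with `u = w_σ(i) w_σ(i + 1)⁻¹`. -/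
def opT (D : Datum m) (ζ : ℂ) (i : ℤ) : Module.End ℂ (W D) :=
  Finsupp.linearCombination ℂ fun σ : DPT D =>
    if hl : σ.IsLeft i then ζ • nu σ
    else if ht : σ.IsTop i then - nu σ
    else
      (- ((1 - ζ) / (1 - σ.weight ζ i * (σ.weight ζ (i + 1))⁻¹))) • nu σ
        + ((1 - ζ * (σ.weight ζ i * (σ.weight ζ (i + 1))⁻¹))
            / (1 - σ.weight ζ i * (σ.weight ζ (i + 1))⁻¹)) • nu (σ.swap i hl ht)

/-- The integer `1 ≤ i ≤ m` which represents the index of the generator `X i`. -/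
def xIndex (i : ZMod m) : ℤ := if i = 0 then m else i.val

/-- The integer `0 ≤ i ≤ m - 1` which represents the index of the generator `T i`. -/
def tIndex (i : ZMod m) : ℤ := i.val

/-- The direct sum `𝒲` of the spaces `W_{(K,N,a,b)}` over `(K,N,a,b) ∈ S`. -/
abbrev BigW (S : Set (Datum m)) : Type := ⨁ D : S, W D.1

/-- `ρ` is the direct sum over `S` of the actions on the `W_{(K,N,a,b)}`, where on each summand `q`
acts as `ζ_{(K,N,a,b)}`, `t` as `ζ_{(K,N,a,b)}^{-a-b}`, and the generators by the formulas above.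
There is at most one such `ρ`, as these elements and their inverses generate the algebra. -/
structure IsTableauAction (S : Set (Datum m)) (ζ : Datum m → ℂ)
    (ρ : DAHA m →ₐ[ℂ] Module.End ℂ (BigW S)) : Prop where
  q_act : ρ (algebraMap Base (DAHA m) qParam)
    = DirectSum.lmap fun D : S => ζ D • (LinearMap.id : W D.1 →ₗ[ℂ] W D.1)
  t_act : ρ (algebraMap Base (DAHA m) tParam)
    = DirectSum.lmap fun D : S =>
        ζ D ^ (- D.1.a - D.1.b) • (LinearMap.id : W D.1 →ₗ[ℂ] W D.1)
  X_act : ∀ i : ZMod m, ρ (gen m (Gen.X i))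
    = DirectSum.lmap fun D : S => opX D.1 (ζ D) (xIndex i)
  T_act : ∀ i : ZMod m, ρ (gen m (Gen.T i))
    = DirectSum.lmap fun D : S => opT D.1 (ζ D) (tIndex i)
  pi_act : ρ (gen m Gen.pi) = DirectSum.lmap fun D : S => opPi D.1

end

end DoublyPeriodic

namespace DoublyPeriodic

noncomputable section

open DPT (simpleRefl simpleRefl_lt simpleRefl_add)

/-! ### Affine permutations -/

section Refl

variable {m : ℕ} {i j z c d : ℤ}

/-! Action. Standard tableaux are embedded in the space of all fillings of the cylinder ℤ²/(K,-N) by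
distinct integers, where `s_i σ` makes sense for every σ. The off-diagonal coefficient of `T_i`
vanishes when `i` and `i + 1` are adjacent (`coefB`), so one formula covers all three cases
(`emb_opT`) and the relations become rational identities in the weights. The denominators are
harmless because consecutive labels never share a weight (`DPT.weight_ne_succ`).

Faithfulness. Over ℂ the algebra is spanned by the products of a monomial in the `X_i`, `q`, `t` and
an element `T_w`, with `w` in the extended affine symmetric group (`stdSpan_eq_top`). Linear
independence of these products is not needed in advance. The action is triangular: `T_w ν_σ` is κ
`ν_{wσ}` plus terms `ν_{gσ}` with `g` shorter than `w`, and κ ≠ 0 once finitely many pairs of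
labels, depending only on `w`, are far apart in σ (`exists_leading`). Monomials act diagonally.
Hence, if `w` is longest in a nonzero combination, the coefficient of `ν_{wσ}` in the image of `ν_σ`
is κ times a nonzero Laurent polynomial P evaluated at the weights of wσ, at `q` and at `t`
(`emb_actW_coeff`).

It remains to find σ avoiding the zeros of P. There are tableaux with parameters Y, J, K in which
the label r + ml, 1 ≤ r ≤ m, has weight ζ^(J(Y^r - l) - r), while `t` acts as ζ^J
(`exists_generic_datum`). For suitable Y and then J, distinct monomials of P have distinct exponents
in ζ, so P becomes a nonzero Laurent polynomial in the single variable ζ. With Y and J fixed and K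
growing, the order JK - m of ζ grows, so ζ takes infinitely many values whichever primitive roots
were chosen; only finitely many of them are zeros (`exists_generic_tableau`). -/

theorem not_dvd_one (hm : 2 ≤ m) : ¬ (m : ℤ) ∣ 1 := fun h => by
  have := Int.le_of_dvd one_pos h
  omega

theorem not_dvd_succ (hm : 2 ≤ m) (h : (m : ℤ) ∣ z) : ¬ (m : ℤ) ∣ z + 1 := fun h' =>
  not_dvd_one hm ((dvd_add_right h).1 h')

theorem simpleRefl_of_dvd (h : (m : ℤ) ∣ z - i) : simpleRefl m i z = z + 1 := by
  rw [simpleRefl, if_pos h]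

theorem simpleRefl_of_dvd_succ (hm : 2 ≤ m) (h : (m : ℤ) ∣ z - (i + 1)) :
    simpleRefl m i z = z - 1 := by
  have : ¬ (m : ℤ) ∣ z - i := by
    have := not_dvd_succ hm h
    rwa [show z - (i + 1) + 1 = z - i by ring] at this
  rw [simpleRefl, if_neg this, if_pos h]

theorem simpleRefl_of_not_dvd (h : ¬ (m : ℤ) ∣ z - i) (h' : ¬ (m : ℤ) ∣ z - (i + 1)) :
    simpleRefl m i z = z := by
  rw [simpleRefl, if_neg h, if_neg h']

theorem simpleRefl_self : simpleRefl m i i = i + 1 := simpleRefl_of_dvd (by simp)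

theorem simpleRefl_succ (hm : 2 ≤ m) : simpleRefl m i (i + 1) = i := by
  rw [simpleRefl_of_dvd_succ hm (by simp), add_sub_cancel_right]

theorem simpleRefl_simpleRefl (hm : 2 ≤ m) (i z : ℤ) :
    simpleRefl m i (simpleRefl m i z) = z := by
  by_cases h : (m : ℤ) ∣ z - i
  · rw [simpleRefl_of_dvd h, simpleRefl_of_dvd_succ hm, add_sub_cancel_right]
    rwa [add_sub_add_right_eq_sub]
  by_cases h' : (m : ℤ) ∣ z - (i + 1)
  · rw [simpleRefl_of_dvd_succ hm h', simpleRefl_of_dvd, sub_add_cancel]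
    rwa [show z - 1 - i = z - (i + 1) by ring]
  · simp only [simpleRefl_of_not_dvd h h']

theorem simpleRefl_congr (h : (m : ℤ) ∣ i - j) : simpleRefl m i = simpleRefl m j := by
  have e : ∀ w : ℤ, (m : ℤ) ∣ w - i ↔ (m : ℤ) ∣ w - j := fun w => by
    rw [show w - j = (w - i) + (i - j) by ring, dvd_add_left h]
  funext z
  unfold simpleRefl
  simp only [e, ← sub_sub, sub_right_comm _ _ (1 : ℤ)]

theorem simpleRefl_add_one (i z : ℤ) : simpleRefl m (i + 1) (z + 1) = simpleRefl m i z + 1 := by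
  unfold simpleRefl
  simp only [add_sub_add_right_eq_sub]
  split_ifs <;> ring

/-- `s_i` preserves the relative order of two labels unless they are swapped by `s_i`. -/
theorem simpleRefl_lt_iff (h₁ : ¬ ((m : ℤ) ∣ c - i ∧ d = c + 1))
    (h₂ : ¬ ((m : ℤ) ∣ d - i ∧ c = d + 1)) : simpleRefl m i c < simpleRefl m i d ↔ c < d := by
  refine ⟨fun h => ?_, fun h => simpleRefl_lt m i h h₁⟩
  rcases lt_trichotomy c d with h' | rfl | h'
  · exact h'
  · exact absurd h (lt_irrefl _)
  · exact absurd h (simpleRefl_lt m i h' h₂).not_gt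

end Refl

/-! ### The extended affine symmetric group: descents and length. -/

section Perm

/-- The extended affine symmetric group, as the group of `m`-periodic permutations of `ℤ`. -/
def AffPerm (m : ℕ) : Subgroup (Equiv.Perm ℤ) where
  carrier := {g | ∀ z, g (z + m) = g z + m}
  mul_mem' {g h} hg hh z := by rw [Equiv.Perm.mul_apply, hh z, hg, Equiv.Perm.mul_apply]
  one_mem' z := rfl
  inv_mem' {g} hg z := by
    rw [Equiv.Perm.inv_eq_iff_eq, hg]
    simp

variable {m : ℕ}

theorem affPerm_map_add (w : AffPerm m) (z : ℤ) : w.1 (z + m) = w.1 z + m := w.2 z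

theorem affPerm_map_add_mul (w : AffPerm m) (z k : ℤ) : w.1 (z + m * k) = w.1 z + m * k := by
  induction k with
  | zero => simp
  | succ k ih => rw [mul_add, ← add_assoc, mul_one, affPerm_map_add w, ih, add_assoc]
  | pred k ih =>
    have := affPerm_map_add w (z + m * (-k - 1))
    rw [show z + m * (-k - 1) + m = z + m * (-(k : ℤ)) by ring, ih] at this
    linarith

theorem affPerm_dvd_sub_iff (w : AffPerm m) (x y : ℤ) :
    (m : ℤ) ∣ w.1 x - w.1 y ↔ (m : ℤ) ∣ x - y := by
  have key : ∀ (w : AffPerm m) (x y : ℤ), (m : ℤ) ∣ x - y → (m : ℤ) ∣ w.1 x - w.1 y := by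
    rintro w x y ⟨k, hk⟩
    rw [eq_add_of_sub_eq' hk, affPerm_map_add_mul w]
    simp
  refine ⟨fun h => ?_, key w x y⟩
  simpa using key w⁻¹ _ _ h

/-- The translation by one. -/
def affPi (m : ℕ) : AffPerm m := ⟨Equiv.addRight 1, fun z => by simp; ring⟩

@[simp] theorem affPi_apply (z : ℤ) : (affPi m).1 z = z + 1 := rfl

@[simp] theorem affPi_inv_apply (z : ℤ) : (affPi m)⁻¹.1 z = z - 1 := rfl

theorem affPi_zpow_apply (r z : ℤ) : (affPi m ^ r).1 z = z + r := by
  induction r generalizing z with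
  | zero => simp
  | succ k ih =>
    rw [zpow_add_one, Subgroup.coe_mul, Equiv.Perm.mul_apply, ih, affPi_apply]; ring
  | pred k ih =>
    rw [zpow_sub_one, Subgroup.coe_mul, Equiv.Perm.mul_apply, ih, affPi_inv_apply]; ring

theorem three_le_not_dvd (h3 : 3 ≤ m) : ¬ (m : ℤ) ∣ 1 ∧ ¬ (m : ℤ) ∣ 2 := by
  constructor <;> intro h <;> have := Int.le_of_dvd (by norm_num) h <;> omega

/-- `i` is a (left) descent of `w`. -/
def Desc (w : AffPerm m) (i : ℤ) : Prop := w⁻¹.1 (i + 1) < w⁻¹.1 i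

/-- The number of inversions of `v` with smaller position `a`. -/
def invCount (v : AffPerm m) (a : ℤ) : ℕ := Set.ncard {b | a < b ∧ v.1 b < v.1 a}

theorem invCount_add_mul (v : AffPerm m) (a k : ℤ) : invCount v (a + m * k) = invCount v a := by
  unfold invCount
  rw [← Set.ncard_image_of_injective {b | a < b ∧ v.1 b < v.1 a} (add_left_injective ((m : ℤ) * k))]
  congr 1
  ext b
  simp only [Set.mem_ofPred_eq, Set.mem_image]
  constructor
  · rintro ⟨h1, h2⟩
    refine ⟨b - m * k, ⟨by linarith, ?_⟩, by ring⟩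
    have := affPerm_map_add_mul v (b - m * k) k
    rw [sub_add_cancel] at this
    rw [affPerm_map_add_mul v] at h2
    linarith
  · rintro ⟨c, ⟨h1, h2⟩, rfl⟩
    rw [affPerm_map_add_mul v, affPerm_map_add_mul v]
    exact ⟨by linarith, by linarith⟩

theorem invCount_congr (v : AffPerm m) {a b : ℤ} (h : (a : ZMod m) = b) :
    invCount v a = invCount v b := by
  rw [ZMod.intCast_eq_intCast_iff_dvd_sub] at h
  obtain ⟨k, hk⟩ := h
  rw [show b = a + m * k by linarith, invCount_add_mul]

theorem desc_affPi_mul {w : AffPerm m} {i : ℤ} : Desc (affPi m * w) (i + 1) ↔ Desc w i := by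
  have e : ∀ z, (affPi m * w)⁻¹.1 (z + 1) = w⁻¹.1 z := fun z => by
    rw [mul_inv_rev, Subgroup.coe_mul, Equiv.Perm.mul_apply, affPi_inv_apply, add_sub_cancel_right]
  rw [Desc, e, e, Desc]

theorem desc_congr {w : AffPerm m} {i j : ℤ} (h : (m : ℤ) ∣ i - j) : Desc w i ↔ Desc w j := by
  obtain ⟨k, hk⟩ := h
  have e1 : i = j + m * k := by linarith
  have e2 : i + 1 = j + 1 + m * k := by linarith
  unfold Desc
  rw [e2, e1, affPerm_map_add_mul, affPerm_map_add_mul]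
  omega

/-- An affine permutation without descents is a translation. -/
theorem eq_affPi_zpow {w : AffPerm m} (h : ∀ i, ¬ Desc w i) : w = affPi m ^ w.1 0 := by
  have mono : StrictMono w⁻¹.1 := by
    refine strictMono_int_of_lt_succ fun i => ?_
    exact lt_of_le_of_ne (not_lt.1 (h i)) fun e => by simpa using w⁻¹.1.injective e
  have hlt : ∀ {x y : ℤ}, x < y → w.1 x < w.1 y := fun {x y} hxy => by
    rw [← mono.lt_iff_lt]
    simpa using hxy
  have step : ∀ z, w.1 (z + 1) = w.1 z + 1 := fun z => by
    have h1 := hlt (lt_add_one z)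
    by_contra hne
    have h2 : w.1 z + 1 < w.1 (z + 1) := by omega
    have h3 := mono h2
    have h4 := mono (lt_add_one (w.1 z))
    simp at h3 h4
    omega
  refine Subtype.ext (Equiv.ext fun z => ?_)
  rw [affPi_zpow_apply]
  induction z with
  | zero => simp
  | succ k ih => rw [step, ih]; ring
  | pred k ih =>
    have := step (-k - 1)
    rw [sub_add_cancel, ih] at this
    omega

variable [hm : Fact (2 ≤ m)]

instance neZero_of_two_le : NeZero m := ⟨by have := hm.out; omega⟩

/-- The simple affine transposition as an affine permutation. -/
def affS (i : ℤ) : AffPerm m :=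
  ⟨⟨simpleRefl m i, simpleRefl m i, simpleRefl_simpleRefl hm.out i, simpleRefl_simpleRefl hm.out i⟩,
    simpleRefl_add m i⟩

theorem affS_apply (i z : ℤ) : (affS i : AffPerm m).1 z = simpleRefl m i z := rfl

@[simp] theorem affS_mul_self (i : ℤ) : (affS i * affS i : AffPerm m) = 1 :=
  Subtype.ext (Equiv.ext (simpleRefl_simpleRefl hm.out i))

@[simp] theorem affS_mul_cancel (i : ℤ) (w : AffPerm m) : affS i * (affS i * w) = w := by
  rw [← mul_assoc, affS_mul_self, one_mul]

@[simp] theorem affS_inv (i : ℤ) : (affS i : AffPerm m)⁻¹ = affS i :=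
  inv_eq_of_mul_eq_one_left (affS_mul_self i)

theorem affS_congr {i j : ℤ} (h : (m : ℤ) ∣ i - j) : (affS i : AffPerm m) = affS j :=
  Subtype.ext (Equiv.ext (congrFun (simpleRefl_congr h)))

theorem affPi_mul_affS (i : ℤ) : (affPi m * affS i) = affS (i + 1) * affPi m := by
  refine Subtype.ext (Equiv.ext fun z => ?_)
  exact (simpleRefl_add_one i z).symm

theorem affS_comm {i j : ℤ} (h₁ : ¬ (m : ℤ) ∣ j - (i + 1)) (h₂ : ¬ (m : ℤ) ∣ i - (j + 1)) :
    (affS i * affS j : AffPerm m) = affS j * affS i := by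
  by_cases h₀ : (m : ℤ) ∣ i - j
  · rw [affS_congr h₀]
  have h₀' : ¬ (m : ℤ) ∣ j - i := by rwa [← dvd_neg, neg_sub]
  have fix : ∀ a b z : ℤ, (m : ℤ) ∣ z - a → ¬ (m : ℤ) ∣ a - b → ¬ (m : ℤ) ∣ a - (b + 1) →
      simpleRefl m b z = z := fun a b z hz h h' => by
    refine simpleRefl_of_not_dvd (fun e => h ?_) (fun e => h' ?_)
    · have := dvd_sub e hz; rwa [sub_sub_sub_cancel_left] at this
    · have := dvd_sub e hz; rwa [sub_sub_sub_cancel_left] at this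
  -- The points moved by `s_i` lie in the classes of `i` and `i + 1`, which `s_j` fixes.
  have key : ∀ i j z : ℤ, ¬ (m : ℤ) ∣ i - j → ¬ (m : ℤ) ∣ j - (i + 1) → ¬ (m : ℤ) ∣ i - (j + 1) →
      simpleRefl m i z ≠ z → simpleRefl m i (simpleRefl m j z) = simpleRefl m j (simpleRefl m i z) := by
    intro i j z h₀ h₁ h₂ hz
    have h₁' : ¬ (m : ℤ) ∣ i + 1 - j := by rwa [← dvd_neg, neg_sub]
    have h₀' : ¬ (m : ℤ) ∣ i + 1 - (j + 1) := by rwa [add_sub_add_right_eq_sub]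
    by_cases h : (m : ℤ) ∣ z - i
    · rw [fix i j z h h₀ h₂, simpleRefl_of_dvd h, fix (i + 1) j _ (by simpa using h) h₁' h₀']
    by_cases h' : (m : ℤ) ∣ z - (i + 1)
    · rw [fix (i + 1) j z h' h₁' h₀', simpleRefl_of_dvd_succ hm.out h', fix i j _ _ h₀ h₂]
      rwa [show z - 1 - i = z - (i + 1) by ring]
    · exact absurd (simpleRefl_of_not_dvd h h') hz
  refine Subtype.ext (Equiv.ext fun z => ?_)
  change simpleRefl m i (simpleRefl m j z) = simpleRefl m j (simpleRefl m i z)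
  by_cases hi : simpleRefl m i z = z
  · by_cases hj : simpleRefl m j z = z
    · rw [hi, hj, hi]
    · exact (key j i z h₀' h₂ h₁ hj).symm
  · exact key i j z h₀ h₁ h₂ hi

/-- For `3 ≤ m` the classes of `i`, `i + 1`, `i + 2` are distinct; both sides exchange the first
with the third and fix everything else. -/
theorem affS_braid (h3 : 3 ≤ m) (i : ℤ) :
    (affS i * affS (i + 1) * affS i : AffPerm m) = affS (i + 1) * affS i * affS (i + 1) := by
  obtain ⟨n1, n2⟩ := three_le_not_dvd h3
  refine Subtype.ext (Equiv.ext fun z => ?_)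
  change simpleRefl m i (simpleRefl m (i + 1) (simpleRefl m i z))
    = simpleRefl m (i + 1) (simpleRefl m i (simpleRefl m (i + 1) z))
  have hd : ∀ (w a b : ℤ), (m : ℤ) ∣ w - a → (¬ (m : ℤ) ∣ a - b) → ¬ (m : ℤ) ∣ w - b := by
    intro w a b h h' e
    have := dvd_sub e h
    rw [sub_sub_sub_cancel_left] at this
    exact h' this
  have m1 : ¬ (m : ℤ) ∣ -1 := by rwa [dvd_neg]
  have m2 : ¬ (m : ℤ) ∣ -2 := by rwa [dvd_neg]
  by_cases h0 : (m : ℤ) ∣ z - i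
  · rw [simpleRefl_of_dvd h0, simpleRefl_of_dvd (i := i + 1) (z := z + 1) (by simpa using h0),
      simpleRefl_of_not_dvd (i := i + 1) (z := z) (hd z i _ h0 (by ring_nf; simpa using m1))
        (hd z i _ h0 (by ring_nf; simpa using m2)), simpleRefl_of_dvd h0,
      simpleRefl_of_dvd (i := i + 1) (z := z + 1) (by simpa using h0)]
    have h0' : (m : ℤ) ∣ z + 1 + 1 - (i + 2) := by ring_nf at h0 ⊢; exact h0
    exact simpleRefl_of_not_dvd (hd _ (i + 2) _ h0' (by ring_nf; simpa using n2))
        (hd _ (i + 2) _ h0' (by ring_nf; simpa using n1))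
  by_cases h1 : (m : ℤ) ∣ z - (i + 1)
  · have h1' : (m : ℤ) ∣ z - 1 - i := by ring_nf at h1 ⊢; exact h1
    have h1'' : (m : ℤ) ∣ z + 1 - (i + 2) := by ring_nf at h1 ⊢; exact h1
    rw [simpleRefl_of_dvd_succ hm.out h1,
      simpleRefl_of_not_dvd (i := i + 1) (z := z - 1) (hd _ i _ h1' (by ring_nf; simpa using m1))
        (hd _ i _ h1' (by ring_nf; simpa using m2)), simpleRefl_of_dvd h1',
      simpleRefl_of_dvd (i := i + 1) h1,
      simpleRefl_of_not_dvd (i := i) (z := z + 1) (hd _ (i + 2) _ h1'' (by ring_nf; simpa using n2))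
        (hd _ (i + 2) _ h1'' (by ring_nf; simpa using n1)),
      simpleRefl_of_dvd_succ hm.out (by ring_nf at h1 ⊢; exact h1)]
    ring
  by_cases h2 : (m : ℤ) ∣ z - (i + 1 + 1)
  · have h2' : (m : ℤ) ∣ z - 1 - (i + 1) := by ring_nf at h2 ⊢; exact h2
    have h2'' : (m : ℤ) ∣ z - 1 - 1 - i := by ring_nf at h2 ⊢; exact h2
    rw [simpleRefl_of_not_dvd h0 h1, simpleRefl_of_dvd_succ hm.out h2,
      simpleRefl_of_dvd_succ hm.out h2', simpleRefl_of_not_dvd (i := i + 1) (z := z - 1 - 1)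
        (hd _ i _ h2'' (by ring_nf; simpa using m1)) (hd _ i _ h2'' (by ring_nf; simpa using m2))]
  · rw [simpleRefl_of_not_dvd h0 h1, simpleRefl_of_not_dvd h1 h2, simpleRefl_of_not_dvd h0 h1,
      simpleRefl_of_not_dvd h1 h2]

/-- The displacement `v z - z` is `m`-periodic, so it takes finitely many values. -/
theorem affPerm_exists_bound (v : AffPerm m) : ∃ C : ℤ, ∀ z, |v.1 z - z| ≤ C := by
  refine ⟨∑ r ∈ Finset.range m, |v.1 r - r|, fun z => ?_⟩
  have hm0 : (m : ℤ) ≠ 0 := by exact_mod_cast NeZero.ne m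
  have h1 := Int.emod_nonneg z hm0
  have h2 := Int.emod_lt_of_pos z (lt_of_le_of_ne (by positivity) hm0.symm)
  have e : v.1 z - z = v.1 (z % m).toNat - (z % m).toNat := by
    rw [Int.toNat_of_nonneg h1]
    conv_lhs => rw [← Int.emod_add_mul_ediv z m, affPerm_map_add_mul v]
    ring
  rw [e]
  exact Finset.single_le_sum (f := fun r : ℕ => |v.1 r - r|) (fun _ _ => abs_nonneg _)
    (Finset.mem_range.2 (by omega))

/-- Finiteness gives `invCount` its meaning, since `Set.ncard` is 0 on infinite sets. -/
theorem finite_inversions (v : AffPerm m) (a : ℤ) : {b | a < b ∧ v.1 b < v.1 a}.Finite := by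
  obtain ⟨C, hC⟩ := affPerm_exists_bound v
  refine (Set.finite_Ioo a (v.1 a + C)).subset fun b hb => ⟨hb.1, ?_⟩
  have := abs_le.1 (hC b)
  linarith [hb.2]

open Classical in
/-- Precomposition with `s_i` creates exactly one inversion per period if `v i < v (i + 1)`. -/
theorem invCount_mul_affS {v : AffPerm m} {i : ℤ} (h : v.1 i < v.1 (i + 1)) (a : ℤ) :
    invCount (v * affS i) (simpleRefl m i a)
      = invCount v a + if (m : ℤ) ∣ a - (i + 1) then 1 else 0 := by
  have hs := simpleRefl_simpleRefl hm.out i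
  have per : ∀ c : ℤ, (m : ℤ) ∣ c - i → v.1 c < v.1 (c + 1) := by
    rintro c ⟨k, hk⟩
    have e1 : c = i + m * k := by linarith
    have e2 : c + 1 = i + 1 + m * k := by linarith
    rw [e2, e1, affPerm_map_add_mul v, affPerm_map_add_mul v]
    linarith
  have e : {b | simpleRefl m i a < b ∧ (v * affS i).1 b < (v * affS i).1 (simpleRefl m i a)}
      = simpleRefl m i '' {b | simpleRefl m i a < simpleRefl m i b ∧ v.1 b < v.1 a} := by
    ext b
    simp only [Set.mem_ofPred_eq, Set.mem_image, Subgroup.coe_mul, Equiv.Perm.mul_apply, affS_apply, hs]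
    constructor
    · rintro ⟨h1, h2⟩
      exact ⟨simpleRefl m i b, ⟨by rwa [hs], h2⟩, hs b⟩
    · rintro ⟨c, ⟨h1, h2⟩, rfl⟩
      exact ⟨h1, by rwa [hs]⟩
  rw [invCount, e, Set.ncard_image_of_injective _ (Function.LeftInverse.injective hs), invCount]
  split_ifs with ha
  -- Here `s_i` exchanges `a - 1` and `a`, and the one new inversion is that of this pair; every
  -- other comparison is preserved.
  · rw [← Set.ncard_insert_of_notMem (a := a - 1) (by simp) (finite_inversions v a)]
    congr 1
    ext b
    simp only [Set.mem_ofPred_eq, Set.mem_insert_iff]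
    have ha' : (m : ℤ) ∣ a - 1 - i := by rwa [show a - 1 - i = a - (i + 1) by ring]
    by_cases hb : b = a - 1
    · subst hb
      rw [simpleRefl_of_dvd_succ hm.out ha, simpleRefl_of_dvd ha']
      have := per _ ha'
      rw [sub_add_cancel] at this
      simp [this]
    · rw [simpleRefl_lt_iff]
      · simp [hb]
      · rintro ⟨h1, -⟩
        exact not_dvd_succ hm.out ha (by rwa [show a - (i + 1) + 1 = a - i by ring])
      · rintro ⟨-, h2⟩
        omega
  · rw [add_zero]
    congr 1
    ext b
    simp only [Set.mem_ofPred_eq]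
    by_cases hb : (m : ℤ) ∣ a - i ∧ b = a + 1
    · obtain ⟨h1, rfl⟩ := hb
      have := per _ h1
      constructor <;> rintro ⟨-, h3⟩ <;> omega
    · rw [simpleRefl_lt_iff hb]
      rintro ⟨h1, h2⟩
      exact ha (by rwa [show a - (i + 1) = b - i by omega])

/-- The length of an affine permutation, as its number of inversions modulo translation. -/
def len (w : AffPerm m) : ℕ := ∑ a : ZMod m, invCount w⁻¹ a.val

/-- Reindexing the residues by the transposition of `i` and `i + 1` matches the two sums term by
term, except that the class of `i + 1` gains one inversion. -/
theorem len_affS_mul {w : AffPerm m} {i : ℤ} (h : ¬ Desc w i) : len (affS i * w) = len w + 1 := by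
  classical
  have hlt : w⁻¹.1 i < w⁻¹.1 (i + 1) :=
    lt_of_le_of_ne (not_lt.1 h) fun e => by simpa using w⁻¹.1.injective e
  have hcast : ∀ a : ZMod m, ((a.val : ℤ) : ZMod m) = a := fun a => by simp
  unfold len
  rw [mul_inv_rev, affS_inv, ← Equiv.sum_comp (Equiv.swap (i : ZMod m) ((i + 1 : ℤ) : ZMod m))]
  have key : ∀ a : ZMod m, invCount (w⁻¹ * affS i)
      ((Equiv.swap (i : ZMod m) ((i + 1 : ℤ) : ZMod m) a).val : ℤ)
      = invCount w⁻¹ a.val + if a = ((i + 1 : ℤ) : ZMod m) then 1 else 0 := by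
    intro a
    have hd : ∀ j : ℤ, (m : ℤ) ∣ a.val - j ↔ a = (j : ZMod m) := fun j => by
      rw [← dvd_neg, neg_sub, ← ZMod.intCast_eq_intCast_iff_dvd_sub, hcast]
    rw [show invCount (w⁻¹ * affS i) ((Equiv.swap (i : ZMod m) ((i + 1 : ℤ) : ZMod m) a).val : ℤ)
      = invCount (w⁻¹ * affS i) (simpleRefl m i a.val) from invCount_congr _ ?_,
      invCount_mul_affS hlt]
    · simp only [hd]
    · rw [hcast]
      by_cases h1 : a = (i : ZMod m)
      · rw [simpleRefl_of_dvd ((hd i).2 h1), h1, Equiv.swap_apply_left]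
        simp
      by_cases h2 : a = ((i + 1 : ℤ) : ZMod m)
      · rw [simpleRefl_of_dvd_succ hm.out ((hd _).2 h2), h2, Equiv.swap_apply_right]
        simp
      · rw [simpleRefl_of_not_dvd (by rwa [hd]) (by rwa [hd]), Equiv.swap_apply_of_ne_of_ne h1 h2,
          hcast]
  simp only [key, Finset.sum_add_distrib, Finset.sum_ite_eq', Finset.mem_univ, if_true]

theorem desc_affS_mul {w : AffPerm m} {i : ℤ} : Desc (affS i * w) i ↔ ¬ Desc w i := by
  have : w⁻¹.1 i ≠ w⁻¹.1 (i + 1) := fun e => by simpa using w⁻¹.1.injective e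
  simp only [Desc, mul_inv_rev, affS_inv, Subgroup.coe_mul, Equiv.Perm.mul_apply, affS_apply,
    simpleRefl_self, simpleRefl_succ hm.out]
  omega

theorem len_affS_mul_of_desc {w : AffPerm m} {i : ℤ} (h : Desc w i) :
    len (affS i * w) + 1 = len w := by
  rw [← len_affS_mul (desc_affS_mul.not.2 (not_not.2 h)), affS_mul_cancel]

theorem len_affS_mul_lt {w : AffPerm m} {i : ℤ} (h : Desc w i) : len (affS i * w) < len w := by
  have := len_affS_mul_of_desc h
  omega

theorem len_affS_mul_le (w : AffPerm m) (i : ℤ) : len (affS i * w) ≤ len w + 1 := by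
  by_cases h : Desc w i
  · have := len_affS_mul_lt h
    omega
  · exact (len_affS_mul h).le

end Perm

/-! ### The double affine Hecke algebra is spanned by the elements `X^μ T_w` -/

section Algebra

variable (m : ℕ)

/-- The image of `q` in the double affine Hecke algebra. -/
def qD : DAHA m := algebraMap Base (DAHA m) qParam

instance : Ring (DAHA m) := Algebra.semiringToRing ℂ

variable {m}

theorem mkAlgHom_fT (i : ZMod m) : RingQuot.mkAlgHom Base (Rel m) (fT m i) = gen m (.T i) := rfl
theorem mkAlgHom_fX (i : ZMod m) : RingQuot.mkAlgHom Base (Rel m) (fX m i) = gen m (.X i) := rfl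
theorem mkAlgHom_fXinv (i : ZMod m) :
    RingQuot.mkAlgHom Base (Rel m) (fXinv m i) = gen m (.Xinv i) := rfl
theorem mkAlgHom_fPi : RingQuot.mkAlgHom Base (Rel m) (fPi m) = gen m .pi := rfl
theorem mkAlgHom_fPiInv : RingQuot.mkAlgHom Base (Rel m) (fPiInv m) = gen m .piInv := rfl

theorem mkAlgHom_eq {x y : FreeAlgebra Base (Gen m)} (h : Rel m x y) :
    RingQuot.mkAlgHom Base (Rel m) x = RingQuot.mkAlgHom Base (Rel m) y :=
  RingQuot.mkAlgHom_rel Base h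

theorem qParam_mul_inv : qParam * LaurentPolynomial.C (LaurentPolynomial.T (-1)) = 1 := by
  rw [qParam, ← map_mul, ← LaurentPolynomial.T_add]
  simp

theorem tParam_mul_inv : tParam * tParamInv = 1 := by
  rw [tParam, tParamInv, ← LaurentPolynomial.T_add]
  simp

/-- `q` as a unit of the base ring. -/
def qBase : Baseˣ := ⟨qParam, LaurentPolynomial.C (LaurentPolynomial.T (-1)), qParam_mul_inv,
  by rw [mul_comm, qParam_mul_inv]⟩

/-- `t` as a unit of the base ring. -/
def tBase : Baseˣ := ⟨tParam, tParamInv, tParam_mul_inv, by rw [mul_comm, tParam_mul_inv]⟩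

variable (m) in
/-- `π` as a unit. -/
def piU : (DAHA m)ˣ where
  val := gen m .pi
  inv := gen m .piInv
  val_inv := by simpa [mkAlgHom_fPi, mkAlgHom_fPiInv] using mkAlgHom_eq (Rel.pi_mul_inv (m := m))
  inv_val := by simpa [mkAlgHom_fPi, mkAlgHom_fPiInv] using mkAlgHom_eq (Rel.pi_inv_mul (m := m))

variable (m) in
/-- The generators `X_i`, `q`, `t` (in this order) as units. -/
def genU : ZMod m ⊕ Bool → (DAHA m)ˣ
  | .inl i => ⟨gen m (.X i), gen m (.Xinv i),
      by simpa [mkAlgHom_fX, mkAlgHom_fXinv] using mkAlgHom_eq (Rel.X_mul_inv i),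
      by simpa [mkAlgHom_fX, mkAlgHom_fXinv] using mkAlgHom_eq (Rel.X_inv_mul i)⟩
  | .inr false => Units.map (algebraMap Base (DAHA m)).toMonoidHom qBase
  | .inr true => Units.map (algebraMap Base (DAHA m)).toMonoidHom tBase

theorem genU_inl (i : ZMod m) : (genU m (.inl i) : DAHA m) = gen m (.X i) := rfl
theorem genU_q : (genU m (.inr false) : DAHA m) = qD m := rfl
theorem genU_t : (genU m (.inr true) : DAHA m) = algebraMap Base _ tParam := rfl
theorem genU_t_inv : (((genU m (.inr true))⁻¹ : (DAHA m)ˣ) : DAHA m) = algebraMap Base _ tParamInv :=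
  rfl

theorem genU_inr_commute (b : Bool) (x : DAHA m) : Commute (genU m (.inr b) : DAHA m) x := by
  cases b
  · exact Algebra.commutes _ _
  · exact Algebra.commutes _ _

theorem genU_commute (a b : ZMod m ⊕ Bool) : Commute (genU m a) (genU m b) := by
  refine Units.ext ?_
  rcases a with i | a
  · rcases b with j | b
    · have := mkAlgHom_eq (Rel.X_comm i j)
      simp only [map_mul, mkAlgHom_fX] at this
      exact this
    · exact ((genU_inr_commute b _).symm : Commute _ _)
  · exact genU_inr_commute a _

theorem gen_T_mul_self (i : ZMod m) :
    gen m (.T i) * gen m (.T i) = (qD m - 1) * gen m (.T i) + qD m := by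
  have h := mkAlgHom_eq (Rel.hecke i)
  simp only [map_mul, map_sub, map_add, map_one, map_zero, mkAlgHom_fT, AlgHom.commutes] at h
  change (gen m (.T i) - qD m) * (gen m (.T i) + 1) = 0 at h
  rw [sub_mul, mul_add, mul_add, mul_one, mul_one] at h
  rw [sub_mul, one_mul, ← sub_eq_zero, ← h]
  abel

theorem gen_T_braid (i : ZMod m) (hm : 2 < m) :
    gen m (.T i) * gen m (.T (i + 1)) * gen m (.T i)
      = gen m (.T (i + 1)) * gen m (.T i) * gen m (.T (i + 1)) := by
  simpa [mkAlgHom_fT] using mkAlgHom_eq (Rel.braid i (i + 1) hm (.inl rfl))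

theorem gen_T_comm (i j : ZMod m) (hij : ¬ (j = i + 1 ∨ j = i - 1)) :
    gen m (.T i) * gen m (.T j) = gen m (.T j) * gen m (.T i) := by
  simpa [mkAlgHom_fT] using mkAlgHom_eq (Rel.T_comm i j hij)

theorem gen_T_X_comm (i j : ZMod m) (h₁ : j ≠ i) (h₂ : j ≠ i + 1) :
    gen m (.T i) * gen m (.X j) = gen m (.X j) * gen m (.T i) := by
  simpa [mkAlgHom_fT, mkAlgHom_fX] using mkAlgHom_eq (Rel.T_X_comm i j h₁ h₂)

/-- The unit which shifts the index: `X_{i+1}`, or `t⁻¹ X_1` if `i = 0`. -/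
def nextX (i : ZMod m) : (DAHA m)ˣ :=
  if i = 0 then (genU m (.inr true))⁻¹ * genU m (.inl (i + 1)) else genU m (.inl (i + 1))

theorem gen_T_X_T (i : ZMod m) :
    gen m (.T i) * gen m (.X i) * gen m (.T i) = qD m * (nextX i : DAHA m) := by
  unfold nextX
  split_ifs with h
  · subst h
    have := mkAlgHom_eq (Rel.T_X_T_zero (m := m))
    simp only [map_mul, map_smul, mkAlgHom_fT, mkAlgHom_fX] at this
    rw [this, Units.val_mul, genU_t_inv, genU_inl, zero_add, qD, ← mul_assoc, ← map_mul,
      mul_comm qParam]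
    exact Algebra.smul_def (R := Base) (A := DAHA m) _ _
  · have := mkAlgHom_eq (Rel.T_X_T i h)
    simp only [map_mul, map_smul, mkAlgHom_fT, mkAlgHom_fX] at this
    exact this

theorem piU_conj_X (i : ZMod m) : piU m * genU m (.inl i) * (piU m)⁻¹ = nextX i := by
  refine Units.ext ?_
  unfold nextX
  split_ifs with h
  · subst h
    have := mkAlgHom_eq (Rel.pi_X_zero (m := m))
    simp only [map_mul, map_smul, mkAlgHom_fPi, mkAlgHom_fPiInv, mkAlgHom_fX] at this
    rw [Units.val_mul _ (genU m (.inl _)), genU_t_inv, genU_inl, zero_add, ← Algebra.smul_def]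
    exact this
  · have := mkAlgHom_eq (Rel.pi_X i h)
    simp only [map_mul, mkAlgHom_fPi, mkAlgHom_fPiInv, mkAlgHom_fX] at this
    exact this

theorem piU_mul_T (i : ZMod m) :
    (piU m : DAHA m) * gen m (.T i) = gen m (.T (i + 1)) * (piU m : DAHA m) := by
  have h : (piU m : DAHA m) * gen m (.T i) * ((piU m)⁻¹ : (DAHA m)ˣ) = gen m (.T (i + 1)) := by
    have := mkAlgHom_eq (Rel.pi_T i)
    simp only [map_mul, mkAlgHom_fPi, mkAlgHom_fPiInv, mkAlgHom_fT] at this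
    exact this
  rw [← h, Units.inv_mul_cancel_right]

theorem zpowersHom_genU_commute : Pairwise fun a b => ∀ x y : Multiplicative ℤ,
    Commute (zpowersHom (DAHA m)ˣ (genU m a) x) (zpowersHom (DAHA m)ˣ (genU m b) y) :=
  fun a b _ _ _ => (genU_commute a b).zpow_zpow _ _

end Algebra

/-! ### Monomials in the X_i, q, t, and how T_i and π move past them. -/

section Monomials

variable {m : ℕ} [hm : Fact (2 ≤ m)]

variable (m) in
/-- Exponents of the monomials in the `X_i`, `q` and `t`. -/
abbrev Exps : Type := ZMod m ⊕ Bool → Multiplicative ℤ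

variable (m) in
/-- The monomials in the `X_i`, `q` and `t`. -/
def mono : Exps m →* (DAHA m)ˣ :=
  MonoidHom.noncommPiCoprod (fun a => zpowersHom (DAHA m)ˣ (genU m a)) zpowersHom_genU_commute

/-- The exponent of a generator. -/
def expOne (a : ZMod m ⊕ Bool) : Exps m := Pi.mulSingle a (Multiplicative.ofAdd 1)

theorem mono_expOne (a : ZMod m ⊕ Bool) : mono m (expOne a) = genU m a := by
  rw [mono, expOne, MonoidHom.noncommPiCoprod_mulSingle]
  simp

/-- Serves as an induction principle: the exponents are finite products of integer powers of the
`expOne a`. -/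
theorem exps_mem (N : Submonoid (Exps m)) (h : ∀ a, expOne a ∈ N) (h' : ∀ a, (expOne a)⁻¹ ∈ N)
    (e : Exps m) : e ∈ N := by
  rw [← Finset.univ_prod_mulSingle e]
  refine Submonoid.prod_mem _ fun a _ => ?_
  have : ∀ k : ℤ, Pi.mulSingle a (Multiplicative.ofAdd k) = (expOne a : Exps m) ^ k := fun k => by
    rw [expOne, ← Pi.mulSingle_zpow, ← ofAdd_zsmul, smul_eq_mul, mul_one]
  change Pi.mulSingle a (Multiplicative.ofAdd (e a).toAdd) ∈ N
  rw [this]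
  rcases (e a).toAdd with k | k
  · simpa using pow_mem (h a) k
  · rw [zpow_negSucc, ← inv_pow]
    exact pow_mem (h' a) _

/-- The exponent of the monomial `nextX i`. -/
def nextExp (i : ZMod m) : Exps m :=
  if i = 0 then (expOne (.inr true))⁻¹ * expOne (.inl (i + 1)) else expOne (.inl (i + 1))

theorem mono_nextExp (i : ZMod m) : mono m (nextExp i) = nextX i := by
  unfold nextX nextExp
  split_ifs
  · simp [mono_expOne]
  · exact mono_expOne _

/-- Commutation rules in the affine Hecke algebra: from `T X T = q Y` deduce how `T` commutes with
`X`, `Y` and their inverses. -/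
theorem hecke_mul_unit {A : Type*} [Ring A] {T : A} {q X Y : Aˣ} (hq : ∀ x : A, (q : A) * x = x * q)
    (hTT : T * T = (q - 1) * T + q) (hTXT : T * X * T = q * Y) :
    T * (X : A) = Y * T - (q - 1) * Y ∧ T * (Y : A) = X * T + (q - 1) * Y ∧
    T * ((X⁻¹ : Aˣ) : A) = (Y⁻¹ : Aˣ) * T + (q - 1) * (X⁻¹ : Aˣ) ∧
    T * ((Y⁻¹ : Aˣ) : A) = (X⁻¹ : Aˣ) * T - (q - 1) * (X⁻¹ : Aˣ) := by
  have hq1 : ∀ x : A, ((q : A) - 1) * x = x * (q - 1) := fun x => by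
    rw [sub_mul, mul_sub, hq, one_mul, mul_one]
  have e1 : T * (X : A) = Y * T - (q - 1) * Y := by
    -- Multiply T X T = q Y on the right by T and expand T² by the quadratic relation. For `e2` the
    -- multiplication is on the left, and the two rules for inverses follow by clearing them.
    have h : (q : A) * Y * T = (q - 1) * (q * Y) + q * (T * X) := by
      rw [← hTXT, mul_assoc (T * (X : A)), hTT, mul_add, ← mul_assoc, ← hq1 (T * X),
        mul_assoc _ (T * (X : A)) T, hq (T * X)]
    rw [← Units.mul_right_inj q, mul_sub, ← mul_assoc (q : A) Y T, h, ← mul_assoc (q : A) _ (Y : A),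
      ← hq1, mul_assoc]
    abel
  have e2 : T * (Y : A) = X * T + (q - 1) * Y := by
    have h : (q : A) * (T * Y) = (q - 1) * (q * Y) + q * (X * T) := by
      rw [← mul_assoc, hq T, mul_assoc, ← hTXT, mul_assoc T X T, ← mul_assoc T T, hTT, add_mul,
        mul_assoc _ T]
    rw [← Units.mul_right_inj q, h, mul_add, ← mul_assoc (q : A) _ (Y : A), ← hq1, mul_assoc]
    abel
  refine ⟨e1, e2, ?_, ?_⟩
  · have h : (Y : A) * T = T * X + (q - 1) * Y := by rw [e1]; abel
    rw [← Units.mul_right_inj Y, mul_add, Units.mul_inv_cancel_left, ← mul_assoc, h, add_mul,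
      Units.mul_inv_cancel_right, ← mul_assoc (Y : A), ← hq1]
  · have h : (X : A) * T = T * Y - (q - 1) * Y := by rw [e2]; abel
    rw [← Units.mul_left_inj Y, Units.inv_mul_cancel_right, sub_mul, ← Units.mul_right_inj X,
      mul_sub, mul_assoc _ T, Units.mul_inv_cancel_left, h, mul_assoc _ _ (Y : A),
      ← mul_assoc (X : A), ← hq1 (X : A), mul_assoc, Units.mul_inv_cancel_left]

theorem conj_mono_mem {u : (DAHA m)ˣ} (h : ∀ a, u * genU m a * u⁻¹ ∈ (mono m).range)
    (e : Exps m) : u * mono m e * u⁻¹ ∈ (mono m).range := by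
  have h : ∀ a, expOne a ∈ Subgroup.comap ((MulAut.conj u).toMonoidHom.comp (mono m))
      (mono m).range := by
    intro a
    change u * mono m (expOne a) * u⁻¹ ∈ (mono m).range
    rw [mono_expOne]
    exact h a
  exact exps_mem (Subgroup.comap ((MulAut.conj u).toMonoidHom.comp (mono m))
    (mono m).range).toSubmonoid h (fun a => Subgroup.inv_mem _ (h a)) e

theorem conj_genU_inr (u : (DAHA m)ˣ) (b : Bool) :
    u * genU m (.inr b) * u⁻¹ ∈ (mono m).range := by
  refine ⟨expOne (.inr b), ?_⟩
  rw [mono_expOne, eq_mul_inv_iff_mul_eq]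
  exact Units.ext (genU_inr_commute b _)

/-- Conjugation by `π` preserves monomials. -/
theorem conj_piU_mono (e : Exps m) : piU m * mono m e * (piU m)⁻¹ ∈ (mono m).range := by
  refine conj_mono_mem (fun a => ?_) e
  rcases a with i | b
  · rw [piU_conj_X]
    exact ⟨_, mono_nextExp i⟩
  · exact conj_genU_inr _ b

/-- Conjugation by `π⁻¹` preserves monomials. -/
theorem conj_piU_inv_mono (e : Exps m) : (piU m)⁻¹ * mono m e * (piU m)⁻¹⁻¹ ∈ (mono m).range := by
  refine conj_mono_mem (fun a => ?_) e
  rcases a with i | b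
  · obtain ⟨j, rfl⟩ : ∃ j, i = j + 1 := ⟨i - 1, by ring⟩
    have h : (piU m)⁻¹ * nextX j * (piU m)⁻¹⁻¹ ∈ (mono m).range := by
      rw [← piU_conj_X, show (piU m)⁻¹ * (piU m * genU m (.inl j) * (piU m)⁻¹) * (piU m)⁻¹⁻¹
        = genU m (.inl j) by group]
      exact ⟨_, mono_expOne _⟩
    unfold nextX at h
    split_ifs at h
    -- For `j = 0` the unit `nextX j` carries a factor t⁻¹, which is cancelled by the central unit
    -- t.
    · have := mul_mem (conj_genU_inr (piU m)⁻¹ true) h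
      rwa [show (piU m)⁻¹ * genU m (.inr true) * (piU m)⁻¹⁻¹ *
        ((piU m)⁻¹ * ((genU m (.inr true))⁻¹ * genU m (.inl (j + 1))) * (piU m)⁻¹⁻¹)
        = (piU m)⁻¹ * genU m (.inl (j + 1)) * (piU m)⁻¹⁻¹ by group] at this
    · exact h
  · exact conj_genU_inr _ b

variable (m) in
/-- The commutative subalgebra spanned by the monomials in the `X_i`, `q`, `t`. -/
def polyPart : Subalgebra ℂ (DAHA m) := Algebra.adjoin ℂ (Set.range fun e => (mono m e : DAHA m))

theorem mono_mem (e : Exps m) : (mono m e : DAHA m) ∈ polyPart m :=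
  Algebra.subset_adjoin ⟨e, rfl⟩

theorem genU_mem (a : ZMod m ⊕ Bool) : (genU m a : DAHA m) ∈ polyPart m := by
  rw [← mono_expOne]
  exact mono_mem _

theorem qD_mem : qD m ∈ polyPart m := genU_mem (.inr false)

variable (m) in
/-- Monomials `p` with `T_i p` in `C T_i + C`, where `C` is the subalgebra of polynomials. -/
def skewMonomials (i : ZMod m) : Submonoid (Exps m) where
  carrier := {e | ∃ a ∈ polyPart m, ∃ b ∈ polyPart m,
    gen m (.T i) * (mono m e : DAHA m) = a * gen m (.T i) + b}
  one_mem' := ⟨1, one_mem _, 0, zero_mem _, by simp⟩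
  mul_mem' := by
    rintro e e' ⟨a, ha, b, hb, h⟩ ⟨a', ha', b', hb', h'⟩
    refine ⟨a * a', mul_mem ha ha', a * b' + b * mono m e',
      add_mem (mul_mem ha hb') (mul_mem hb (mono_mem _)), ?_⟩
    rw [map_mul, Units.val_mul, ← mul_assoc, h, add_mul, mul_assoc, h', mul_add, mul_assoc]
    abel

theorem mem_skewMonomials_of_commute {i : ZMod m} {e : Exps m}
    (h : Commute (gen m (.T i)) (mono m e : DAHA m)) : e ∈ skewMonomials m i :=
  ⟨mono m e, mono_mem _, 0, zero_mem _, by rw [add_zero]; exact h⟩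

/-- As the good exponents form a submonoid, it suffices to treat generators and inverses. `T_i`
commutes with all of them except those with index `i` or `i + 1`, for which `hecke_mul_unit` applies
to `X_i` and `nextX i`. -/
theorem mem_skewMonomials (i : ZMod m) (e : Exps m) : e ∈ skewMonomials m i := by
  have hy := mono_nextExp i
  set y := nextExp i with hyd
  obtain ⟨e1, e2, e3, e4⟩ := hecke_mul_unit (q := genU m (.inr false)) (X := genU m (.inl i))
    (Y := nextX i) (genU_inr_commute false) (gen_T_mul_self i) (gen_T_X_T i)
  set X : (DAHA m)ˣ := genU m (.inl i) with hX
  set Y : (DAHA m)ˣ := nextX i with hY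
  have hqm : qD m - 1 ∈ polyPart m := sub_mem qD_mem (one_mem _)
  have hXm : (X : DAHA m) ∈ polyPart m := genU_mem _
  have hXim : ((X⁻¹ : (DAHA m)ˣ) : DAHA m) ∈ polyPart m := by
    rw [hX, ← mono_expOne, ← map_inv]; exact mono_mem _
  have hYm : (Y : DAHA m) ∈ polyPart m := by rw [← hy]; exact mono_mem _
  have hYim : ((Y⁻¹ : (DAHA m)ˣ) : DAHA m) ∈ polyPart m := by
    rw [← hy, ← map_inv]; exact mono_mem _
  have mX : expOne (.inl i) ∈ skewMonomials m i :=
    ⟨Y, hYm, - ((qD m - 1) * Y), neg_mem (mul_mem hqm hYm), by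
      rw [mono_expOne, ← sub_eq_add_neg]; exact e1⟩
  have mX' : (expOne (.inl i))⁻¹ ∈ skewMonomials m i :=
    ⟨_, hYim, _, mul_mem hqm hXim, by rw [map_inv, mono_expOne]; exact e3⟩
  have mY : y ∈ skewMonomials m i :=
    ⟨X, hXm, _, mul_mem hqm hYm, by rw [hy]; exact e2⟩
  have mY' : y⁻¹ ∈ skewMonomials m i :=
    ⟨_, hXim, - ((qD m - 1) * (X⁻¹ : (DAHA m)ˣ)), neg_mem (mul_mem hqm hXim), by
      rw [map_inv, hy, ← sub_eq_add_neg]; exact e4⟩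
  have mc : ∀ b, expOne (.inr b) ∈ skewMonomials m i := fun b =>
    mem_skewMonomials_of_commute (by rw [mono_expOne]; exact (genU_inr_commute b _).symm)
  have mc' : ∀ b, (expOne (.inr b))⁻¹ ∈ skewMonomials m i := fun b =>
    mem_skewMonomials_of_commute (by
      rw [map_inv, mono_expOne]; exact (genU_inr_commute b _).symm.units_inv_right)
  refine exps_mem _ (fun a => ?_) (fun a => ?_) e
  · rcases a with j | b
    · by_cases h1 : j = i
      · rwa [h1]
      by_cases h2 : j = i + 1
      · rw [h2]
        unfold nextExp at hyd
        split_ifs at hyd with h0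
        · rw [show expOne (.inl (i + 1)) = expOne (.inr true) * y by rw [hyd]; group]
          exact mul_mem (mc _) mY
        · rwa [← hyd]
      · exact mem_skewMonomials_of_commute (by rw [mono_expOne]; exact gen_T_X_comm i j h1 h2)
    · exact mc b
  · rcases a with j | b
    · by_cases h1 : j = i
      · rwa [h1]
      by_cases h2 : j = i + 1
      · rw [h2]
        unfold nextExp at hyd
        split_ifs at hyd with h0
        · rw [show (expOne (.inl (i + 1)))⁻¹ = y⁻¹ * (expOne (.inr true))⁻¹ by rw [hyd]; group]
          exact mul_mem mY' (mc' _)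
        · rwa [← hyd]
      · refine mem_skewMonomials_of_commute ?_
        rw [map_inv, mono_expOne]
        exact (show Commute _ _ from gen_T_X_comm i j h1 h2).units_inv_right
    · exact mc' b

end Monomials

/-! ### The elements T_w and left multiplication on them. -/

section StandardBasis

variable {m : ℕ}

variable (m) in
/-- The generator `T_i`, for an integer `i`. -/
def gT (i : ℤ) : DAHA m := gen m (.T i)

theorem gT_congr {i j : ℤ} (h : (m : ℤ) ∣ i - j) : gT m i = gT m j := by
  have : (i : ZMod m) = j := by
    rw [ZMod.intCast_eq_intCast_iff_dvd_sub, ← dvd_neg, neg_sub]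
    exact h
  rw [gT, gT, this]

theorem gT_mul_self (i : ℤ) : gT m i * gT m i = (qD m - 1) * gT m i + qD m := gen_T_mul_self _

theorem gT_braid (h3 : 3 ≤ m) (i : ℤ) :
    gT m i * gT m (i + 1) * gT m i = gT m (i + 1) * gT m i * gT m (i + 1) := by
  simpa [gT] using gen_T_braid (i : ZMod m) h3

theorem gT_comm {i j : ℤ} (h₁ : ¬ (m : ℤ) ∣ j - (i + 1)) (h₂ : ¬ (m : ℤ) ∣ i - (j + 1)) :
    gT m i * gT m j = gT m j * gT m i := by
  refine gen_T_comm _ _ ?_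
  rintro (h | h)
  · refine h₁ ?_
    rw [← ZMod.intCast_zmod_eq_zero_iff_dvd]
    push_cast
    rw [h, sub_self]
  · refine h₂ ?_
    rw [← ZMod.intCast_zmod_eq_zero_iff_dvd]
    push_cast
    rw [h]
    ring

theorem piU_mul_gT (i : ℤ) : (piU m : DAHA m) * gT m i = gT m (i + 1) * (piU m : DAHA m) := by
  simpa [gT] using piU_mul_T (i : ZMod m)

theorem affPerm_inv_mul_apply (u w : AffPerm m) (z : ℤ) : (u * w)⁻¹.1 z = w⁻¹.1 (u⁻¹.1 z) := by
  rw [mul_inv_rev]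
  rfl

theorem desc_mul_iff (u w : AffPerm m) (i : ℤ) :
    Desc (u * w) i ↔ w⁻¹.1 (u⁻¹.1 (i + 1)) < w⁻¹.1 (u⁻¹.1 i) := by
  rw [Desc, mul_inv_rev]
  rfl

variable [hm : Fact (2 ≤ m)]

open Classical in
/-- The element `T_w`, defined by successively splitting off descents. -/
def Tw (w : AffPerm m) : DAHA m :=
  if h : ∃ i : ℤ, Desc w i then gT m h.choose * Tw (affS h.choose * w)
  else ((piU m ^ w.1 0 : (DAHA m)ˣ) : DAHA m)
termination_by len w
decreasing_by exact len_affS_mul_lt h.choose_spec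

theorem Tw_of_not_desc {w : AffPerm m} (h : ∀ i, ¬ Desc w i) :
    Tw w = ((piU m ^ w.1 0 : (DAHA m)ˣ) : DAHA m) := by
  rw [Tw, dif_neg (by simpa using h)]

theorem exists_Tw_eq {w : AffPerm m} {i : ℤ} (h : Desc w i) :
    ∃ j, Desc w j ∧ Tw w = gT m j * Tw (affS j * w) := by
  have h' : ∃ i : ℤ, Desc w i := ⟨i, h⟩
  exact ⟨_, h'.choose_spec, by rw [Tw, dif_pos h']⟩

/-- For `m = 2`, periodicity gives w⁻¹(i + 2) = w⁻¹(i) + 2, whereas two consecutive descents would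
give w⁻¹(i + 2) < w⁻¹(i). -/
theorem three_le_of_desc {w : AffPerm m} {i : ℤ} (h : Desc w i) (h' : Desc w (i + 1)) : 3 ≤ m := by
  by_contra hlt
  have h2 : (m : ℤ) = 2 := by have := hm.out; omega
  have := affPerm_map_add w⁻¹ i
  unfold Desc at h h'
  rw [h2, ← one_add_one_eq_two, ← add_assoc] at this
  omega

/-- The recursion for `T_w` holds for every descent. -/
theorem Tw_eq {w : AffPerm m} {i : ℤ} (h : Desc w i) : Tw w = gT m i * Tw (affS i * w) := by
  -- The definition of `Tw` picks an arbitrary descent. Independence of the choice is a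
  -- Matsumoto-type argument: any two descents are compared through a braid or a commutation
  -- relation, using the recursion for shorter elements.
  induction hn : len w using Nat.strong_induction_on generalizing w i with
  | _ n ih =>
  subst hn
  -- With adjacent descents, `w` has reduced expressions beginning with s_i s_{i+1} s_i and with
  -- s_{i+1} s_i s_{i+1}. The induction hypothesis splits off two more factors on each side.
  have adj : ∀ i, Desc w i → Desc w (i + 1) →
      gT m i * Tw (affS i * w) = gT m (i + 1) * Tw (affS (i + 1) * w) := by
    intro i h h'
    have h3 := three_le_of_desc h h'
    obtain ⟨n1, n2⟩ := three_le_not_dvd h3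
    have v1 : simpleRefl m i (i + 1 + 1) = i + 1 + 1 :=
      simpleRefl_of_not_dvd (by rw [show i + 1 + 1 - i = 2 by ring]; exact n2)
        (by rw [show i + 1 + 1 - (i + 1) = 1 by ring]; exact n1)
    have v2 : simpleRefl m (i + 1) i = i :=
      simpleRefl_of_not_dvd (by rw [show i - (i + 1) = -1 by ring]; rwa [dvd_neg])
        (by rw [show i - (i + 1 + 1) = -2 by ring]; rwa [dvd_neg])
    have v3 : simpleRefl m (i + 1) (i + 1 + 1) = i + 1 := simpleRefl_succ hm.out
    have v4 : simpleRefl m i (i + 1) = i := simpleRefl_succ hm.out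
    have d1 : Desc (affS i * w) (i + 1) := by
      rw [desc_mul_iff, affS_inv, affS_apply, affS_apply, v1, v4]
      exact h'.trans h
    have d2 : Desc (affS (i + 1) * (affS i * w)) i := by
      rw [desc_mul_iff, affPerm_inv_mul_apply, affPerm_inv_mul_apply, affS_inv, affS_inv, affS_apply, affS_apply, affS_apply,
        affS_apply, simpleRefl_self, v1, v2, simpleRefl_self]
      exact h'
    have d3 : Desc (affS (i + 1) * w) i := by
      rw [desc_mul_iff, affS_inv, affS_apply, affS_apply, simpleRefl_self, v2]
      exact h'.trans h
    have d4 : Desc (affS i * (affS (i + 1) * w)) (i + 1) := by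
      rw [desc_mul_iff, affPerm_inv_mul_apply, affPerm_inv_mul_apply, affS_inv, affS_inv, affS_apply, affS_apply, affS_apply,
        affS_apply, v1, v3, v4, v2]
      exact h
    have l1 := len_affS_mul_lt h
    have l2 := len_affS_mul_lt h'
    have l3 := len_affS_mul_lt d1
    have l4 := len_affS_mul_lt d3
    rw [ih _ l1 d1 rfl, ih _ (l3.trans l1) d2 rfl, ih _ l2 d3 rfl, ih _ (l4.trans l2) d4 rfl]
    have e := affS_braid (m := m) h3 i
    have e' : affS i * (affS (i + 1) * (affS i * w)) = affS (i + 1) * (affS i * (affS (i + 1) * w)) := by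
      simp only [← mul_assoc, e]
    rw [e']
    simp only [← mul_assoc, gT_braid h3 i]
  have all : ∀ i j, Desc w i → Desc w j → gT m i * Tw (affS i * w) = gT m j * Tw (affS j * w) := by
    intro i j hi hj
    by_cases h0 : (m : ℤ) ∣ i - j
    · rw [gT_congr h0, affS_congr h0]
    by_cases h1 : (m : ℤ) ∣ j - (i + 1)
    · rw [gT_congr h1, affS_congr h1]
      exact adj i hi ((desc_congr h1).1 hj)
    by_cases h2 : (m : ℤ) ∣ i - (j + 1)
    · rw [gT_congr h2, affS_congr h2]
      exact (adj j hj ((desc_congr h2).1 hi)).symm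
    -- For distant descents, each remains a descent after the other has been split off.
    · have fix : ∀ a b : ℤ, ¬ (m : ℤ) ∣ a - b → ¬ (m : ℤ) ∣ b - (a + 1) → ¬ (m : ℤ) ∣ a - (b + 1) →
          simpleRefl m a b = b ∧ simpleRefl m a (b + 1) = b + 1 := by
        intro a b h0 h1 h2
        constructor
        · exact simpleRefl_of_not_dvd (by rwa [← dvd_neg, neg_sub]) h1
        · refine simpleRefl_of_not_dvd (by rwa [← dvd_neg, neg_sub]) ?_
          rwa [add_sub_add_right_eq_sub, ← dvd_neg, neg_sub]
      obtain ⟨f1, f2⟩ := fix i j h0 h1 h2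
      obtain ⟨f3, f4⟩ := fix j i (by rwa [← dvd_neg, neg_sub]) h2 h1
      have d1 : Desc (affS i * w) j := by
        rw [desc_mul_iff, affS_inv, affS_apply, affS_apply, f1, f2]
        exact hj
      have d2 : Desc (affS j * w) i := by
        rw [desc_mul_iff, affS_inv, affS_apply, affS_apply, f3, f4]
        exact hi
      rw [ih _ (len_affS_mul_lt hi) d1 rfl, ih _ (len_affS_mul_lt hj) d2 rfl, ← mul_assoc,
        ← mul_assoc, ← mul_assoc, ← mul_assoc, gT_comm h1 h2, affS_comm h1 h2]
  obtain ⟨j, hj, e⟩ := exists_Tw_eq h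
  rw [e]
  exact all j i hj h

theorem gT_mul_Tw_of_not_desc {w : AffPerm m} {i : ℤ} (h : ¬ Desc w i) :
    gT m i * Tw w = Tw (affS i * w) := by
  rw [Tw_eq (desc_affS_mul.2 h), affS_mul_cancel]

theorem gT_mul_Tw_of_desc {w : AffPerm m} {i : ℤ} (h : Desc w i) :
    gT m i * Tw w = (qD m - 1) * Tw w + qD m * Tw (affS i * w) := by
  rw [Tw_eq h, ← mul_assoc, gT_mul_self, add_mul, mul_assoc]

theorem piU_mul_Tw (w : AffPerm m) : (piU m : DAHA m) * Tw w = Tw (affPi m * w) := by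
  induction hn : len w using Nat.strong_induction_on generalizing w with
  | _ n ih =>
  subst hn
  by_cases h : ∃ i, Desc w i
  · obtain ⟨i, hi⟩ := h
    rw [Tw_eq hi, Tw_eq (desc_affPi_mul.2 hi), ← mul_assoc, piU_mul_gT, mul_assoc,
      ih _ (len_affS_mul_lt hi) _ rfl, ← mul_assoc, ← mul_assoc, affPi_mul_affS, mul_assoc (affS _)]
  · rw [not_exists] at h
    rw [Tw_of_not_desc h, Tw_of_not_desc, ← Units.val_mul, ← zpow_one_add]
    · congr 2
      simp [add_comm]
    · intro i hi
      rw [← sub_add_cancel i 1, desc_affPi_mul] at hi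
      exact h _ hi

theorem piU_inv_mul_Tw (w : AffPerm m) :
    (((piU m)⁻¹ : (DAHA m)ˣ) : DAHA m) * Tw w = Tw ((affPi m)⁻¹ * w) := by
  rw [Units.inv_mul_eq_iff_eq_mul, piU_mul_Tw, mul_inv_cancel_left]

theorem Tw_one : Tw (1 : AffPerm m) = 1 := by
  rw [Tw_of_not_desc]
  · simp
  · intro i hi
    simp [Desc] at hi

end StandardBasis

/-! ### The standard elements span over ℂ. -/

section Spanning

variable {m : ℕ} [hm : Fact (2 ≤ m)]

variable (m) in
/-- The products of monomials and the elements `T_w`. -/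
def stdElt (p : Exps m × AffPerm m) : DAHA m := (mono m p.1 : DAHA m) * Tw p.2

variable (m) in
/-- The span of the products of monomials and the elements `T_w`. -/
def stdSpan : Submodule ℂ (DAHA m) := Submodule.span ℂ (Set.range (stdElt m))

theorem stdElt_mem (e : Exps m) (w : AffPerm m) : (mono m e : DAHA m) * Tw w ∈ stdSpan m :=
  Submodule.subset_span ⟨(e, w), rfl⟩

theorem Tw_mem (w : AffPerm m) : Tw w ∈ stdSpan m := by
  simpa using stdElt_mem 1 w

/-- To show that left multiplication by `y` preserves the span it suffices to look at the
spanning elements. -/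
theorem mul_mem_stdSpan {y : DAHA m}
    (h : ∀ e w, y * ((mono m e : DAHA m) * Tw w) ∈ stdSpan m) {x : DAHA m} (hx : x ∈ stdSpan m) :
    y * x ∈ stdSpan m := by
  induction hx using Submodule.span_induction with
  | mem x hx => obtain ⟨p, rfl⟩ := hx; exact h _ _
  | zero => rw [mul_zero]; exact zero_mem _
  | add x z _ _ hx hz => rw [mul_add]; exact add_mem hx hz
  | smul c x _ hx => rw [mul_smul_comm]; exact Submodule.smul_mem _ _ hx

theorem polyPart_mul_mem {y : DAHA m} (hy : y ∈ polyPart m) {x : DAHA m} (hx : x ∈ stdSpan m) :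
    y * x ∈ stdSpan m := by
  induction hy using Algebra.adjoin_induction generalizing x with
  | mem y hy =>
    obtain ⟨e, rfl⟩ := hy
    refine mul_mem_stdSpan (fun e' w => ?_) hx
    rw [← mul_assoc, ← Units.val_mul, ← map_mul]
    exact stdElt_mem _ _
  | algebraMap c => rw [← Algebra.smul_def]; exact Submodule.smul_mem _ _ hx
  | add y z _ _ hy hz => rw [add_mul]; exact add_mem (hy hx) (hz hx)
  | mul y z _ _ hy hz => rw [mul_assoc]; exact hy (hz hx)

theorem gT_mul_Tw_mem (i : ℤ) (w : AffPerm m) : gT m i * Tw w ∈ stdSpan m := by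
  by_cases h : Desc w i
  · rw [gT_mul_Tw_of_desc h]
    exact add_mem (polyPart_mul_mem (sub_mem qD_mem (one_mem _)) (Tw_mem _))
      (polyPart_mul_mem qD_mem (Tw_mem _))
  · rw [gT_mul_Tw_of_not_desc h]
    exact Tw_mem _

theorem gen_mul_mem (g : Gen m) {x : DAHA m} (hx : x ∈ stdSpan m) : gen m g * x ∈ stdSpan m := by
  cases g with
  | T i =>
    refine mul_mem_stdSpan (fun e w => ?_) hx
    obtain ⟨a, ha, b, hb, h⟩ := mem_skewMonomials i e
    obtain ⟨j, rfl⟩ := ZMod.intCast_surjective i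
    rw [← mul_assoc, h, add_mul, mul_assoc]
    exact add_mem (polyPart_mul_mem ha (gT_mul_Tw_mem j w)) (polyPart_mul_mem hb (Tw_mem w))
  | X i => exact polyPart_mul_mem (genU_mem (.inl i)) hx
  | Xinv i =>
    refine polyPart_mul_mem ?_ hx
    have := mono_mem (expOne (.inl i))⁻¹
    rwa [map_inv, mono_expOne] at this
  | pi =>
    refine mul_mem_stdSpan (fun e w => ?_) hx
    obtain ⟨e', h⟩ := conj_piU_mono e
    have h' : (piU m : DAHA m) * mono m e = mono m e' * piU m := by
      rw [← Units.val_mul, ← Units.val_mul, h, inv_mul_cancel_right]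
    change (piU m : DAHA m) * _ ∈ _
    rw [← mul_assoc, h', mul_assoc, piU_mul_Tw]
    exact stdElt_mem _ _
  | piInv =>
    refine mul_mem_stdSpan (fun e w => ?_) hx
    obtain ⟨e', h⟩ := conj_piU_inv_mono e
    have h' : (((piU m)⁻¹ : (DAHA m)ˣ) : DAHA m) * mono m e = mono m e' * ((piU m)⁻¹ : (DAHA m)ˣ) := by
      rw [← Units.val_mul, ← Units.val_mul, h, inv_inv, mul_assoc, mul_assoc, mul_inv_cancel, mul_one]
    change (((piU m)⁻¹ : (DAHA m)ˣ) : DAHA m) * _ ∈ _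
    rw [← mul_assoc, h', mul_assoc, piU_inv_mul_Tw]
    exact stdElt_mem _ _

/-- The spanning is over ℂ, because q and t act by different scalars on different summands. The base
ring must therefore be absorbed into the monomials, which contain all powers of q and t. -/
theorem algebraMap_mem_polyPart (r : Base) : algebraMap Base (DAHA m) r ∈ polyPart m := by
  have inv_mem : ∀ a, (((genU m a)⁻¹ : (DAHA m)ˣ) : DAHA m) ∈ polyPart m := fun a => by
    rw [← mono_expOne, ← map_inv]
    exact mono_mem _
  have tmem : ∀ n : ℤ, algebraMap Base (DAHA m) (LaurentPolynomial.T n) ∈ polyPart m := by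
    intro n
    obtain ⟨k, rfl | rfl⟩ := n.eq_nat_or_neg
    · rw [show (LaurentPolynomial.T (k : ℤ) : Base) = LaurentPolynomial.T 1 ^ k by
        rw [LaurentPolynomial.T_pow, mul_one], map_pow]
      exact pow_mem (genU_mem (.inr true)) k
    · rw [show (LaurentPolynomial.T (-k : ℤ) : Base) = LaurentPolynomial.T (-1) ^ k by
        rw [LaurentPolynomial.T_pow, mul_neg_one], map_pow]
      exact pow_mem (inv_mem (.inr true)) k
  have qmem : ∀ n : ℤ, algebraMap Base (DAHA m) (LaurentPolynomial.C (LaurentPolynomial.T n))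
      ∈ polyPart m := by
    intro n
    obtain ⟨k, rfl | rfl⟩ := n.eq_nat_or_neg
    · rw [show (LaurentPolynomial.T (k : ℤ) : LaurentPolynomial ℂ) = LaurentPolynomial.T 1 ^ k by
        rw [LaurentPolynomial.T_pow, mul_one], map_pow, map_pow]
      exact pow_mem (genU_mem (.inr false)) k
    · rw [show (LaurentPolynomial.T (-k : ℤ) : LaurentPolynomial ℂ) = LaurentPolynomial.T (-1) ^ k by
        rw [LaurentPolynomial.T_pow, mul_neg_one], map_pow, map_pow]
      exact pow_mem (inv_mem (.inr false)) k
  have cmem : ∀ p : LaurentPolynomial ℂ, algebraMap Base (DAHA m) (LaurentPolynomial.C p)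
      ∈ polyPart m := by
    intro p
    induction p using LaurentPolynomial.induction_on' with
    | add p q hp hq => rw [map_add, map_add]; exact add_mem hp hq
    | C_mul_T n a =>
      rw [map_mul, map_mul]
      exact mul_mem (Subalgebra.algebraMap_mem (polyPart m) a) (qmem n)
  induction r using LaurentPolynomial.induction_on' with
  | add p q hp hq => rw [map_add]; exact add_mem hp hq
  | C_mul_T n a => rw [map_mul]; exact mul_mem (cmem a) (tmem n)

/-- The span contains 1 and is stable under left multiplication by all generators and scalars. -/
theorem stdSpan_eq_top : stdSpan m = ⊤ := by
  rw [eq_top_iff]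
  rintro y -
  obtain ⟨f, rfl⟩ := RingQuot.mkAlgHom_surjective Base (Rel m) y
  suffices h : ∀ x ∈ stdSpan m, RingQuot.mkAlgHom Base (Rel m) f * x ∈ stdSpan m by
    simpa using h 1 (by rw [← Tw_one]; exact Tw_mem 1)
  induction f using FreeAlgebra.induction with
  | grade0 r => 
    intro x hx
    rw [AlgHom.commutes]
    exact polyPart_mul_mem (algebraMap_mem_polyPart r) hx
  | grade1 g => exact fun x hx => gen_mul_mem g hx
  | mul a b ha hb =>
    intro x hx
    rw [map_mul, mul_assoc]
    exact ha _ (hb _ hx)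
  | add a b ha hb =>
    intro x hx
    rw [map_add, add_mul]
    exact add_mem (ha _ hx) (hb _ hx)

/-- Every element of the double affine Hecke algebra is a linear combination of standard
elements. -/
theorem exists_eq_linearCombination (y : DAHA m) :
    ∃ c : Exps m × AffPerm m →₀ ℂ, Finsupp.linearCombination ℂ (stdElt m) c = y := by
  have : y ∈ stdSpan m := by rw [stdSpan_eq_top]; trivial
  rwa [stdSpan, ← Finsupp.range_linearCombination] at this

end Spanning

/-! ### Cells of standard tableaux -/

section Cells

variable {m : ℕ} {D : Datum m}

theorem DPT.toFun_add_period (σ : DPT D) (k x y : ℤ) :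
    σ.toFun (x + k * D.K, y - k * D.N) = σ.toFun (x, y) := by
  induction k with
  | zero => simp
  | succ k ih =>
    rw [← ih, ← σ.periodic (x + k * D.K)]
    congr 2 <;> ring
  | pred k ih =>
    rw [← ih, ← σ.periodic (x + (-k - 1 : ℤ) * D.K)]
    congr 2 <;> ring

/-- Each unit step raises an integer label by at least one. This limits how far apart the cells of
nearby labels can be. -/
theorem DPT.add_le (σ : DPT D) (x y : ℤ) (k l : ℕ) :
    σ.toFun (x, y) + k + l ≤ σ.toFun (x + k, y + l) := by
  induction k with
  | zero =>
    induction l with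
    | zero => simp
    | succ l ih =>
      have := σ.lt_down (x + (0 : ℕ)) (y + l)
      push_cast at *
      rw [← add_assoc y]
      omega
  | succ k ih =>
    have := σ.lt_right (x + k) (y + l)
    push_cast at *
    rw [← add_assoc x] at *
    omega

/-- The linear map with columns `(K, -N)` and `(a, -b)`. -/
def Datum.latticeMap (D : Datum m) : (Fin 2 → ℤ) →ₗ[ℤ] (Fin 2 → ℤ) :=
  Matrix.toLin' !![D.K, D.a; -D.N, -D.b]

theorem Datum.det_latticeMap (D : Datum m) : LinearMap.det D.latticeMap = m := by
  rw [Datum.latticeMap, LinearMap.det_toLin', Matrix.det_fin_two_of, ← D.det]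
  ring

theorem Datum.latticeMap_apply (D : Datum m) (v : Fin 2 → ℤ) :
    D.latticeMap v = ![v 0 * D.K + v 1 * D.a, -(v 0 * D.N) - v 1 * D.b] := by
  ext i
  fin_cases i <;> simp [Datum.latticeMap, Matrix.vecHead, Matrix.vecTail] <;> ring

/-- The cells with a given label of a standard tableau form an orbit of `(K, -N)`. -/
theorem DPT.fiber [NeZero m] (σ : DPT D) {c d : ℤ × ℤ} (h : σ.toFun c = σ.toFun d) :
    ∃ k : ℤ, d.1 = c.1 + k * D.K ∧ d.2 = c.2 - k * D.N := by
  have hm0 : (m : ℤ) ≠ 0 := by exact_mod_cast NeZero.ne m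
  have hinj : Function.Injective D.latticeMap :=
    by
    refine Matrix.mulVec_injective_of_det_ne_zero ?_
    rw [← LinearMap.det_toLin']
    exact D.det_latticeMap.trans_ne hm0
  -- The lattice spanned by (K,-N) and (a,-b) has index equal to its determinant aN - bK = m.
  have hcard : Nat.card ((Fin 2 → ℤ) ⧸ LinearMap.range D.latticeMap) = m := by
    have := Submodule.natAbs_det_equiv _ (LinearEquiv.ofInjective D.latticeMap hinj)
    rwa [show (LinearMap.range D.latticeMap).subtype ∘ₗ AddMonoidHom.toIntLinearMap
      ((LinearEquiv.ofInjective D.latticeMap hinj : (Fin 2 → ℤ) →+ LinearMap.range D.latticeMap))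
      = D.latticeMap from rfl, D.det_latticeMap, Int.natAbs_natCast, eq_comm] at this
  have hperiod : ∀ x y k l : ℤ, σ.toFun (x + (k * D.K + l * D.a), y + (-(k * D.N) - l * D.b))
      = σ.toFun (x, y) + l * m := fun x y k l => by
    rw [← σ.toFun_add_mul, ← σ.toFun_add_period k (x + l * D.a)]
    congr 2 <;> ring
  have hwd : ∀ v w : Fin 2 → ℤ, v - w ∈ LinearMap.range D.latticeMap →
      ∃ k l : ℤ, v 0 = w 0 + (k * D.K + l * D.a) ∧ v 1 = w 1 + (-(k * D.N) - l * D.b) := by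
    rintro v w ⟨u, hu⟩
    rw [D.latticeMap_apply] at hu
    have h0 := congrFun hu 0
    have h1 := congrFun hu 1
    simp at h0 h1
    exact ⟨u 0, u 1, by linarith, by linarith⟩
  -- Labels modulo `m` descend to the quotient by this lattice. The resulting map is surjective
  -- between sets with `m` elements, hence injective, so cells with equal labels differ by a lattice
  -- vector.
  let f : (Fin 2 → ℤ) ⧸ LinearMap.range D.latticeMap → ZMod m :=
    Quotient.lift (fun v => ((σ.toFun (v 0, v 1) : ℤ) : ZMod m)) (by
      intro v w hvw
      obtain ⟨k, l, h0, h1⟩ := hwd v w ((Submodule.quotientRel_def _).1 hvw)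
      simp only [h0, h1, hperiod]
      push_cast
      simp)
  have hf : ∀ v, f (Submodule.Quotient.mk v) = ((σ.toFun (v 0, v 1) : ℤ) : ZMod m) := fun v => rfl
  have hsurj : Function.Surjective f := by
    intro z
    obtain ⟨i, rfl⟩ := ZMod.intCast_surjective z
    obtain ⟨e, he⟩ := σ.surjective i
    exact ⟨Submodule.Quotient.mk ![e.1, e.2], by rw [hf]; simp [he]⟩
  have : Finite ((Fin 2 → ℤ) ⧸ LinearMap.range D.latticeMap) :=
    Nat.finite_of_card_ne_zero (by rw [hcard]; exact NeZero.ne m)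
  have hbij : Function.Bijective f := by
    rw [Nat.bijective_iff_surjective_and_card]
    exact ⟨hsurj, by rw [hcard, Nat.card_zmod]⟩
  have heq := hbij.1 (a₁ := Submodule.Quotient.mk ![d.1, d.2]) (a₂ := Submodule.Quotient.mk ![c.1, c.2])
    (by rw [hf, hf]; simp [h])
  obtain ⟨k, l, h0, h1⟩ := hwd _ _ ((Submodule.Quotient.eq _).1 heq)
  simp at h0 h1
  have hl := hperiod c.1 c.2 k l
  rw [← h0, ← h1] at hl
  change σ.toFun d = σ.toFun c + l * m at hl
  rw [h] at hl
  -- The (a,-b) component shifts the label by `l * m`, so it is zero for equal labels.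
  have : l = 0 := by
    rcases mul_eq_zero.1 (show l * (m : ℤ) = 0 by linarith) with h | h
    · exact h
    · exact absurd h hm0
  subst this
  exact ⟨k, by linarith, by linarith⟩

end Cells

/-! ### Tableaux which need not be standard -/

theorem zeta_ne_zero {m : ℕ} {D : Datum m} {ζ : ℂ}
    (hζ : IsPrimitiveRoot ζ (D.K + D.N).toNat) : ζ ≠ 0 :=
  hζ.ne_zero (by have := D.K_pos; have := D.N_pos; omega)

/-- Surjective fillings of the cylinder `ℤ² / (K, -N)` by the integers, without repetitions. -/
structure PT {m : ℕ} (D : Datum m) where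
  toFun : ℤ × ℤ → ℤ
  surjective : Function.Surjective toFun
  fiber : ∀ c d, toFun c = toFun d ↔ ∃ k : ℤ, d.1 = c.1 + k * D.K ∧ d.2 = c.2 - k * D.N

namespace PT

variable {m : ℕ} {D : Datum m}

/-- The weight `ζ^{x - y}` of a label `i` at the cell `(x, y)`. -/
def weight (ζ : ℂ) (p : PT D) (i : ℤ) : ℂ :=
  ζ ^ ((Function.surjInv p.surjective i).1 - (Function.surjInv p.surjective i).2)

/-- Permutations of `ℤ` act on fillings. -/
def act (g : Equiv.Perm ℤ) (p : PT D) : PT D where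
  toFun c := g (p.toFun c)
  surjective := g.surjective.comp p.surjective
  fiber c d := by rw [g.injective.eq_iff, p.fiber]

theorem act_mul (g h : Equiv.Perm ℤ) (p : PT D) : act (g * h) p = act g (act h p) := rfl

theorem act_injective (p : PT D) : Function.Injective fun g : Equiv.Perm ℤ => act g p := by
  intro g h e
  ext i
  obtain ⟨c, rfl⟩ := p.surjective i
  exact congrFun (congrArg PT.toFun e) c

/-- Moving by (K,-N) changes x - y by K + N, the order of ζ, so any cell with label `i` computes the
weight. -/
theorem weight_eq {ζ : ℂ} (hζ : IsPrimitiveRoot ζ (D.K + D.N).toNat) (p : PT D) {i : ℤ} {c : ℤ × ℤ}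
    (h : p.toFun c = i) : p.weight ζ i = ζ ^ (c.1 - c.2) := by
  have h' : p.toFun c = p.toFun (Function.surjInv p.surjective i) := by
    rw [h, Function.surjInv_eq p.surjective]
  obtain ⟨k, h1, h2⟩ := (p.fiber _ _).1 h'
  have hpos : 0 < D.K + D.N := add_pos D.K_pos D.N_pos
  have hz := zeta_ne_zero hζ
  have h1' : ζ ^ (D.K + D.N) = 1 := by
    have := hζ.pow_eq_one
    rwa [← zpow_natCast, Int.toNat_of_nonneg hpos.le] at this
  rw [weight, h1, h2, show c.1 + k * D.K - (c.2 - k * D.N) = c.1 - c.2 + (D.K + D.N) * k by ring,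
    zpow_add₀ hz, zpow_mul, h1', one_zpow, mul_one]

theorem weight_act {ζ : ℂ} (hζ : IsPrimitiveRoot ζ (D.K + D.N).toNat) (g : Equiv.Perm ℤ) (p : PT D)
    (i : ℤ) : (act g p).weight ζ i = p.weight ζ (g⁻¹ i) := by
  obtain ⟨c, hc⟩ := p.surjective (g⁻¹ i)
  rw [p.weight_eq hζ hc, (act g p).weight_eq hζ (c := c)]
  change g (p.toFun c) = i
  rw [hc]
  exact g.apply_symm_apply i

theorem weight_ne_zero {ζ : ℂ} (hζ : ζ ≠ 0) (p : PT D) (i : ℤ) : p.weight ζ i ≠ 0 :=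
  zpow_ne_zero _ hζ

end PT

namespace DPT

variable {m : ℕ} {D : Datum m}

theorem ne_one {ζ : ℂ} (hζ : IsPrimitiveRoot ζ (D.K + D.N).toNat) : ζ ≠ 1 :=
  hζ.ne_one (by have := D.K_pos; have := D.N_pos; omega)

variable [NeZero m]

/-- A standard tableau as a filling of the cylinder. -/
def toPT (σ : DPT D) : PT D where
  toFun := σ.toFun
  surjective := σ.surjective
  fiber c d := by
    refine ⟨σ.fiber, ?_⟩
    rintro ⟨k, h1, h2⟩
    rw [← σ.toFun_add_period k c.1 c.2, ← h1, ← h2]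

theorem toPT_injective : Function.Injective (toPT : DPT D → PT D) := by
  intro σ τ h
  have := congrArg PT.toFun h
  cases σ
  cases τ
  congr

variable {ζ : ℂ}

theorem weight_eq (hζ : IsPrimitiveRoot ζ (D.K + D.N).toNat) (σ : DPT D) {i : ℤ} {x y : ℤ}
    (h : σ.toFun (x, y) = i) : σ.weight ζ i = ζ ^ (x - y) :=
  σ.toPT.weight_eq hζ (c := (x, y)) h

theorem weight_add (hζ : IsPrimitiveRoot ζ (D.K + D.N).toNat) (σ : DPT D) (i : ℤ) :
    σ.weight ζ (i + m) = ζ ^ (D.a + D.b) * σ.weight ζ i := by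
  have hz := zeta_ne_zero hζ
  obtain ⟨⟨x, y⟩, h⟩ := σ.surjective i
  have h' := σ.shift x y
  rw [h] at h'
  rw [σ.weight_eq hζ h, σ.weight_eq hζ h', ← zpow_add₀ hz]
  congr 1
  ring

/-- Labels whose weights differ by `ζ ^ e` lie on diagonals which differ by `e`. -/
theorem exists_cell (hζ : IsPrimitiveRoot ζ (D.K + D.N).toNat) (σ : DPT D) {i j x y : ℤ} (e : ℤ)
    (h : σ.toFun (x, y) = i) (hw : σ.weight ζ j = ζ ^ e * σ.weight ζ i) :
    ∃ k : ℤ, σ.toFun (x + e + k, y + k) = j := by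
  have hpos : 0 < D.K + D.N := add_pos D.K_pos D.N_pos
  have hz := zeta_ne_zero hζ
  obtain ⟨⟨x', y'⟩, h'⟩ := σ.surjective j
  rw [σ.weight_eq hζ h, σ.weight_eq hζ h', ← zpow_add₀ hz] at hw
  have h1 : ζ ^ (x' - y' - (e + (x - y))) = 1 := by
    rw [zpow_sub₀ hz, hw, div_self (zpow_ne_zero _ hz)]
  rw [hζ.zpow_eq_one_iff_dvd, Int.toNat_of_nonneg hpos.le] at h1
  obtain ⟨r, hr⟩ := h1
  refine ⟨y' + r * D.N - y, ?_⟩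
  rw [← h', ← σ.toFun_add_period (-r) x' y']
  congr 2
  · linear_combination -hr
  · ring

/-- Equal weights would put both labels on one diagonal, where labels of distinct cells differ by at
least 2. -/
theorem weight_ne_succ (hζ : IsPrimitiveRoot ζ (D.K + D.N).toNat) (σ : DPT D) (i : ℤ) :
    σ.weight ζ i ≠ σ.weight ζ (i + 1) := by
  intro h
  obtain ⟨⟨x, y⟩, hc⟩ := σ.surjective i
  obtain ⟨k, hk⟩ := σ.exists_cell hζ 0 hc (j := i + 1) (by simp [h])
  rw [add_zero] at hk
  obtain ⟨n, rfl | rfl⟩ := k.eq_nat_or_neg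
  · have := σ.add_le x y n n
    have : n = 0 := by omega
    subst this
    simp [hc] at hk
  · have := σ.add_le (x + -n) (y + -n) n n
    rw [neg_add_cancel_right, neg_add_cancel_right] at this
    omega

/-- The weight condition places `i + 1` at (x + 1 + k, y + k) for some k, and monotonicity leaves
only k = 0. -/
theorem isLeft_iff (hζ : IsPrimitiveRoot ζ (D.K + D.N).toNat) (σ : DPT D) (i : ℤ) :
    σ.IsLeft i ↔ σ.weight ζ (i + 1) = ζ * σ.weight ζ i := by
  have hz := zeta_ne_zero hζ
  constructor
  · rintro ⟨x, y, h1, h2⟩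
    rw [σ.weight_eq hζ h1, σ.weight_eq hζ h2, ← zpow_one_add₀ hz]
    congr 1
    ring
  · intro h
    obtain ⟨⟨x, y⟩, hc⟩ := σ.surjective i
    obtain ⟨k, hk⟩ := σ.exists_cell hζ 1 hc (j := i + 1) (by simp [h])
    obtain ⟨n, rfl | rfl⟩ := k.eq_nat_or_neg
    · have := σ.add_le x y (n + 1) n
      rw [show x + ((n + 1 : ℕ) : ℤ) = x + 1 + n by push_cast; ring] at this
      have : n = 0 := by push_cast at this; omega
      subst this
      exact ⟨x, y, hc, by simpa using hk⟩
    · rcases n with - | n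
      · exact ⟨x, y, hc, by simpa using hk⟩
      · have := σ.add_le (x + 1 + -((n + 1 : ℕ) : ℤ)) (y + -((n + 1 : ℕ) : ℤ)) n (n + 1)
        rw [show x + 1 + -((n + 1 : ℕ) : ℤ) + n = x by push_cast; ring, neg_add_cancel_right, hk, hc]
          at this
        push_cast at this
        omega

theorem isTop_iff (hζ : IsPrimitiveRoot ζ (D.K + D.N).toNat) (σ : DPT D) (i : ℤ) :
    σ.IsTop i ↔ σ.weight ζ i = ζ * σ.weight ζ (i + 1) := by
  have hz := zeta_ne_zero hζ
  constructor
  · rintro ⟨x, y, h1, h2⟩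
    rw [σ.weight_eq hζ h1, σ.weight_eq hζ h2, ← zpow_one_add₀ hz]
    congr 1
    ring
  · intro h
    obtain ⟨⟨x, y⟩, hc⟩ := σ.surjective i
    obtain ⟨k, hk⟩ := σ.exists_cell hζ (-1) hc (j := i + 1) (by rw [h]; simp [hz])
    obtain ⟨n, rfl | rfl⟩ := k.eq_nat_or_neg
    · rcases n with - | n
      · have := σ.add_le (x + -1) y 1 0
        simp at this hk
        omega
      · have := σ.add_le x y n (n + 1)
        rw [show x + -1 + ((n + 1 : ℕ) : ℤ) = x + n by push_cast; ring] at hk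
        have : n = 0 := by push_cast at this hk; omega
        subst this
        exact ⟨x, y, hc, by simpa using hk⟩
    · have := σ.add_le (x + -1 + -(n : ℤ)) (y + -(n : ℤ)) (n + 1) n
      rw [show x + -1 + -(n : ℤ) + ((n + 1 : ℕ) : ℤ) = x by push_cast; ring, neg_add_cancel_right, hk,
        hc] at this
      push_cast at this
      omega

/-- If `i` and `i + 2` lie on the same diagonal then `K = N = 1`, and `i + 1` is next to `i`. -/
theorem weight_eq_add_two (hζ : IsPrimitiveRoot ζ (D.K + D.N).toNat) (σ : DPT D) (i : ℤ)
    (h : σ.weight ζ i = σ.weight ζ (i + 1 + 1)) :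
    ζ = -1 ∧ σ.weight ζ (i + 1) = - σ.weight ζ i := by
  have hz := zeta_ne_zero hζ
  obtain ⟨⟨x, y⟩, hc⟩ := σ.surjective i
  obtain ⟨k, hk⟩ := σ.exists_cell hζ 0 hc (j := i + 1 + 1) (by simp [h])
  rw [add_zero] at hk
  -- k diagonal steps change the label by at least 2|k|, and here the change is exactly +2.
  have hk1 : k = 1 := by
    obtain ⟨n, rfl | rfl⟩ := k.eq_nat_or_neg
    · have := σ.add_le x y n n
      have : n ≠ 0 := by
        rintro rfl
        simp at hk
        omega
      omega
    · have := σ.add_le (x + -n) (y + -n) n n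
      rw [neg_add_cancel_right, neg_add_cancel_right] at this
      omega
  subst hk1
  have l1 := σ.lt_right x y
  have l2 := σ.lt_down (x + 1) y
  have l3 := σ.lt_down x y
  have l4 := σ.lt_right x (y + 1)
  -- Both (x + 1, y) and (x, y + 1) have labels strictly between `i` and `i + 2`, so `i + 1` is at
  -- once to the right of `i` and below it; comparing weights gives ζ² = 1.
  have hl := (σ.isLeft_iff hζ i).1 ⟨x, y, hc, by omega⟩
  have ht := (σ.isTop_iff hζ i).1 ⟨x, y, hc, by omega⟩
  have h2 : ζ * ζ = 1 := by
    rw [hl, ← mul_assoc] at ht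
    exact (mul_eq_right₀ (σ.toPT.weight_ne_zero hz i)).1 ht.symm
  have hm1 : ζ = -1 := (mul_self_eq_one_iff.1 h2).resolve_left (ne_one hζ)
  exact ⟨hm1, by rw [hl, hm1]; ring⟩

end DPT

/-! ### Coefficients of the operators -/

section Coefficients

/-- The diagonal coefficient of `T_i`, in terms of the weights of `i` and `i + 1`. -/
def coefA (ζ a b : ℂ) : ℂ := -((1 - ζ) / (1 - a * b⁻¹))

open Classical in
/-- The off-diagonal coefficient of `T_i`, in terms of the weights of `i` and `i + 1`. It vanishes
if these weights are those of adjacent cells. -/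
def coefB (ζ a b : ℂ) : ℂ :=
  if b = ζ * a ∨ a = ζ * b then 0 else (1 - ζ * (a * b⁻¹)) / (1 - a * b⁻¹)

variable {ζ a b c : ℂ}

theorem coefA_eq (hb : b ≠ 0) : coefA ζ a b = (1 - ζ) * b / (a - b) := by
  by_cases h : a = b
  · subst h
    simp [coefA, hb]
  have h1 : a - b ≠ 0 := sub_ne_zero.2 h
  have h2 : 1 - a * b⁻¹ ≠ 0 := by
    rw [← div_eq_mul_inv, one_sub_div hb]
    exact div_ne_zero (sub_ne_zero.2 (Ne.symm h)) hb
  rw [coefA, ← neg_div, div_eq_div_iff h2 h1]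
  field_simp
  ring

theorem coefA_add_coefA (ha : a ≠ 0) (hb : b ≠ 0) (h : a ≠ b) :
    coefA ζ a b + coefA ζ b a = ζ - 1 := by
  have h1 : a - b ≠ 0 := sub_ne_zero.2 h
  have h2 : b - a ≠ 0 := sub_ne_zero.2 h.symm
  rw [coefA_eq ha, coefA_eq hb]
  field_simp
  ring

/-- The right side is (ζa - b)(a - ζb)/(a - b)², which vanishes exactly where `coefB` is set to
zero, so the degenerate case needs no exception. -/
theorem coefB_mul_coefB (ha : a ≠ 0) (hb : b ≠ 0) (h : a ≠ b) :
    coefB ζ a b * coefB ζ b a = (ζ - coefA ζ a b) * (coefA ζ a b + 1) := by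
  have h1 : a - b ≠ 0 := sub_ne_zero.2 h
  have h2 : b - a ≠ 0 := sub_ne_zero.2 h.symm
  have e : (ζ - coefA ζ a b) * (coefA ζ a b + 1) = (ζ * a - b) * (a - ζ * b) / (a - b) ^ 2 := by
    rw [coefA_eq hb]
    field_simp
    ring
  rw [e, coefB, coefB]
  by_cases hc : b = ζ * a ∨ a = ζ * b
  · rw [if_pos hc, zero_mul, eq_comm, div_eq_zero_iff, mul_eq_zero, sub_eq_zero, sub_eq_zero]
    left
    rcases hc with hc | hc
    · exact .inl hc.symm
    · exact .inr hc
  · rw [if_neg hc, if_neg (by rwa [or_comm])]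
    have h3 : 1 - a * b⁻¹ ≠ 0 := by
      rw [← div_eq_mul_inv, one_sub_div hb]
      exact div_ne_zero h2 hb
    have h4 : 1 - b * a⁻¹ ≠ 0 := by
      rw [← div_eq_mul_inv, one_sub_div ha]
      exact div_ne_zero h1 ha
    rw [div_mul_div_comm, div_eq_div_iff (mul_ne_zero h3 h4) (pow_ne_zero 2 h1)]
    field_simp
    ring

theorem coefA_mul_add (ha : a ≠ 0) (hb : b ≠ 0) (h : a ≠ b) :
    a * coefA ζ a b + b * coefA ζ b a = 0 := by
  have h1 : a - b ≠ 0 := sub_ne_zero.2 h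
  have h2 : b - a ≠ 0 := sub_ne_zero.2 h.symm
  rw [coefA_eq ha, coefA_eq hb]
  field_simp
  ring

theorem coefA_sq_mul (hb : b ≠ 0) (h : a ≠ b) :
    coefA ζ a b ^ 2 * a + (ζ - coefA ζ a b) * (coefA ζ a b + 1) * b = ζ * b := by
  have h1 : a - b ≠ 0 := sub_ne_zero.2 h
  rw [coefA_eq hb]
  field_simp
  ring

/-- The three identities `coefA_braid₁`, `coefA_braid₂`, `coefA_braid₃` compare the coefficients of
s_iσ, s_{i+1}σ and σ in the braid relation. -/
theorem coefA_braid₁ (ha : a ≠ 0) (hb : b ≠ 0) (hc : c ≠ 0) (hab : a ≠ b) (hbc : b ≠ c)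
    (hac : a ≠ c) :
    coefA ζ a b * coefA ζ b c + coefA ζ a c * coefA ζ b a = coefA ζ b c * coefA ζ a c := by
  have h1 : a - b ≠ 0 := sub_ne_zero.2 hab
  have h2 : b - a ≠ 0 := sub_ne_zero.2 hab.symm
  have h3 : b - c ≠ 0 := sub_ne_zero.2 hbc
  have h4 : a - c ≠ 0 := sub_ne_zero.2 hac
  rw [coefA_eq hb, coefA_eq hc, coefA_eq hc, coefA_eq ha]
  field_simp
  ring

theorem coefA_braid₂ (hb : b ≠ 0) (hc : c ≠ 0) (hab : a ≠ b) (hbc : b ≠ c) (hac : a ≠ c) :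
    coefA ζ a b * coefA ζ b c + coefA ζ a c * coefA ζ c b = coefA ζ a b * coefA ζ a c := by
  have h1 : a - b ≠ 0 := sub_ne_zero.2 hab
  have h2 : c - b ≠ 0 := sub_ne_zero.2 hbc.symm
  have h3 : b - c ≠ 0 := sub_ne_zero.2 hbc
  have h4 : a - c ≠ 0 := sub_ne_zero.2 hac
  rw [coefA_eq hb, coefA_eq hc, coefA_eq hc, coefA_eq hb]
  field_simp
  ring

theorem coefA_braid₃ (hb : b ≠ 0) (hc : c ≠ 0) (hab : a ≠ b) (hbc : b ≠ c) (hac : a ≠ c) :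
    coefA ζ a b ^ 2 * coefA ζ b c + coefA ζ a c * ((ζ - coefA ζ a b) * (coefA ζ a b + 1))
      = coefA ζ b c ^ 2 * coefA ζ a b
        + coefA ζ a c * ((ζ - coefA ζ b c) * (coefA ζ b c + 1)) := by
  have h1 : a - b ≠ 0 := sub_ne_zero.2 hab
  have h3 : b - c ≠ 0 := sub_ne_zero.2 hbc
  have h4 : a - c ≠ 0 := sub_ne_zero.2 hac
  rw [coefA_eq hb, coefA_eq hc, coefA_eq hc]
  field_simp
  ring

theorem coefB_neg (h : b = -a) : coefB (-1) a b = 0 := by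
  rw [coefB, if_pos (Or.inl (by rw [h]; ring))]

theorem coefA_neg (ha : a ≠ 0) : coefA (-1) a (-a) = -1 := by
  rw [coefA_eq (neg_ne_zero.2 ha)]
  field_simp

end Coefficients

/-! ### Operators on all fillings -/

section Operators

variable {m : ℕ} {D : Datum m}

/-- The formula for `X_i` on fillings. -/
def ptX (D : Datum m) (ζ : ℂ) (i : ℤ) : Module.End ℂ (PT D →₀ ℂ) :=
  Finsupp.linearCombination ℂ fun p : PT D => p.weight ζ i • Finsupp.single p 1

/-- The formula for the inverse of `X_i` on fillings. -/
def ptXinv (D : Datum m) (ζ : ℂ) (i : ℤ) : Module.End ℂ (PT D →₀ ℂ) :=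
  Finsupp.linearCombination ℂ fun p : PT D => (p.weight ζ i)⁻¹ • Finsupp.single p 1

/-- The action of a permutation on fillings. -/
def ptAct (D : Datum m) (g : Equiv.Perm ℤ) : Module.End ℂ (PT D →₀ ℂ) :=
  Finsupp.linearCombination ℂ fun p : PT D => Finsupp.single (PT.act g p) 1

theorem ptX_single (ζ : ℂ) (i : ℤ) (p : PT D) :
    ptX D ζ i (Finsupp.single p 1) = p.weight ζ i • Finsupp.single p 1 := by
  simp [ptX]

theorem ptXinv_single (ζ : ℂ) (i : ℤ) (p : PT D) :
    ptXinv D ζ i (Finsupp.single p 1) = (p.weight ζ i)⁻¹ • Finsupp.single p 1 := by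
  simp [ptXinv]

theorem ptAct_single (g : Equiv.Perm ℤ) (p : PT D) :
    ptAct D g (Finsupp.single p 1) = Finsupp.single (PT.act g p) 1 := by
  simp [ptAct]

/-- The inverse of `X_i` on the tableau module. -/
def opXinv (D : Datum m) (ζ : ℂ) (i : ℤ) : Module.End ℂ (W D) :=
  Finsupp.linearCombination ℂ fun σ : DPT D => (σ.weight ζ i)⁻¹ • nu σ

/-- The tableau `π⁻¹ σ`. -/
def DPT.unrotate (σ : DPT D) : DPT D where
  toFun c := σ.toFun c - 1
  surjective n := by
    obtain ⟨c, hc⟩ := σ.surjective (n + 1)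
    exact ⟨c, by simp [hc]⟩
  periodic x y := by simp [σ.periodic]
  shift x y := by simp only [σ.shift]; ring
  lt_right x y := by simpa using σ.lt_right x y
  lt_down x y := by simpa using σ.lt_down x y

/-- The inverse of `π` on the tableau module. -/
def opPiInv (D : Datum m) : Module.End ℂ (W D) :=
  Finsupp.linearCombination ℂ fun σ : DPT D => nu σ.unrotate

variable [hm : Fact (2 ≤ m)]

/-- The formula for `T_i` on fillings. -/
def ptT (D : Datum m) (ζ : ℂ) (i : ℤ) : Module.End ℂ (PT D →₀ ℂ) :=
  Finsupp.linearCombination ℂ fun p : PT D =>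
    coefA ζ (p.weight ζ i) (p.weight ζ (i + 1)) • Finsupp.single p 1
      + coefB ζ (p.weight ζ i) (p.weight ζ (i + 1)) •
        Finsupp.single (PT.act (affS i : AffPerm m).1 p) 1

theorem ptT_single (ζ : ℂ) (i : ℤ) (p : PT D) :
    ptT D ζ i (Finsupp.single p 1) = coefA ζ (p.weight ζ i) (p.weight ζ (i + 1)) • Finsupp.single p 1
      + coefB ζ (p.weight ζ i) (p.weight ζ (i + 1)) •
        Finsupp.single (PT.act (affS i : AffPerm m).1 p) 1 := by
  simp [ptT]

/-- The embedding of the tableau module into the space of fillings. -/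
def emb (D : Datum m) : W D →ₗ[ℂ] (PT D →₀ ℂ) := Finsupp.lmapDomain ℂ ℂ DPT.toPT

theorem emb_nu (σ : DPT D) : emb D (nu σ) = Finsupp.single σ.toPT 1 := by
  simp [emb, nu]

theorem emb_injective : Function.Injective (emb D) :=
  Finsupp.mapDomain_injective DPT.toPT_injective

/-- Relations are compared inside the space of fillings, where swaps need no standardness, but only
on standard tableaux, where the weights of consecutive labels are distinct. -/
theorem end_ext {f g : Module.End ℂ (W D)} (h : ∀ σ : DPT D, emb D (f (nu σ)) = emb D (g (nu σ))) :
    f = g :=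
  Finsupp.lhom_ext' fun σ => LinearMap.ext_ring (emb_injective (h σ))

theorem emb_eq_of_nu {f : Module.End ℂ (W D)} {g : Module.End ℂ (PT D →₀ ℂ)}
    (h : ∀ σ : DPT D, emb D (f (nu σ)) = g (emb D (nu σ))) (v : W D) : emb D (f v) = g (emb D v) := by
  have : emb D ∘ₗ f = g ∘ₗ emb D := Finsupp.lhom_ext' fun σ => LinearMap.ext_ring (h σ)
  exact LinearMap.congr_fun this v

theorem emb_opX (ζ : ℂ) (i : ℤ) (v : W D) : emb D (opX D ζ i v) = ptX D ζ i (emb D v) := by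
  refine emb_eq_of_nu (fun σ => ?_) v
  rw [emb_nu, ptX_single, opX, nu, Finsupp.linearCombination_single, one_smul, map_smul, emb_nu]
  rfl

theorem emb_opXinv (ζ : ℂ) (i : ℤ) (v : W D) : emb D (opXinv D ζ i v) = ptXinv D ζ i (emb D v) := by
  refine emb_eq_of_nu (fun σ => ?_) v
  rw [emb_nu, ptXinv_single, opXinv, nu, Finsupp.linearCombination_single, one_smul, map_smul, emb_nu]
  rfl

theorem emb_opPi (v : W D) : emb D (opPi D v) = ptAct D (affPi m).1 (emb D v) := by
  refine emb_eq_of_nu (fun σ => ?_) v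
  rw [emb_nu, ptAct_single, opPi, nu, Finsupp.linearCombination_single, one_smul, emb_nu]
  rfl

theorem emb_opPiInv (v : W D) : emb D (opPiInv D v) = ptAct D (affPi m)⁻¹.1 (emb D v) := by
  refine emb_eq_of_nu (fun σ => ?_) v
  rw [emb_nu, ptAct_single, opPiInv, nu, Finsupp.linearCombination_single, one_smul, emb_nu]
  rfl

variable {ζ : ℂ}

/-- Adjacency is detected by weights. In the adjacent cases `coefB` is 0 and `coefA` evaluates to ζ
or -1, which merges the three cases of `opT`. -/
theorem emb_opT (hζ : IsPrimitiveRoot ζ (D.K + D.N).toNat) (i : ℤ) (v : W D) :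
    emb D (opT D ζ i v) = ptT D ζ i (emb D v) := by
  have hz := zeta_ne_zero hζ
  refine emb_eq_of_nu (fun σ => ?_) v
  have hb := σ.toPT.weight_ne_zero hz i
  have hb' := σ.toPT.weight_ne_zero hz (i + 1)
  have h1 := DPT.ne_one hζ
  rw [emb_nu, ptT_single, opT, nu, Finsupp.linearCombination_single, one_smul]
  by_cases hl : σ.IsLeft i
  · have hw : σ.toPT.weight ζ (i + 1) = ζ * σ.toPT.weight ζ i := (σ.isLeft_iff hζ i).1 hl
    have hA : coefA ζ (σ.toPT.weight ζ i) (σ.toPT.weight ζ (i + 1)) = ζ := by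
      rw [coefA_eq hb', hw, div_eq_iff]
      · ring
      · rw [← one_sub_mul]
        exact mul_ne_zero (sub_ne_zero.2 h1.symm) hb
    rw [dif_pos hl, map_smul, emb_nu, hA, coefB, if_pos (.inl hw), zero_smul, add_zero]
  by_cases ht : σ.IsTop i
  · have hw : σ.toPT.weight ζ i = ζ * σ.toPT.weight ζ (i + 1) := (σ.isTop_iff hζ i).1 ht
    have hA : coefA ζ (σ.toPT.weight ζ i) (σ.toPT.weight ζ (i + 1)) = -1 := by
      rw [coefA_eq hb', hw, div_eq_iff]
      · ring
      · rw [← sub_one_mul]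
        exact mul_ne_zero (sub_ne_zero.2 h1) hb'
    rw [dif_neg hl, dif_pos ht, map_neg, emb_nu, hA, coefB, if_pos (.inr hw), zero_smul, add_zero,
      neg_one_smul]
  · have hn : ¬ (σ.toPT.weight ζ (i + 1) = ζ * σ.toPT.weight ζ i
        ∨ σ.toPT.weight ζ i = ζ * σ.toPT.weight ζ (i + 1)) := by
      rintro (h | h)
      · exact hl ((σ.isLeft_iff hζ i).2 h)
      · exact ht ((σ.isTop_iff hζ i).2 h)
    rw [dif_neg hl, dif_neg ht, map_add, map_smul, map_smul, emb_nu, emb_nu, coefB, if_neg hn]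
    rfl

end Operators

/-! ### The relations -/

section OperatorRelations

variable {m : ℕ} [hm : Fact (2 ≤ m)] {D : Datum m} {ζ : ℂ}

theorem weight_act_affS (hζ : IsPrimitiveRoot ζ (D.K + D.N).toNat) (p : PT D) (i j : ℤ) :
    (PT.act (affS i : AffPerm m).1 p).weight ζ j = p.weight ζ (simpleRefl m i j) :=
  PT.weight_act hζ _ p j

theorem act_affS_act_affS (p : PT D) (i : ℤ) :
    PT.act (affS i : AffPerm m).1 (PT.act (affS i : AffPerm m).1 p) = p := by
  rw [← PT.act_mul, ← Subgroup.coe_mul, affS_mul_self]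
  rfl

theorem opX_comm (i j : ℤ) : opX D ζ i * opX D ζ j = opX D ζ j * opX D ζ i := by
  refine end_ext fun σ => ?_
  simp only [Module.End.mul_apply, emb_opX, emb_nu, ptX_single, map_smul, smul_smul]
  rw [mul_comm]

theorem opX_mul_opXinv (hz : ζ ≠ 0) (i : ℤ) : opX D ζ i * opXinv D ζ i = 1 := by
  refine end_ext fun σ => ?_
  simp only [Module.End.mul_apply, emb_opX, emb_opXinv, emb_nu, ptX_single, ptXinv_single, map_smul,
    smul_smul, Module.End.one_apply]
  rw [inv_mul_cancel₀ (σ.toPT.weight_ne_zero hz i), one_smul]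

theorem opXinv_mul_opX (hz : ζ ≠ 0) (i : ℤ) : opXinv D ζ i * opX D ζ i = 1 := by
  refine end_ext fun σ => ?_
  simp only [Module.End.mul_apply, emb_opX, emb_opXinv, emb_nu, ptX_single, ptXinv_single, map_smul,
    smul_smul, Module.End.one_apply]
  rw [mul_inv_cancel₀ (σ.toPT.weight_ne_zero hz i), one_smul]

theorem opPi_mul_opPiInv : opPi D * opPiInv D = 1 := by
  refine end_ext fun σ => ?_
  simp only [Module.End.mul_apply, emb_opPi, emb_opPiInv, emb_nu, ptAct_single, Module.End.one_apply]
  rw [← PT.act_mul, ← Subgroup.coe_mul, mul_inv_cancel]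
  rfl

theorem opPiInv_mul_opPi : opPiInv D * opPi D = 1 := by
  refine end_ext fun σ => ?_
  simp only [Module.End.mul_apply, emb_opPi, emb_opPiInv, emb_nu, ptAct_single, Module.End.one_apply]
  rw [← PT.act_mul, ← Subgroup.coe_mul, inv_mul_cancel]
  rfl

theorem opPi_mul_opX (hζ : IsPrimitiveRoot ζ (D.K + D.N).toNat) (i : ℤ) :
    opPi D * opX D ζ i = opX D ζ (i + 1) * opPi D := by
  refine end_ext fun σ => ?_
  simp only [Module.End.mul_apply, emb_opPi, emb_opX, emb_nu, ptAct_single, ptX_single, map_smul,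
    PT.weight_act hζ]
  rw [show (affPi m).1⁻¹ (i + 1) = i from add_sub_cancel_right i 1]

theorem opPi_mul_opT (hζ : IsPrimitiveRoot ζ (D.K + D.N).toNat) (i : ℤ) :
    opPi D * opT D ζ i = opT D ζ (i + 1) * opPi D := by
  refine end_ext fun σ => ?_
  simp only [Module.End.mul_apply, emb_opPi, emb_opT hζ, emb_nu, ptAct_single, ptT_single, map_smul,
    map_add, PT.weight_act hζ]
  rw [show (affPi m).1⁻¹ (i + 1) = i from add_sub_cancel_right i 1,
    show (affPi m).1⁻¹ (i + 1 + 1) = i + 1 from add_sub_cancel_right (i + 1) 1, ← PT.act_mul,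
    ← PT.act_mul, ← Subgroup.coe_mul, ← Subgroup.coe_mul, affPi_mul_affS]

theorem opT_hecke (hζ : IsPrimitiveRoot ζ (D.K + D.N).toNat) (i : ℤ) :
    opT D ζ i * opT D ζ i = (ζ - 1) • opT D ζ i + ζ • 1 := by
  have hz := zeta_ne_zero hζ
  refine end_ext fun σ => ?_
  have ha := σ.toPT.weight_ne_zero hz i
  have hb := σ.toPT.weight_ne_zero hz (i + 1)
  have hab : σ.toPT.weight ζ i ≠ σ.toPT.weight ζ (i + 1) := σ.weight_ne_succ hζ i
  simp only [Module.End.mul_apply, emb_opT hζ, emb_nu, ptT_single, map_smul, map_add,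
    weight_act_affS hζ, LinearMap.add_apply, LinearMap.smul_apply, Module.End.one_apply,
    simpleRefl_self, simpleRefl_succ hm.out, act_affS_act_affS]
  generalize σ.toPT.weight ζ i = a at *
  generalize σ.toPT.weight ζ (i + 1) = b at *
  have h1 := coefB_mul_coefB (ζ := ζ) ha hb hab
  have h2 := coefA_add_coefA (ζ := ζ) ha hb hab
  match_scalars
  · linear_combination h1
  · linear_combination coefB ζ a b * h2

theorem opT_opX_opT (hζ : IsPrimitiveRoot ζ (D.K + D.N).toNat) (i : ℤ) :
    opT D ζ i * opX D ζ i * opT D ζ i = ζ • opX D ζ (i + 1) := by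
  have hz := zeta_ne_zero hζ
  refine end_ext fun σ => ?_
  have ha := σ.toPT.weight_ne_zero hz i
  have hb := σ.toPT.weight_ne_zero hz (i + 1)
  have hab : σ.toPT.weight ζ i ≠ σ.toPT.weight ζ (i + 1) := σ.weight_ne_succ hζ i
  simp only [Module.End.mul_apply, emb_opT hζ, emb_opX, emb_nu, ptT_single, ptX_single, map_smul,
    map_add, weight_act_affS hζ, LinearMap.smul_apply, simpleRefl_self, simpleRefl_succ hm.out,
    act_affS_act_affS]
  generalize σ.toPT.weight ζ i = a at *
  generalize σ.toPT.weight ζ (i + 1) = b at *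
  have h1 := coefB_mul_coefB (ζ := ζ) ha hb hab
  have h2 := coefA_mul_add (ζ := ζ) ha hb hab
  have h3 := coefA_sq_mul (ζ := ζ) hb hab
  match_scalars
  · linear_combination h3 + b * h1
  · linear_combination coefB ζ a b * h2

theorem opT_opX_comm (hζ : IsPrimitiveRoot ζ (D.K + D.N).toNat) {i j : ℤ}
    (h₁ : ¬ (m : ℤ) ∣ j - i) (h₂ : ¬ (m : ℤ) ∣ j - (i + 1)) :
    opT D ζ i * opX D ζ j = opX D ζ j * opT D ζ i := by
  refine end_ext fun σ => ?_
  simp only [Module.End.mul_apply, emb_opT hζ, emb_opX, emb_nu, ptT_single, ptX_single, map_smul,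
    map_add, weight_act_affS hζ, simpleRefl_of_not_dvd h₁ h₂]
  module

theorem opT_comm (hζ : IsPrimitiveRoot ζ (D.K + D.N).toNat) {i j : ℤ} (h₀ : ¬ (m : ℤ) ∣ i - j)
    (h₁ : ¬ (m : ℤ) ∣ j - (i + 1)) (h₂ : ¬ (m : ℤ) ∣ i - (j + 1)) :
    opT D ζ i * opT D ζ j = opT D ζ j * opT D ζ i := by
  have h₀' : ¬ (m : ℤ) ∣ j - i := by rwa [← dvd_neg, neg_sub]
  have e1 : simpleRefl m i j = j := simpleRefl_of_not_dvd h₀' h₁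
  have e2 : simpleRefl m i (j + 1) = j + 1 := simpleRefl_of_not_dvd
    (by rwa [← dvd_neg, neg_sub]) (by rwa [add_sub_add_right_eq_sub])
  have e3 : simpleRefl m j i = i := simpleRefl_of_not_dvd h₀ h₂
  have e4 : simpleRefl m j (i + 1) = i + 1 := simpleRefl_of_not_dvd
    (by rwa [← dvd_neg, neg_sub]) (by rwa [add_sub_add_right_eq_sub])
  refine end_ext fun σ => ?_
  have e5 : PT.act (affS i : AffPerm m).1 (PT.act (affS j : AffPerm m).1 σ.toPT)
      = PT.act (affS j : AffPerm m).1 (PT.act (affS i : AffPerm m).1 σ.toPT) := by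
    rw [← PT.act_mul, ← PT.act_mul, ← Subgroup.coe_mul, ← Subgroup.coe_mul, affS_comm h₁ h₂]
  simp only [Module.End.mul_apply, emb_opT hζ, emb_nu, ptT_single, map_smul,
    map_add, weight_act_affS hζ, e1, e2, e3, e4, e5]
  module

theorem opT_braid (hζ : IsPrimitiveRoot ζ (D.K + D.N).toNat) (h3 : 3 ≤ m) (i : ℤ) :
    opT D ζ i * opT D ζ (i + 1) * opT D ζ i = opT D ζ (i + 1) * opT D ζ i * opT D ζ (i + 1) := by
  have hz := zeta_ne_zero hζ
  obtain ⟨n1, n2⟩ := three_le_not_dvd h3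
  have v1 : simpleRefl m i (i + 1 + 1) = i + 1 + 1 :=
    simpleRefl_of_not_dvd (by rw [show i + 1 + 1 - i = 2 by ring]; exact n2)
      (by rw [show i + 1 + 1 - (i + 1) = 1 by ring]; exact n1)
  have v2 : simpleRefl m (i + 1) i = i :=
    simpleRefl_of_not_dvd (by rw [show i - (i + 1) = -1 by ring]; rwa [dvd_neg])
      (by rw [show i - (i + 1 + 1) = -2 by ring]; rwa [dvd_neg])
  have v3 : simpleRefl m (i + 1) (i + 1 + 1) = i + 1 := simpleRefl_succ hm.out
  have v4 : simpleRefl m i (i + 1) = i := simpleRefl_succ hm.out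
  refine end_ext fun σ => ?_
  have ha := σ.toPT.weight_ne_zero hz i
  have hb := σ.toPT.weight_ne_zero hz (i + 1)
  have hc := σ.toPT.weight_ne_zero hz (i + 1 + 1)
  have hab : σ.toPT.weight ζ i ≠ σ.toPT.weight ζ (i + 1) := σ.weight_ne_succ hζ i
  have hbc : σ.toPT.weight ζ (i + 1) ≠ σ.toPT.weight ζ (i + 1 + 1) := σ.weight_ne_succ hζ (i + 1)
  have hac : σ.toPT.weight ζ i = σ.toPT.weight ζ (i + 1 + 1) →
    ζ = -1 ∧ σ.toPT.weight ζ (i + 1) = - σ.toPT.weight ζ i := σ.weight_eq_add_two hζ i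
  have e : PT.act (affS i : AffPerm m).1 (PT.act (affS (i + 1) : AffPerm m).1
      (PT.act (affS i : AffPerm m).1 σ.toPT)) = PT.act (affS (i + 1) : AffPerm m).1
      (PT.act (affS i : AffPerm m).1 (PT.act (affS (i + 1) : AffPerm m).1 σ.toPT)) := by
    simp only [← PT.act_mul, ← Subgroup.coe_mul]
    rw [← mul_assoc, affS_braid h3, mul_assoc]
  simp only [Module.End.mul_apply, emb_opT hζ, emb_nu, ptT_single, map_smul,
    map_add, weight_act_affS hζ, v1, v2, v3, v4, simpleRefl_self, act_affS_act_affS, e]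
  generalize σ.toPT.weight ζ i = a at *
  generalize σ.toPT.weight ζ (i + 1) = b at *
  generalize σ.toPT.weight ζ (i + 1 + 1) = c at *
  -- The identities divide by a - c. The case a = c occurs only for ζ = -1 and b = -a, where all
  -- off-diagonal coefficients vanish and both `T_i` and `T_{i+1}` act as -1.
  by_cases h : a = c
  · obtain ⟨rfl, rfl⟩ := hac h
    subst h
    have h1 : coefA (-1) (-a) a = -1 := by simpa using coefA_neg hb
    simp only [coefB_neg rfl, coefB_neg (neg_neg a).symm, coefA_neg ha, h1]
    module
  · have h1 := coefB_mul_coefB (ζ := ζ) ha hb hab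
    have h2 := coefB_mul_coefB (ζ := ζ) hb hc hbc
    have b1 := coefA_braid₁ (ζ := ζ) ha hb hc hab hbc h
    have b2 := coefA_braid₂ (ζ := ζ) hb hc hab hbc h
    have b3 := coefA_braid₃ (ζ := ζ) hb hc hab hbc h
    match_scalars
    · linear_combination b3 + coefA ζ a c * h1 - coefA ζ a c * h2
    · linear_combination coefB ζ a b * b1
    · linear_combination -coefB ζ b c * b2
    all_goals ring

end OperatorRelations

/-! ### The representation -/

section Representation

variable {m : ℕ}

/-- Evaluation of the base ring at `q = z`, `t = w`. -/
def evalBase (z w : ℂˣ) : Base →+* ℂ :=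
  LaurentPolynomial.eval₂ (LaurentPolynomial.eval₂ (RingHom.id ℂ) z) w

theorem evalBase_qParam (z w : ℂˣ) : evalBase z w qParam = z := by
  simp [evalBase, qParam]

theorem evalBase_tParam (z w : ℂˣ) : evalBase z w tParam = w := by
  simp [evalBase, tParam]

theorem evalBase_tParamInv (z w : ℂˣ) : evalBase z w tParamInv = (w : ℂ)⁻¹ := by
  simp [evalBase, tParamInv]

theorem evalBase_algebraMap (z w : ℂˣ) (c : ℂ) : evalBase z w (algebraMap ℂ Base c) = c := by
  have : algebraMap ℂ Base c = LaurentPolynomial.C (LaurentPolynomial.C c) := rfl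
  simp [this, evalBase]

/-- The ring homomorphism out of the free algebra determined by the images of the generators and
the values of `q` and `t`. -/
def freeLift {A : Type*} [Ring A] [Algebra ℂ A] (z w : ℂˣ) (f : Gen m → A) :
    FreeAlgebra Base (Gen m) →+* A :=
  letI : Algebra Base A := ((algebraMap ℂ A).comp (evalBase z w)).toAlgebra'
    fun c x => Algebra.commutes (evalBase z w c) x
  (FreeAlgebra.lift Base f).toRingHom

theorem freeLift_ι {A : Type*} [Ring A] [Algebra ℂ A] (z w : ℂˣ) (f : Gen m → A) (g : Gen m) :
    freeLift z w f (FreeAlgebra.ι Base g) = f g := by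
  let : Algebra Base A := ((algebraMap ℂ A).comp (evalBase z w)).toAlgebra'
    fun c x => Algebra.commutes (evalBase z w c) x
  exact FreeAlgebra.lift_ι_apply f g

theorem freeLift_algebraMap {A : Type*} [Ring A] [Algebra ℂ A] (z w : ℂˣ) (f : Gen m → A) (r : Base) :
    freeLift z w f (algebraMap Base _ r) = algebraMap ℂ A (evalBase z w r) := by
  let : Algebra Base A := ((algebraMap ℂ A).comp (evalBase z w)).toAlgebra'
    fun c x => Algebra.commutes (evalBase z w c) x
  exact (FreeAlgebra.lift Base f).commutes r

theorem freeLift_smul {A : Type*} [Ring A] [Algebra ℂ A] (z w : ℂˣ) (f : Gen m → A) (r : Base)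
    (x : FreeAlgebra Base (Gen m)) :
    freeLift z w f (r • x) = evalBase z w r • freeLift z w f x := by
  rw [show r • x = algebraMap Base _ r * x from Algebra.smul_def r x, map_mul, freeLift_algebraMap,
    ← Algebra.smul_def]

variable [hm : Fact (2 ≤ m)] {D : Datum m} {ζ : ℂ}

/-- The images of the generators. -/
def genAct (D : Datum m) (ζ : ℂ) : Gen m → Module.End ℂ (W D)
  | .T i => opT D ζ (tIndex i)
  | .X i => opX D ζ (xIndex i)
  | .Xinv i => opXinv D ζ (xIndex i)
  | .pi => opPi D
  | .piInv => opPiInv D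

theorem tIndex_dvd {i : ZMod m} {k : ℤ} : (m : ℤ) ∣ tIndex i - k ↔ i = k := by
  rw [← ZMod.intCast_zmod_eq_zero_iff_dvd, tIndex]
  push_cast
  rw [ZMod.natCast_zmod_val, sub_eq_zero]

theorem xIndex_cast (i : ZMod m) : ((xIndex i : ℤ) : ZMod m) = i := by
  unfold xIndex
  split_ifs with h
  · simp [h]
  · simp

/-- Shifting the index by `m` multiplies both weights by ζ^(a+b), and the coefficients depend only
on their ratio. -/
theorem opT_congr (hζ : IsPrimitiveRoot ζ (D.K + D.N).toNat) {i j : ℤ} (h : (m : ℤ) ∣ i - j) :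
    opT D ζ i = opT D ζ j := by
  have hz := zeta_ne_zero hζ
  have key : ∀ i, opT D ζ (i + m) = opT D ζ i := fun i => by
    refine end_ext fun σ => ?_
    have e : ∀ j, σ.toPT.weight ζ (j + m) = ζ ^ (D.a + D.b) * σ.toPT.weight ζ j := σ.weight_add hζ
    have hA : ∀ c a b : ℂ, c ≠ 0 → coefA ζ (c * a) (c * b) = coefA ζ a b := fun c a b hc => by
      rw [coefA, coefA, ← div_eq_mul_inv, ← div_eq_mul_inv, mul_div_mul_left _ _ hc]
    have hB : ∀ c a b : ℂ, c ≠ 0 → coefB ζ (c * a) (c * b) = coefB ζ a b := fun c a b hc => by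
      rw [coefB, coefB, ← div_eq_mul_inv, ← div_eq_mul_inv, mul_div_mul_left _ _ hc]
      congr 1
      rw [mul_left_comm ζ, mul_left_comm ζ, mul_right_inj' hc, mul_right_inj' hc]
    rw [emb_opT hζ, emb_opT hζ, emb_nu, ptT_single, ptT_single, add_right_comm, e, e,
      hA _ _ _ (zpow_ne_zero _ hz), hB _ _ _ (zpow_ne_zero _ hz),
      affS_congr (m := m) (i := i + m) (j := i) (by simp)]
  obtain ⟨k, hk⟩ := h
  rw [show i = j + m * k by linarith]
  clear hk
  induction k with
  | zero => simp
  | succ k ih => rw [← ih, mul_add, ← add_assoc, mul_one, key]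
  | pred k ih => rw [← ih, ← key (j + m * (-k - 1))]; congr 1; ring

theorem opX_add (hζ : IsPrimitiveRoot ζ (D.K + D.N).toNat) (i : ℤ) :
    opX D ζ (i + m) = ζ ^ (D.a + D.b) • opX D ζ i := by
  refine end_ext fun σ => ?_
  have e : ∀ j, σ.toPT.weight ζ (j + m) = ζ ^ (D.a + D.b) * σ.toPT.weight ζ j := σ.weight_add hζ
  rw [LinearMap.smul_apply, map_smul, emb_opX, emb_opX, emb_nu, ptX_single, ptX_single, e, smul_smul]

theorem xIndex_succ {i : ZMod m} (h : i ≠ 0) : xIndex (i + 1) = xIndex i + 1 := by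
  have h1 : ((i.val + 1 : ℕ) : ZMod m) = i + 1 := by push_cast; simp
  have hlt := ZMod.val_lt i
  rw [xIndex, xIndex, if_neg h]
  split_ifs with h0
  · rw [h0, ZMod.natCast_eq_zero_iff] at h1
    have := Nat.le_of_dvd (by omega) h1
    omega
  · have : i.val + 1 ≠ m := fun e => by
      rw [e, ZMod.natCast_self] at h1
      exact h0 h1.symm
    rw [← h1, ZMod.val_natCast, Nat.mod_eq_of_lt (by omega)]
    push_cast
    rfl

theorem xIndex_one : xIndex (1 : ZMod m) = 1 := by
  have : (1 : ZMod m) ≠ 0 := by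
    intro h
    have h' : ((1 : ℕ) : ZMod m) = 0 := by exact_mod_cast h
    rw [ZMod.natCast_eq_zero_iff] at h'
    have := Nat.le_of_dvd one_pos h'
    have := hm.out
    omega
  have h1 : Fact (1 < m) := ⟨hm.out⟩
  rw [xIndex, if_neg this, ZMod.val_one]
  rfl

theorem tIndex_cast (i : ZMod m) : ((tIndex i : ℤ) : ZMod m) = i := by
  simp [tIndex]

/-- The factor ζ^(a+b) in passing from `m` to `m + 1` is the value of t⁻¹, matching the exceptional
relations at index 0. -/
theorem genAct_X_nextX (hζ : IsPrimitiveRoot ζ (D.K + D.N).toNat) (i : ZMod m) :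
    opX D ζ (xIndex i + 1) = if i = 0 then ζ ^ (D.a + D.b) • opX D ζ (xIndex (1 : ZMod m))
      else opX D ζ (xIndex (i + 1)) := by
  split_ifs with h
  · rw [h, xIndex, if_pos rfl, xIndex_one, add_comm, opX_add hζ]
  · rw [xIndex_succ h]

theorem opT_opX_opT_zmod (hζ : IsPrimitiveRoot ζ (D.K + D.N).toNat) (i : ZMod m) :
    opT D ζ (tIndex i) * opX D ζ (xIndex i) * opT D ζ (tIndex i) = ζ • opX D ζ (xIndex i + 1) := by
  rw [opT_congr hζ (i := tIndex i) (j := xIndex i) (tIndex_dvd.2 (xIndex_cast i).symm),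
    opT_opX_opT hζ]

/-- The value of `t`. -/
def tUnit (D : Datum m) (z : ℂˣ) : ℂˣ := z ^ (-D.a - D.b)

/-- The operators satisfy the relations of the double affine Hecke algebra. -/
theorem freeLift_rel {z : ℂˣ} (hζ : IsPrimitiveRoot (z : ℂ) (D.K + D.N).toNat)
    ⦃x y : FreeAlgebra Base (Gen m)⦄ (h : Rel m x y) :
    freeLift z (tUnit D z) (genAct D z) x = freeLift z (tUnit D z) (genAct D z) y := by
  have ht : ((tUnit D z : ℂˣ) : ℂ)⁻¹ = (z : ℂ) ^ (D.a + D.b) := by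
    rw [tUnit, ← Units.val_inv_eq_inv_val, ← zpow_neg, ← Units.val_zpow_eq_zpow_val]
    congr 2
    ring
  have dvd_iff : ∀ j i : ZMod m, ∀ e : ℤ, (m : ℤ) ∣ tIndex j - (tIndex i + e) ↔ j = i + e := by
    intro j i e
    rw [tIndex_dvd]
    push_cast
    rw [tIndex_cast]
  induction h with
  | X_mul_inv i =>
    simp only [fX, fXinv, map_mul, map_one, freeLift_ι]
    exact opX_mul_opXinv z.ne_zero _
  | X_inv_mul i =>
    simp only [fX, fXinv, map_mul, map_one, freeLift_ι]
    exact opXinv_mul_opX z.ne_zero _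
  | pi_mul_inv =>
    simp only [fPi, fPiInv, map_mul, map_one, freeLift_ι]
    exact opPi_mul_opPiInv
  | pi_inv_mul =>
    simp only [fPi, fPiInv, map_mul, map_one, freeLift_ι]
    exact opPiInv_mul_opPi
  | hecke i =>
    simp only [fT, map_mul, map_add, map_sub, map_one, map_zero, freeLift_ι, Algebra.algebraMap_eq_smul_one (R := Base),
      freeLift_smul, evalBase_qParam]
    have := opT_hecke hζ (tIndex i)
    change (opT D z (tIndex i) - _) * (opT D z (tIndex i) + 1) = 0
    refine (sub_mul (opT D z (tIndex i)) ((z : ℂ) • 1) (opT D z (tIndex i) + 1)).trans ?_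
    rw [mul_add, this, smul_mul_assoc, one_mul, mul_one]
    module
  | braid i j hm3 hij =>
    have key : ∀ i : ZMod m, opT D z (tIndex i) * opT D z (tIndex (i + 1)) * opT D z (tIndex i)
        = opT D z (tIndex (i + 1)) * opT D z (tIndex i) * opT D z (tIndex (i + 1)) := fun i => by
      rw [opT_congr hζ (i := tIndex (i + 1)) (j := tIndex i + 1) ((dvd_iff _ _ _).2 (by simp))]
      exact opT_braid hζ hm3 _
    simp only [fT, map_mul, freeLift_ι]
    rcases hij with rfl | rfl
    · exact key i
    · have := key (i - 1)
      rw [sub_add_cancel] at this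
      exact this.symm
  | T_comm i j hij =>
    simp only [fT, map_mul, freeLift_ι]
    change opT D z _ * opT D z _ = opT D z _ * opT D z _
    by_cases h0 : i = j
    · rw [h0]
    · rw [not_or] at hij
      refine opT_comm hζ ?_ ?_ ?_
      · rwa [tIndex_dvd, tIndex_cast]
      · rw [dvd_iff]
        simpa using hij.1
      · rw [dvd_iff]
        intro e
        exact hij.2 (by rw [e]; simp)
  | T_X_T i hi =>
    simp only [fT, fX, map_mul, freeLift_ι, freeLift_smul, evalBase_qParam]
    refine (opT_opX_opT_zmod hζ i).trans ?_
    rw [genAct_X_nextX hζ, if_neg hi]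
    rfl
  | T_X_T_zero =>
    simp only [fT, fX, map_mul, freeLift_ι, freeLift_smul, map_mul, evalBase_qParam,
      evalBase_tParamInv, ht]
    refine (opT_opX_opT_zmod hζ 0).trans ?_
    rw [genAct_X_nextX hζ, if_pos rfl, smul_smul, mul_comm]
    rfl
  | T_X_comm i j h₁ h₂ =>
    simp only [fT, fX, map_mul, freeLift_ι]
    have hd : ∀ e : ℤ, (m : ℤ) ∣ xIndex j - (tIndex i + e) ↔ j = i + e := fun e => by
      rw [← ZMod.intCast_zmod_eq_zero_iff_dvd]
      push_cast
      rw [xIndex_cast, tIndex_cast, sub_eq_zero]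
    refine opT_opX_comm hζ ?_ ?_
    · have := hd 0
      rw [add_zero] at this
      rw [this]
      simpa using h₁
    · rw [hd]
      simpa using h₂
  | pi_X i hi =>
    simp only [fPi, fPiInv, fX, map_mul, freeLift_ι]
    change opPi D * opX D z _ * opPiInv D = opX D z _
    rw [opPi_mul_opX hζ, mul_assoc, opPi_mul_opPiInv, mul_one, genAct_X_nextX hζ, if_neg hi]
  | pi_X_zero =>
    simp only [fPi, fPiInv, fX, map_mul, freeLift_ι, freeLift_smul,
      evalBase_tParamInv, ht]
    change opPi D * opX D z _ * opPiInv D = _ • opX D z _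
    rw [opPi_mul_opX hζ, mul_assoc, opPi_mul_opPiInv, mul_one, genAct_X_nextX hζ, if_pos rfl]
  | pi_T i =>
    simp only [fPi, fPiInv, fT, map_mul, freeLift_ι]
    change opPi D * opT D z _ * opPiInv D = opT D z _
    rw [opPi_mul_opT hζ, mul_assoc, opPi_mul_opPiInv, mul_one]
    exact opT_congr hζ (by rw [← dvd_neg, neg_sub, dvd_iff]; simp)
  | X_comm i j =>
    simp only [fX, map_mul, freeLift_ι]
    exact opX_comm _ _

/-- The action of the double affine Hecke algebra on one tableau module. -/
def actW (D : Datum m) {z : ℂˣ} (hζ : IsPrimitiveRoot (z : ℂ) (D.K + D.N).toNat) :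
    DAHA m →+* Module.End ℂ (W D) :=
  RingQuot.lift ⟨freeLift z (tUnit D z) (genAct D z), freeLift_rel hζ⟩

variable {z : ℂˣ} (hζ : IsPrimitiveRoot (z : ℂ) (D.K + D.N).toNat)

theorem actW_mk (x : FreeAlgebra Base (Gen m)) :
    actW D hζ (RingQuot.mkAlgHom Base (Rel m) x) = freeLift z (tUnit D z) (genAct D z) x := by
  rw [show RingQuot.mkAlgHom Base (Rel m) x = RingQuot.mkRingHom (Rel m) x by
    rw [← RingQuot.mkAlgHom_coe Base]; rfl]
  exact RingQuot.lift_mkRingHom_apply _ (freeLift_rel hζ) x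

theorem actW_gen (g : Gen m) : actW D hζ (gen m g) = genAct D z g := by
  rw [gen, actW_mk, freeLift_ι]

theorem actW_algebraMap (r : Base) :
    actW D hζ (algebraMap Base _ r) = algebraMap ℂ _ (evalBase z (tUnit D z) r) := by
  rw [← AlgHom.commutes (RingQuot.mkAlgHom Base (Rel m)), actW_mk, freeLift_algebraMap]

theorem actW_algebraMap_complex (c : ℂ) :
    actW D hζ (algebraMap ℂ _ c) = algebraMap ℂ _ c := by
  rw [show algebraMap ℂ (DAHA m) c = algebraMap Base (DAHA m) (algebraMap ℂ Base c) from rfl,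
    actW_algebraMap, evalBase_algebraMap]

theorem actW_smul (c : ℂ) (y : DAHA m) : actW D hζ (c • y) = c • actW D hζ y := by
  rw [Algebra.smul_def, map_mul, actW_algebraMap_complex, ← Algebra.smul_def]

end Representation

/-! ### The direct sum of the actions. -/

section DirectSum

variable {m : ℕ} [hm : Fact (2 ≤ m)] {S : Set (Datum m)} {z : Datum m → ℂˣ}
  (hz : ∀ D : Datum m, IsPrimitiveRoot (z D : ℂ) (D.K + D.N).toNat)

/-- The direct sum of the actions on the tableau modules. -/
def actBigW (S : Set (Datum m)) : DAHA m →ₐ[ℂ] Module.End ℂ (BigW S) where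
  toFun y := DirectSum.lmap fun D : S => actW D.1 (hz D.1) y
  map_one' := by simp only [map_one]; exact DirectSum.lmap_id
  map_mul' x y := by
    simp only [map_mul]
    exact DirectSum.lmap_comp _ _
  map_zero' := by
    ext1 v
    ext D
    simp
  map_add' x y := by
    ext1 v
    ext D
    simp
  commutes' c := by
    ext1 v
    ext D
    simp [actW_smul, Algebra.algebraMap_eq_smul_one]
    rfl

theorem actBigW_isTableauAction {ζ : Datum m → ℂ} (h : ∀ D, (z D : ℂ) = ζ D) :
    IsTableauAction S ζ (actBigW hz S) := by
  obtain rfl : (fun D => (z D : ℂ)) = ζ := funext h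
  refine ⟨?_, ?_, fun i => ?_, fun i => ?_, ?_⟩
  · change (DirectSum.lmap _ : BigW S →ₗ[ℂ] BigW S) = _
    congr 1
    funext D
    rw [actW_algebraMap, evalBase_qParam, Algebra.algebraMap_eq_smul_one]
    rfl
  · change (DirectSum.lmap _ : BigW S →ₗ[ℂ] BigW S) = _
    congr 1
    funext D
    rw [actW_algebraMap, evalBase_tParam, Algebra.algebraMap_eq_smul_one, tUnit,
      Units.val_zpow_eq_zpow_val]
    rfl
  · change (DirectSum.lmap _ : BigW S →ₗ[ℂ] BigW S) = _
    congr 1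
    funext D
    exact actW_gen _ _
  · change (DirectSum.lmap _ : BigW S →ₗ[ℂ] BigW S) = _
    congr 1
    funext D
    exact actW_gen _ _
  · change (DirectSum.lmap _ : BigW S →ₗ[ℂ] BigW S) = _
    congr 1
    funext D
    exact actW_gen _ _

theorem actW_eq_zero {y : DAHA m} (h : actBigW hz S y = 0) {D : Datum m} (hD : D ∈ S) :
    actW D (hz D) y = 0 := by
  classical
  ext1 σ
  ext1
  have h1 := LinearMap.congr_fun h (DirectSum.lof ℂ S (fun D => W D.1) ⟨D, hD⟩ (Finsupp.single σ 1))
  have h2 := congrArg (fun v : BigW S => v ⟨D, hD⟩) h1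
  change (DirectSum.lmap (fun D : S => actW D.1 (hz D.1) y)) _ ⟨D, hD⟩ = 0 at h2
  rw [DirectSum.lmap_lof, DirectSum.lof_apply] at h2
  exact h2

end DirectSum

/-! ### Triangularity of the action -/

section Triangular

variable {m : ℕ}

/-- The value of a monomial. -/
def monoVal (x : ZMod m ⊕ Bool → ℂ) [NeZero m] (e : Exps m) : ℂ := ∏ a, x a ^ (e a).toAdd

variable {D : Datum m} {z : ℂˣ}

/-- The eigenvalues of the generators `X_i`, `q`, `t` on a filling. -/
def eigen (z : ℂˣ) (p : PT D) : ZMod m ⊕ Bool → ℂ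
  | .inl i => p.weight z (xIndex i)
  | .inr false => z
  | .inr true => tUnit D z

theorem eigen_ne_zero (p : PT D) (a : ZMod m ⊕ Bool) : eigen z p a ≠ 0 := by
  rcases a with i | b | b
  · exact p.weight_ne_zero z.ne_zero _
  · exact z.ne_zero
  · exact (tUnit D z).ne_zero

/-- The weights of the given pairs of labels are not those of adjacent or equal cells. -/
def NonDeg (ζ : ℂ) (p : PT D) (Q : Finset (ℤ × ℤ)) : Prop :=
  ∀ q ∈ Q, p.weight ζ q.1 ≠ p.weight ζ q.2 ∧ p.weight ζ q.2 ≠ ζ * p.weight ζ q.1 ∧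
    p.weight ζ q.1 ≠ ζ * p.weight ζ q.2

theorem coefB_ne_zero {ζ a b : ℂ} (hb : b ≠ 0) (h1 : a ≠ b) (h2 : b ≠ ζ * a) (h3 : a ≠ ζ * b) :
    coefB ζ a b ≠ 0 := by
  rw [coefB, if_neg (by tauto), ← div_eq_mul_inv, one_sub_div hb, ← mul_div_assoc, one_sub_div hb]
  exact div_ne_zero (div_ne_zero (sub_ne_zero.2 h2) hb)
    (div_ne_zero (sub_ne_zero.2 h1.symm) hb)

variable [hm : Fact (2 ≤ m)]

theorem monoVal_one (x : ZMod m ⊕ Bool → ℂ) : monoVal x 1 = 1 := by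
  simp [monoVal]

theorem monoVal_mul {x : ZMod m ⊕ Bool → ℂ} (hx : ∀ a, x a ≠ 0) (e e' : Exps m) :
    monoVal x (e * e') = monoVal x e * monoVal x e' := by
  simp only [monoVal, Pi.mul_apply, toAdd_mul, zpow_add₀ (hx _), Finset.prod_mul_distrib]

theorem monoVal_expOne (x : ZMod m ⊕ Bool → ℂ) (a : ZMod m ⊕ Bool) : monoVal x (expOne a) = x a := by
  classical
  rw [monoVal, Finset.prod_eq_single a]
  · simp [expOne]
  · intro b _ hb
    simp [expOne, Pi.mulSingle_eq_of_ne hb]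
  · simp

theorem monoVal_zpow {z : ℂ} (hz : z ≠ 0) (l : ZMod m ⊕ Bool → ℤ) (e : Exps m) :
    monoVal (fun a => z ^ l a) e = z ^ ∑ a, l a * (e a).toAdd := by
  have : ∀ (s : Finset (ZMod m ⊕ Bool)) (f : ZMod m ⊕ Bool → ℤ),
      ∏ a ∈ s, z ^ f a = z ^ ∑ a ∈ s, f a := by
    classical
    intro s f
    induction s using Finset.induction_on with
    | empty => simp
    | insert a s ha ih => rw [Finset.prod_insert ha, Finset.sum_insert ha, zpow_add₀ hz, ih]
  simp only [monoVal, ← zpow_mul]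
  exact this _ _

/-- The action of a monomial on fillings. -/
def ptMono (D : Datum m) (z : ℂˣ) (e : Exps m) : Module.End ℂ (PT D →₀ ℂ) :=
  Finsupp.linearCombination ℂ fun p : PT D => monoVal (eigen z p) e • Finsupp.single p 1

theorem ptMono_single (e : Exps m) (p : PT D) :
    ptMono D z e (Finsupp.single p 1) = monoVal (eigen z p) e • Finsupp.single p 1 := by
  simp [ptMono]

theorem ptMono_apply (e : Exps m) (v : PT D →₀ ℂ) (p : PT D) :
    ptMono D z e v p = monoVal (eigen z p) e * v p := by
  induction v using Finsupp.induction_linear with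
  | zero => simp
  | add v w hv hw => rw [map_add, Finsupp.add_apply, hv, hw, Finsupp.add_apply, mul_add]
  | single p' c =>
    classical
    rw [← mul_one c, ← smul_eq_mul, ← Finsupp.smul_single, map_smul, ptMono_single]
    simp only [Finsupp.smul_apply, Finsupp.single_apply, smul_eq_mul]
    split_ifs with h
    · rw [h]; ring
    · ring

theorem ptMono_mul (e e' : Exps m) (v : PT D →₀ ℂ) :
    ptMono D z (e * e') v = ptMono D z e (ptMono D z e' v) := by
  ext p
  rw [ptMono_apply, ptMono_apply, ptMono_apply, monoVal_mul (eigen_ne_zero p), mul_assoc]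

theorem ptMono_one (v : PT D →₀ ℂ) : ptMono D z 1 v = v := by
  ext p
  rw [ptMono_apply, monoVal_one, one_mul]

variable (hζ : IsPrimitiveRoot (z : ℂ) (D.K + D.N).toNat)

theorem emb_actW_genU (a : ZMod m ⊕ Bool) (v : W D) :
    emb D (actW D hζ (genU m a) v) = ptMono D z (expOne a) (emb D v) := by
  refine emb_eq_of_nu (fun σ => ?_) v
  rw [emb_nu, ptMono_single, monoVal_expOne]
  rcases a with i | b | b
  · rw [genU_inl, actW_gen]
    change emb D (opX D z _ _) = _
    rw [emb_opX, emb_nu, ptX_single]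
    rfl
  · rw [genU_q, qD, actW_algebraMap, evalBase_qParam, Module.algebraMap_end_apply, map_smul, emb_nu]
    rfl
  · rw [genU_t, actW_algebraMap, evalBase_tParam, Module.algebraMap_end_apply, map_smul, emb_nu]
    rfl

theorem emb_actW_mono (e : Exps m) (v : W D) :
    emb D (actW D hζ (mono m e) v) = ptMono D z e (emb D v) := by
  let N : Submonoid (Exps m) :=
    { carrier := {e | ∀ v : W D, emb D (actW D hζ (mono m e) v) = ptMono D z e (emb D v)}
      one_mem' := fun v => by rw [map_one, Units.val_one, map_one, ptMono_one]; rfl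
      mul_mem' := fun {a b} ha hb v => by
        rw [map_mul, Units.val_mul, map_mul, Module.End.mul_apply, ha, hb, ptMono_mul] }
  refine exps_mem N (fun a v => ?_) (fun a v => ?_) e v
  · rw [mono_expOne]
    exact emb_actW_genU hζ a v
  · rw [map_inv, mono_expOne]
    -- The action of an inverse generator is deduced from that of the generator by cancellation.
    have h := emb_actW_genU hζ a (actW D hζ ((genU m a)⁻¹ : (DAHA m)ˣ) v)
    rw [← Module.End.mul_apply, ← map_mul, Units.mul_inv, map_one, Module.End.one_apply] at h
    rw [h, ← ptMono_mul, inv_mul_cancel, ptMono_one]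

theorem emb_actW_piU_zpow (r : ℤ) (σ : DPT D) :
    emb D (actW D hζ ((piU m ^ r : (DAHA m)ˣ) : DAHA m) (nu σ))
      = Finsupp.single (PT.act (affPi m ^ r).1 σ.toPT) 1 := by
  induction r with
  | zero =>
    rw [zpow_zero, zpow_zero, Units.val_one, map_one, Module.End.one_apply, emb_nu]
    rfl
  | succ k ih =>
    rw [add_comm, zpow_one_add, zpow_one_add, Units.val_mul, map_mul, Module.End.mul_apply]
    rw [show ((piU m : (DAHA m)ˣ) : DAHA m) = gen m .pi from rfl, actW_gen]
    change emb D (opPi D _) = _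
    rw [emb_opPi, ih, ptAct_single]
    rfl
  | pred k ih =>
    rw [sub_eq_neg_add, zpow_add, zpow_add, zpow_neg_one, zpow_neg_one, Units.val_mul, map_mul,
      Module.End.mul_apply]
    rw [show (((piU m)⁻¹ : (DAHA m)ˣ) : DAHA m) = gen m .piInv from rfl, actW_gen]
    change emb D (opPiInv D _) = _
    rw [emb_opPiInv, ih, ptAct_single]
    rfl

theorem emb_actW_gT (i : ℤ) (v : W D) :
    emb D (actW D hζ (gT m i) v) = ptT D z i (emb D v) := by
  rw [gT, actW_gen]
  change emb D (opT D z _ v) = _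
  rw [opT_congr hζ (i := tIndex (i : ZMod m)) (j := i) (tIndex_dvd.2 rfl), emb_opT hζ]

/-- Combinations of the translates of `p` by affine permutations of length less than `k`. -/
def shorter (p : PT D) (k : ℕ) : Submodule ℂ (PT D →₀ ℂ) :=
  Finsupp.supported ℂ ℂ {p' | ∃ g : AffPerm m, len g < k ∧ p' = PT.act g.1 p}

theorem single_mem_shorter {p : PT D} {k : ℕ} {g : AffPerm m} (h : len g < k) (c : ℂ) :
    Finsupp.single (PT.act g.1 p) c ∈ shorter p k :=
  Finsupp.single_mem_supported ℂ c ⟨g, h, rfl⟩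

theorem ptT_mem_shorter {p : PT D} {k : ℕ} (i : ℤ) {v : PT D →₀ ℂ} (hv : v ∈ shorter p k) :
    ptT D z i v ∈ shorter p (k + 1) := by
  rw [shorter, Finsupp.supported_eq_span_single] at hv
  induction hv using Submodule.span_induction with
  | mem x hx =>
    obtain ⟨_, ⟨g, hg, rfl⟩, rfl⟩ := hx
    rw [ptT_single, ← PT.act_mul, ← Subgroup.coe_mul]
    refine add_mem (Submodule.smul_mem _ _ (single_mem_shorter (hg.trans (Nat.lt_succ_self k)) 1))
      (Submodule.smul_mem _ _ (single_mem_shorter ?_ 1))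
    exact (len_affS_mul_le g i).trans_lt (Nat.succ_lt_succ hg)
  | zero => rw [map_zero]; exact zero_mem _
  | add x y _ _ hx hy => rw [map_add]; exact add_mem hx hy
  | smul c x _ hx => rw [map_smul]; exact Submodule.smul_mem _ _ hx

/-- `T_w ν_σ` is a multiple of `ν_{wσ}` up to shorter terms, and generically a nonzero one. -/
theorem exists_leading (w : AffPerm m) : ∃ Q : Finset (ℤ × ℤ), (∀ q ∈ Q, ¬ (m : ℤ) ∣ q.1 - q.2) ∧
    ∀ (D : Datum m) (z : ℂˣ) (hζ : IsPrimitiveRoot (z : ℂ) (D.K + D.N).toNat) (σ : DPT D),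
      ∃ κ : ℂ, (NonDeg (z : ℂ) σ.toPT Q → κ ≠ 0) ∧ emb D (actW D hζ (Tw w) (nu σ))
        - κ • Finsupp.single (PT.act w.1 σ.toPT) 1 ∈ shorter σ.toPT (len w) := by
  classical
  induction hn : len w using Nat.strong_induction_on generalizing w with
  | _ n ih =>
  subst hn
  by_cases h : ∃ i, Desc w i
  · obtain ⟨i, hi⟩ := h
    have hlen := len_affS_mul_of_desc hi
    obtain ⟨Q, hQ, key⟩ := ih _ (len_affS_mul_lt hi) (affS i * w) rfl
    set w' := affS i * w with hw'
    have hww : w = affS i * w' := by rw [hw', affS_mul_cancel]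
    -- Applying `T_i` to w'σ multiplies the leading coefficient by `coefB` at the weights of `i` and
    -- `i + 1` in w'σ; these are the weights of this pair in σ. The pair depends on `w` alone, not
    -- on the datum.
    refine ⟨insert (w'⁻¹.1 i, w'⁻¹.1 (i + 1)) Q, ?_, fun D z hζ σ => ?_⟩
    · intro q hq
      rcases Finset.mem_insert.1 hq with rfl | hq
      · rw [affPerm_dvd_sub_iff, show i - (i + 1) = -1 by ring, dvd_neg]
        exact not_dvd_one hm.out
      · exact hQ q hq
    · obtain ⟨κ, hκ, hmem⟩ := key D z hζ σ
      set v := emb D (actW D hζ (Tw w') (nu σ)) - κ • Finsupp.single (PT.act w'.1 σ.toPT) 1 with hv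
      have hv' : emb D (actW D hζ (Tw w') (nu σ))
          = v + κ • Finsupp.single (PT.act w'.1 σ.toPT) 1 := by rw [hv]; abel
      refine ⟨κ * coefB z ((PT.act w'.1 σ.toPT).weight z i) ((PT.act w'.1 σ.toPT).weight z (i + 1)),
        fun hd => mul_ne_zero (hκ fun q hq => hd q (Finset.mem_insert_of_mem hq)) ?_, ?_⟩
      · obtain ⟨h1, h2, h3⟩ := hd _ (Finset.mem_insert_self _ _)
        rw [PT.weight_act hζ, PT.weight_act hζ]
        exact coefB_ne_zero (σ.toPT.weight_ne_zero z.ne_zero _) h1 h2 h3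
      · rw [Tw_eq hi, ← hw', map_mul, Module.End.mul_apply, emb_actW_gT, hv', map_add, map_smul,
          ptT_single, ← PT.act_mul, ← Subgroup.coe_mul, ← hww, smul_add, smul_smul, smul_smul,
          ← add_assoc, add_sub_cancel_right, ← hlen]
        exact add_mem (ptT_mem_shorter i hmem)
          (Submodule.smul_mem _ _ (single_mem_shorter (Nat.lt_succ_self _) 1))
  · rw [not_exists] at h
    refine ⟨∅, by simp, fun D z hζ σ => ⟨1, fun _ => one_ne_zero, ?_⟩⟩
    rw [Tw_of_not_desc h, emb_actW_piU_zpow, ← eq_affPi_zpow h, one_smul, sub_self]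
    exact zero_mem _

/-- The coefficient of a longest term. -/
theorem emb_actW_coeff {c : Exps m × AffPerm m →₀ ℂ} {w : AffPerm m}
    (hmax : ∀ p ∈ c.support, len p.2 ≤ len w) (σ : DPT D) {κ : ℂ}
    (hκ : emb D (actW D hζ (Tw w) (nu σ)) - κ • Finsupp.single (PT.act w.1 σ.toPT) 1
      ∈ shorter σ.toPT (len w)) (s : Finset (Exps m))
    (hs : ∀ e, (e, w) ∈ c.support → e ∈ s) :
    emb D (actW D hζ (Finsupp.linearCombination ℂ (stdElt m) c) (nu σ)) (PT.act w.1 σ.toPT)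
      = κ * ∑ e ∈ s, c (e, w) * monoVal (eigen z (PT.act w.1 σ.toPT)) e := by
  classical
  -- The action on fillings is free, so elements other than `w` of no greater length contribute
  -- nothing at wσ.
  have hinj : ∀ g : AffPerm m, PT.act g.1 σ.toPT = PT.act w.1 σ.toPT → g = w := fun g hg =>
    Subtype.ext (PT.act_injective σ.toPT hg)
  have hzero : ∀ k ≤ len w, ∀ v ∈ shorter σ.toPT k, v (PT.act w.1 σ.toPT) = 0 := by
    intro k hk v hv
    by_contra hne
    obtain ⟨g, hg, e⟩ := hv (Finsupp.mem_support_iff.2 hne)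
    rw [← hinj g e.symm] at hk
    omega
  have hterm : ∀ p ∈ c.support, emb D (actW D hζ (stdElt m p) (nu σ)) (PT.act w.1 σ.toPT)
      = if p.2 = w then κ * monoVal (eigen z (PT.act w.1 σ.toPT)) p.1 else 0 := by
    intro p hp
    rw [stdElt, map_mul, Module.End.mul_apply, emb_actW_mono, ptMono_apply]
    split_ifs with h
    · have := hzero _ le_rfl _ hκ
      rw [Finsupp.sub_apply, sub_eq_zero] at this
      rw [h, this]
      simp [mul_comm]
    · obtain ⟨Q, -, key⟩ := exists_leading p.2
      obtain ⟨κ', -, hmem⟩ := key D z hζ σ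
      have := hzero _ (hmax p hp) _ hmem
      rw [Finsupp.sub_apply, sub_eq_zero] at this
      rw [this, Finsupp.smul_apply, Finsupp.single_apply, if_neg fun e => h (hinj _ e)]
      simp
  have hsum : emb D (actW D hζ (Finsupp.linearCombination ℂ (stdElt m) c) (nu σ))
      (PT.act w.1 σ.toPT) = ∑ p ∈ c.support, c p *
        if p.2 = w then κ * monoVal (eigen z (PT.act w.1 σ.toPT)) p.1 else 0 := by
    rw [Finsupp.linearCombination_apply, Finsupp.sum, map_sum, LinearMap.sum_apply, map_sum,
      Finsupp.finsetSum_apply]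
    refine Finset.sum_congr rfl fun p hp => ?_
    rw [actW_smul, LinearMap.smul_apply, map_smul, Finsupp.smul_apply, hterm p hp, smul_eq_mul]
  rw [hsum, Finset.mul_sum]
  simp only [mul_ite, mul_zero]
  rw [← Finset.sum_filter]
  have hinj' : Function.Injective fun e : Exps m => (e, w) := fun _ _ h => congrArg Prod.fst h
  symm
  rw [← Finset.sum_image (f := fun p : Exps m × AffPerm m =>
    κ * (c p * monoVal (eigen z (PT.act w.1 σ.toPT)) p.1)) (g := fun e => (e, w))
    (fun _ _ _ _ h => hinj' h)]
  symm
  refine (Finset.sum_subset ?_ ?_).trans (Finset.sum_congr rfl fun p _ => ?_)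
  · rintro ⟨e, g⟩ hp
    obtain ⟨h1, rfl⟩ := Finset.mem_filter.1 hp
    exact Finset.mem_image_of_mem _ (hs e h1)
  · rintro p hp hp'
    obtain ⟨e, -, rfl⟩ := Finset.mem_image.1 hp
    have : c (e, w) = 0 := by
      by_contra hne
      exact hp' (Finset.mem_filter.2 ⟨Finsupp.mem_support_iff.2 hne, rfl⟩)
    rw [this, zero_mul]
  · ring

end Triangular

/-! ### Generic tableaux -/

/-! ### Division with residues from 1 to m. -/

section Residues

/-- The residue of `j` modulo `m`, between `1` and `m`. -/
def resid (m : ℕ) (j : ℤ) : ℕ := ((j - 1) % m).toNat + 1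

/-- The quotient of `j` modulo `m`, for residues between `1` and `m`. -/
def quot (m : ℕ) (j : ℤ) : ℤ := (j - 1) / m

/-- Positivity keeps the monomials Y^(resid) apart from constant terms when coefficients in Y are
compared. -/
theorem one_le_resid {m : ℕ} (j : ℤ) : 1 ≤ resid m j := Nat.le_add_left _ _

variable {m : ℕ} [NeZero m]

theorem resid_add_quot (j : ℤ) : (resid m j : ℤ) + m * quot m j = j := by
  have hm0 : (m : ℤ) ≠ 0 := by exact_mod_cast NeZero.ne m
  have h1 := Int.emod_nonneg (j - 1) hm0
  have h2 := Int.emod_add_mul_ediv (j - 1) m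
  rw [resid, quot]
  push_cast
  rw [Int.toNat_of_nonneg h1]
  linarith

theorem resid_le (j : ℤ) : resid m j ≤ m := by
  have hm0 : (0 : ℤ) < m := by exact_mod_cast Nat.pos_of_ne_zero (NeZero.ne m)
  have h2 := Int.emod_lt_of_pos (j - 1) hm0
  have h1 := Int.emod_nonneg (j - 1) hm0.ne'
  rw [resid]
  omega

theorem resid_quot_unique {j : ℤ} {r : ℕ} {l : ℤ} (h1 : 1 ≤ r) (h2 : r ≤ m) (h : (r : ℤ) + m * l = j) :
    resid m j = r ∧ quot m j = l := by
  have hm0 : (0 : ℤ) < m := by exact_mod_cast Nat.pos_of_ne_zero (NeZero.ne m)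
  have e : j - 1 = (r - 1 : ℤ) + m * l := by linarith
  have e1 : (j - 1) % m = r - 1 := by
    rw [e, Int.add_mul_emod_self_left, Int.emod_eq_of_lt (by omega) (by omega)]
  constructor
  · rw [resid, e1]
    omega
  · rw [quot, e, Int.add_mul_ediv_left _ _ hm0.ne', Int.ediv_eq_zero_of_lt (by omega) (by omega),
      zero_add]

theorem resid_add_mul (j k : ℤ) : resid m (j + m * k) = resid m j ∧
    quot m (j + m * k) = quot m j + k :=
  resid_quot_unique (one_le_resid j) (resid_le j) (by
    have := resid_add_quot (m := m) j
    linarith)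

theorem resid_eq_iff {i j : ℤ} : resid m i = resid m j ↔ (m : ℤ) ∣ i - j := by
  have h1 := resid_add_quot (m := m) i
  have h2 := resid_add_quot (m := m) j
  constructor
  · intro h
    refine ⟨quot m i - quot m j, ?_⟩
    rw [h] at h1
    linarith
  · rintro ⟨k, hk⟩
    rw [show i = j + m * k by linarith]
    exact (resid_add_mul j k).1

end Residues

/-! ### Construction of the generic tableau. -/

section Tableau

variable {m : ℕ} [NeZero m]

/-- The labels in the column `0` of the generic tableau. -/
def column (m Y K : ℕ) (j : ℤ) : ℤ := j + m * ((Y : ℤ) ^ resid m j + (K - 1) * quot m j)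

/-- The content of the label `j` in the generic tableau. -/
def genericContent (m Y J : ℕ) (j : ℤ) : ℤ := J * ((Y : ℤ) ^ resid m j - quot m j) - resid m j

theorem column_add_mul (Y K : ℕ) (j k : ℤ) :
    column m Y K (j + m * k) = column m Y K j + k * (m * K) := by
  obtain ⟨h1, h2⟩ := resid_add_mul (m := m) j k
  rw [column, column, h1, h2]
  ring

/-- Inside a period Y^(resid) does not decrease. At the end of a period it drops from Y^m to Y,
which the increase K - 1 ≥ Y^m of the other term makes up for. -/
theorem column_lt (Y K : ℕ) (hY : 1 ≤ Y) (hK : Y ^ m < K) (j : ℤ) :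
    column m Y K j < column m Y K (j + 1) := by
  have hj := resid_add_quot (m := m) j
  have hm0 : (0 : ℤ) < m := by exact_mod_cast Nat.pos_of_ne_zero (NeZero.ne m)
  have key : (Y : ℤ) ^ resid m j + (K - 1) * quot m j
      ≤ (Y : ℤ) ^ resid m (j + 1) + (K - 1) * quot m (j + 1) := by
    rcases (resid_le (m := m) j).lt_or_eq with h | h
    · obtain ⟨h1, h2⟩ := resid_quot_unique (m := m) (j := j + 1) (r := resid m j + 1) (l := quot m j)
        (by omega) h (by push_cast; linarith)
      rw [h1, h2]
      have : (Y : ℤ) ^ resid m j ≤ (Y : ℤ) ^ (resid m j + 1) :=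
        pow_le_pow_right₀ (by exact_mod_cast hY) (Nat.le_succ _)
      linarith
    · obtain ⟨h1, h2⟩ := resid_quot_unique (m := m) (j := j + 1) (r := 1) (l := quot m j + 1)
        le_rfl (Nat.pos_of_ne_zero (NeZero.ne m)) (by rw [h] at hj; push_cast; linarith)
      rw [h1, h2, h]
      have : (Y : ℤ) ^ m < K := by exact_mod_cast hK
      have : (1 : ℤ) ≤ (Y : ℤ) ^ 1 := by rw [pow_one]; exact_mod_cast hY
      linarith
  have := mul_le_mul_of_nonneg_left key hm0.le
  rw [column, column]
  linarith

theorem column_add_le (Y K : ℕ) (hY : 1 ≤ Y) (hK : Y ^ m < K) (j : ℤ) (n : ℕ) :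
    column m Y K j + n ≤ column m Y K (j + n) := by
  induction n with
  | zero => simp
  | succ n ih =>
    have := column_lt Y K hY hK (j + n)
    push_cast
    rw [← add_assoc j]
    omega

variable {Y J K : ℕ} {D : Datum m}

/-- The generic tableau. -/
def genericDPT (hY : 1 ≤ Y) (hJ : m + 2 ≤ J) (hK : Y ^ m < K) (r : ℤ) (hDK : D.K = K)
    (hDN : D.N = (J - 1) * K - m) (hDa : D.a = -1 + r * D.K) (hDb : D.b = 1 - J + r * D.N) :
    DPT D where
  -- Up to a multiple of the period, (a,-b) is (-1, J - 1) and must raise labels by `m`. Hence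
  -- column 0 determines everything, and (x, y) is reached from (0, y + (J - 1)x) by -x such shifts.
  toFun c := column m Y K (c.2 + (J - 1) * c.1) - m * c.1
  surjective j := by
    -- With r = resid m j, row r of column 0 has label r + mY^r. Shifting it back Y^r - quot m j
    -- times lowers the label to `j`.
    refine ⟨((Y : ℤ) ^ resid m j - quot m j,
      resid m j - (J - 1) * ((Y : ℤ) ^ resid m j - quot m j)), ?_⟩
    obtain ⟨h1, h2⟩ := resid_quot_unique (m := m) (j := resid m j) (r := resid m j) (l := 0)
      (one_le_resid j) (resid_le j) (by simp)
    change column m Y K (_ + _) - _ = _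
    rw [sub_add_cancel, column, h1, h2]
    have := resid_add_quot (m := m) j
    linarith
  periodic x y := by
    simp only [hDN, hDK]
    rw [show y - ((J - 1) * K - m) + ((J : ℤ) - 1) * (x + K) = y + (J - 1) * x + m * 1 by ring,
      column_add_mul]
    ring
  shift x y := by
    simp only [hDa, hDb, hDN, hDK]
    rw [show y - (1 - J + r * ((J - 1) * K - m)) + ((J : ℤ) - 1) * (x + (-1 + r * K))
      = y + (J - 1) * x + m * r by ring, column_add_mul]
    ring
  lt_right x y := by
    -- One step to the right is J - 1 steps down column 0 followed by subtracting `m`, and J - 1 >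
    -- m.
    have := column_add_le (m := m) Y K hY hK (y + (J - 1) * x) (J - 1)
    rw [Nat.cast_sub (by omega), show y + ((J : ℤ) - 1) * x + (J - (1 : ℕ)) = y + (J - 1) * (x + 1) by
      push_cast; ring] at this
    simp only
    have hJ' : (m : ℤ) + 2 ≤ J := by exact_mod_cast hJ
    push_cast at this
    linarith
  lt_down x y := by
    simp only
    rw [show y + 1 + ((J : ℤ) - 1) * x = y + (J - 1) * x + 1 by ring]
    have := column_lt (m := m) Y K hY hK (y + (J - 1) * x)
    linarith

/-- The cell with label `j` found for surjectivity has y = r - (J - 1)x, hence x - y = Jx - r with x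
= Y^r - quot m j. -/
theorem genericDPT_weight {ζ : ℂ} (hζ : IsPrimitiveRoot ζ (D.K + D.N).toNat)
    (hY : 1 ≤ Y) (hJ : m + 2 ≤ J) (hK : Y ^ m < K) (r : ℤ) (hDK : D.K = K)
    (hDN : D.N = (J - 1) * K - m) (hDa : D.a = -1 + r * D.K) (hDb : D.b = 1 - J + r * D.N) (j : ℤ) :
    (genericDPT hY hJ hK r hDK hDN hDa hDb).weight ζ j = ζ ^ genericContent m Y J j := by
  have h : (genericDPT hY hJ hK r hDK hDN hDa hDb).toFun ((Y : ℤ) ^ resid m j - quot m j,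
      resid m j - (J - 1) * ((Y : ℤ) ^ resid m j - quot m j)) = j := by
    obtain ⟨h1, h2⟩ := resid_quot_unique (m := m) (j := resid m j) (r := resid m j) (l := 0)
      (one_le_resid j) (resid_le j) (by simp)
    change column m Y K (_ + _) - _ = _
    rw [sub_add_cancel, column, h1, h2]
    have := resid_add_quot (m := m) j
    linarith
  rw [DPT.weight_eq hζ _ h, genericContent]
  congr 1
  ring

/-- Generic tableaux exist in a transversal. -/
theorem exists_generic_datum {S : Set (Datum m)} (hS : IsTransversal S) (hJ : m + 2 ≤ J)
    (hY : 1 ≤ Y) (hK : Y ^ m < K) : ∃ D ∈ S, D.K + D.N = J * K - m ∧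
      (∀ z : ℂˣ, IsPrimitiveRoot (z : ℂ) (D.K + D.N).toNat → (tUnit D z : ℂ) = (z : ℂ) ^ J) ∧
      ∃ σ : DPT D, ∀ ζ : ℂ, IsPrimitiveRoot ζ (D.K + D.N).toNat →
        ∀ j, σ.weight ζ j = ζ ^ genericContent m Y J j := by
  have hJ' : (m : ℤ) + 2 ≤ J := by exact_mod_cast hJ
  have hK1 : (1 : ℤ) ≤ K := by
    have : 1 ≤ K := by omega
    exact_mod_cast this
  let D₀ : Datum m :=
    { K := K
      N := (J - 1) * K - m
      a := -1
      b := 1 - J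
      K_pos := by omega
      N_pos := by nlinarith
      det := by ring }
  -- The vector (-1, 1 - J) is not positive, so it is replaced by its representative in `S`. This
  -- changes -a - b by a multiple of K + N, leaving t = ζ^J.
  obtain ⟨D, ⟨hD, hDK, hDN, r, hDa, hDb⟩, -⟩ := hS.2 D₀
  have hDa' : D.a = -1 + r * D.K := by rw [hDa, hDK]
  have hDb' : D.b = 1 - J + r * D.N := by rw [hDb, hDN]
  refine ⟨D, hD, ?_, fun z hz => ?_, genericDPT hY hJ hK r hDK hDN hDa' hDb', fun ζ hζ j => ?_⟩
  · rw [hDK, hDN]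
    change (K : ℤ) + ((J - 1) * K - m) = _
    ring
  · have h1 : (z : ℂ) ^ (D.K + D.N) = 1 := by
      have := hz.pow_eq_one
      rwa [← zpow_natCast, Int.toNat_of_nonneg (add_pos D.K_pos D.N_pos).le] at this
    rw [tUnit, Units.val_zpow_eq_zpow_val, hDa', hDb',
      show -(-1 + r * D.K) - (1 - J + r * D.N) = J + (D.K + D.N) * (-r) by ring,
      zpow_add₀ z.ne_zero, zpow_mul, h1, one_zpow, mul_one, zpow_natCast]
  · exact genericDPT_weight hζ hY hJ hK r hDK hDN hDa' hDb' j

end Tableau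

/-! ### Choice of parameters and faithfulness. -/

section Choice

open Filter Polynomial

/-- For f ≠ 0, take Y beyond the roots of f and then J > |α|. If α + J f(Y) = 0, then J divides α,
so α = 0 and f(Y) = 0, a contradiction. -/
theorem eventually_add_mul_eval_ne_zero (α : ℤ) (f : ℤ[X]) (h : f = 0 → α ≠ 0) :
    ∀ᶠ Y : ℕ in atTop, ∀ᶠ J : ℕ in atTop, α + J * f.eval (Y : ℤ) ≠ 0 := by
  by_cases hf : f = 0
  · simp [hf, h hf]
  have h1 : {Y : ℕ | f.eval (Y : ℤ) = 0}.Finite :=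
    ((finite_setOfPred_isRoot hf).preimage (Nat.cast_injective (R := ℤ)).injOn)
  have h2 : ∀ᶠ Y : ℕ in atTop, f.eval (Y : ℤ) ≠ 0 := by
    rw [← Nat.cofinite_eq_atTop]
    exact h1.compl_mem_cofinite
  filter_upwards [h2] with Y hY
  filter_upwards [eventually_gt_atTop α.natAbs] with J hJ e
  have h3 : (J : ℤ) ∣ α := ⟨-f.eval (Y : ℤ), by linarith⟩
  have h4 : α ≠ 0 := by
    rintro rfl
    rw [zero_add, mul_eq_zero] at e
    rcases e with e | e
    · have : J = 0 := by exact_mod_cast e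
      omega
    · exact hY e
  have := Nat.le_of_dvd (Int.natAbs_pos.2 h4) (Int.natAbs_dvd_natAbs.2 h3)
  rw [Int.natAbs_natCast] at this
  omega

/-- A nonzero Laurent polynomial has finitely many zeros. -/
theorem finite_zeros {ι : Type*} (s : Finset ι) (L : ι → ℤ) (hL : Set.InjOn L s) (c : ι → ℂ)
    (hc : ∃ i ∈ s, c i ≠ 0) : {x : ℂ | x ≠ 0 ∧ ∑ i ∈ s, c i * x ^ L i = 0}.Finite := by
  classical
  obtain ⟨i₀, hi₀, hne⟩ := hc
  -- Multiplication by x^M clears all negative exponents.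
  set M : ℕ := ∑ i ∈ s, (L i).natAbs with hM
  have hpos : ∀ i ∈ s, 0 ≤ L i + M := fun i hi => by
    have : (L i).natAbs ≤ M :=
      Finset.single_le_sum (f := fun i => (L i).natAbs) (fun _ _ => Nat.zero_le _) hi
    omega
  let p : ℂ[X] := ∑ i ∈ s, C (c i) * X ^ (L i + M).toNat
  have hp : p ≠ 0 := by
    intro h
    have h1 := congrArg (fun p : ℂ[X] => p.coeff (L i₀ + M).toNat) h
    simp only [p, finsetSum_coeff, coeff_C_mul, coeff_X_pow, coeff_zero] at h1
    rw [Finset.sum_eq_single i₀] at h1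
    · simp [hne] at h1
    · intro i hi hne'
      rw [if_neg, mul_zero]
      intro e
      have := hpos i hi
      have := hpos i₀ hi₀
      exact hne' (hL hi hi₀ (by omega))
    · exact fun h => absurd hi₀ h
  refine (finite_setOfPred_isRoot hp).subset ?_
  rintro x ⟨hx, h⟩
  change p.eval x = 0
  have : p.eval x = x ^ M * ∑ i ∈ s, c i * x ^ L i := by
    simp only [p, eval_finsetSum, eval_mul, eval_C, eval_pow, eval_X, Finset.mul_sum]
    refine Finset.sum_congr rfl fun i hi => ?_
    rw [← zpow_natCast x M, mul_left_comm, ← zpow_add₀ hx, ← zpow_natCast,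
      Int.toNat_of_nonneg (hpos i hi), add_comm]
  rw [this, h, mul_zero]

variable {m : ℕ} [hm : Fact (2 ≤ m)]

/-- The exponents, in terms of `q`, of `X_i` (with content that of the label `v i`), `q` and `t`. -/
def genericExp (Y J : ℕ) (v : ZMod m → ℤ) : ZMod m ⊕ Bool → ℤ
  | .inl i => genericContent m Y J (v i)
  | .inr false => 1
  | .inr true => J

/-- The sum has the form α + J f(Y). If f = 0, its coefficients at the distinct positive residues
kill the exponents of the `X_i`, and its constant term then kills that of t; what is left of α is
the exponent of q. -/
theorem eventually_genericExp_ne_zero {v : ZMod m → ℤ}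
    (hv : Function.Injective fun i => resid m (v i)) {e : ZMod m ⊕ Bool → ℤ} (he : e ≠ 0) :
    ∀ᶠ Y : ℕ in atTop, ∀ᶠ J : ℕ in atTop, ∑ a, genericExp Y J v a * e a ≠ 0 := by
  let f : ℤ[X] := C (e (.inr true) - ∑ i, e (.inl i) * quot m (v i))
    + ∑ i, C (e (.inl i)) * X ^ resid m (v i)
  let α : ℤ := e (.inr false) - ∑ i, e (.inl i) * resid m (v i)
  have key := eventually_add_mul_eval_ne_zero α f ?_
  · refine key.mono fun Y hY => hY.mono fun J hJ => ?_
    convert hJ using 1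
    simp only [Fintype.sum_sum_type, Fintype.sum_bool, genericExp, genericContent, α, f, eval_add,
      eval_C, eval_finsetSum, eval_mul, eval_pow, eval_X, mul_add, mul_sub, Finset.mul_sum,
      sub_mul, Finset.sum_sub_distrib]
    have h1 : ∑ i, (J : ℤ) * (Y : ℤ) ^ resid m (v i) * e (.inl i)
        = ∑ i, (J : ℤ) * (e (.inl i) * (Y : ℤ) ^ resid m (v i)) :=
      Finset.sum_congr rfl fun i _ => by ring
    have h2 : ∑ i, (J : ℤ) * quot m (v i) * e (.inl i)
        = ∑ i, (J : ℤ) * (e (.inl i) * quot m (v i)) :=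
      Finset.sum_congr rfl fun i _ => by ring
    have h3 : ∑ i, (resid m (v i) : ℤ) * e (.inl i) = ∑ i, e (.inl i) * (resid m (v i) : ℤ) :=
      Finset.sum_congr rfl fun i _ => by ring
    rw [h1, h2, h3]
    ring
  · intro hf
    have hi : ∀ i, e (.inl i) = 0 := by
      intro i
      have h1 := congrArg (fun p : ℤ[X] => p.coeff (resid m (v i))) hf
      have h0 : resid m (v i) ≠ 0 := Nat.one_le_iff_ne_zero.1 (one_le_resid _)
      simp only [f, coeff_add, coeff_C_of_ne_zero h0, finsetSum_coeff, coeff_C_mul, coeff_X_pow,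
        coeff_zero, zero_add] at h1
      rw [Finset.sum_eq_single i] at h1
      · simpa using h1
      · intro j _ hj
        rw [if_neg fun h => hj (hv h).symm, mul_zero]
      · simp
    have ht : e (.inr true) = 0 := by
      simp only [f, hi] at hf
      simpa using hf
    intro hα
    have hq : e (.inr false) = 0 := by
      simpa [α, hi] using hα
    apply he
    funext a
    rcases a with i | b | b
    · exact hi i
    · exact hq
    · exact ht

theorem eventually_content_ne {j j' : ℤ} (h : ¬ (m : ℤ) ∣ j - j') (ε : ℤ) :
    ∀ᶠ Y : ℕ in atTop, ∀ᶠ J : ℕ in atTop,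
      genericContent m Y J j - genericContent m Y J j' ≠ ε := by
  let f : ℤ[X] := X ^ resid m j - X ^ resid m j' - C (quot m j - quot m j')
  have hne : resid m j ≠ resid m j' := by rwa [Ne, resid_eq_iff]
  have key := eventually_add_mul_eval_ne_zero (resid m j' - resid m j - ε) f ?_
  · refine key.mono fun Y hY => hY.mono fun J hJ => ?_
    intro h
    apply hJ
    rw [← h]
    simp only [f, eval_sub, eval_pow, eval_X, eval_C, genericContent]
    ring
  · intro hf
    exfalso
    have h1 := congrArg (fun p : ℤ[X] => p.coeff (resid m j)) hf
    have h0 : resid m j ≠ 0 := Nat.one_le_iff_ne_zero.1 (one_le_resid _)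
    simp only [f, coeff_sub, coeff_X_pow, coeff_C_of_ne_zero h0, coeff_zero, if_true,
      if_neg hne, sub_zero, one_ne_zero] at h1

/-- In a transversal there is a tableau for which given pairs of labels are not close to each
other, and a given nonzero Laurent polynomial in the `X_i`, `q` and `t` does not vanish. -/
theorem exists_generic_tableau {S : Set (Datum m)} (hS : IsTransversal S) {z : Datum m → ℂˣ}
    (hz : ∀ D : Datum m, IsPrimitiveRoot (z D : ℂ) (D.K + D.N).toNat) (w : AffPerm m)
    (s : Finset (Exps m)) (c : Exps m → ℂ) (hc : ∃ e ∈ s, c e ≠ 0) (Q : Finset (ℤ × ℤ))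
    (hQ : ∀ q ∈ Q, ¬ (m : ℤ) ∣ q.1 - q.2) :
    ∃ D ∈ S, ∃ σ : DPT D, NonDeg (z D : ℂ) σ.toPT Q ∧
      ∑ e ∈ s, c e * monoVal (eigen (z D) (PT.act w.1 σ.toPT)) e ≠ 0 := by
  classical
  -- The eigenvalue of `X_i` on wσ is the weight of the label w⁻¹(i) in σ.
  let v : ZMod m → ℤ := fun i => w⁻¹.1 (xIndex i)
  have hv : Function.Injective fun i => resid m (v i) := by
    intro i j h
    rw [resid_eq_iff, affPerm_dvd_sub_iff, ← ZMod.intCast_zmod_eq_zero_iff_dvd] at h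
    push_cast at h
    rwa [xIndex_cast, xIndex_cast, sub_eq_zero] at h
  -- the linear form is injective on the exponents, and the contents are far apart
  have ev1 : ∀ᶠ Y : ℕ in atTop, ∀ᶠ J : ℕ in atTop, ∀ p ∈ s ×ˢ s, p.1 ≠ p.2 →
      ∑ a, genericExp Y J v a * ((p.1 a).toAdd - (p.2 a).toAdd) ≠ 0 := by
    have : ∀ p ∈ s ×ˢ s, ∀ᶠ Y : ℕ in atTop, ∀ᶠ J : ℕ in atTop, p.1 ≠ p.2 →
        ∑ a, genericExp Y J v a * ((p.1 a).toAdd - (p.2 a).toAdd) ≠ 0 := by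
      intro p _
      by_cases h : p.1 = p.2
      · exact .of_forall fun _ => .of_forall fun _ h' => absurd h h'
      · refine (eventually_genericExp_ne_zero hv
          (e := fun a => (p.1 a).toAdd - (p.2 a).toAdd) ?_).mono fun Y hY => hY.mono fun J hJ _ => hJ
        intro h0
        apply h
        funext a
        have := congrFun h0 a
        exact Multiplicative.toAdd.injective (sub_eq_zero.1 this)
    exact ((Filter.eventually_all_finset _).2 this).mono fun Y hY =>
      (Filter.eventually_all_finset _).2 hY
  -- The content differences 0, 1, -1 are those of equal and of adjacent weights, excluded by
  -- `NonDeg`.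
  have ev2 : ∀ᶠ Y : ℕ in atTop, ∀ᶠ J : ℕ in atTop, ∀ p ∈ Q ×ˢ ({0, 1, -1} : Finset ℤ),
      genericContent m Y J p.1.1 - genericContent m Y J p.1.2 ≠ p.2 := by
    have : ∀ p ∈ Q ×ˢ ({0, 1, -1} : Finset ℤ), ∀ᶠ Y : ℕ in atTop, ∀ᶠ J : ℕ in atTop,
        genericContent m Y J p.1.1 - genericContent m Y J p.1.2 ≠ p.2 := fun p hp =>
      eventually_content_ne (hQ _ (Finset.mem_product.1 hp).1) _
    exact ((Filter.eventually_all_finset _).2 this).mono fun Y hY =>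
      (Filter.eventually_all_finset _).2 hY
  obtain ⟨Y, ⟨hY1, hY2⟩, hY⟩ := ((ev1.and ev2).and (eventually_ge_atTop 1)).exists
  obtain ⟨J, ⟨hJ1, hJ2⟩, hJ⟩ := ((hY1.and hY2).and (eventually_ge_atTop (m + 2))).exists
  -- Y and J are now fixed and only K varies, so the exponents of ζ do not depend on `k`.
  choose Dk hDS hDn hDt σ hσ using fun k : ℕ =>
    exists_generic_datum (K := Y ^ m + 1 + k) hS hJ hY (by omega)
  -- Roots for different `k` have different orders JK - m, so they differ however they were chosen.
  have hinj : Function.Injective fun k => ((z (Dk k) : ℂˣ) : ℂ) := by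
    intro k k' h
    have h1 := (hz (Dk k)).eq_orderOf
    have h2 := (hz (Dk k')).eq_orderOf
    simp only at h
    rw [h, ← h2] at h1
    have p1 := add_pos (Dk k).K_pos (Dk k).N_pos
    have p2 := add_pos (Dk k').K_pos (Dk k').N_pos
    have h3 : (Dk k).K + (Dk k).N = (Dk k').K + (Dk k').N := by omega
    rw [hDn, hDn, sub_left_inj] at h3
    have hJ0 : (J : ℤ) ≠ 0 := by omega
    have := mul_left_cancel₀ hJ0 h3
    push_cast at this
    omega
  set L : Exps m → ℤ := fun e => ∑ a, genericExp Y J v a * (e a).toAdd with hL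
  have hLinj : Set.InjOn L s := by
    intro e he e' he' h
    by_contra hne
    apply hJ1 (e, e') (Finset.mem_product.2 ⟨he, he'⟩) hne
    simp only [mul_sub, Finset.sum_sub_distrib]
    exact sub_eq_zero.2 h
  have fin1 := finite_zeros s L hLinj c hc
  have fin2 : (⋃ p ∈ Q ×ˢ ({0, 1, -1} : Finset ℤ), {x : ℂ | x ≠ 0 ∧
      x ^ (genericContent m Y J p.1.1 - genericContent m Y J p.1.2) = x ^ p.2}).Finite := by
    refine Set.Finite.biUnion (Finset.finite_toSet _) fun p hp => ?_
    refine (finite_zeros Finset.univ (fun b : Bool => if b then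
      genericContent m Y J p.1.1 - genericContent m Y J p.1.2 else p.2) ?_
      (fun b => if b then 1 else -1) ⟨true, Finset.mem_univ _, by simp⟩).subset ?_
    · have := hJ2 p hp
      intro b _ b' _ h
      cases b <;> cases b' <;> simp_all
    · rintro x ⟨hx, h⟩
      refine ⟨hx, ?_⟩
      simp [h]
  obtain ⟨k, hk⟩ : ∃ k : ℕ, ((z (Dk k) : ℂˣ) : ℂ) ∉ {x : ℂ | x ≠ 0 ∧ ∑ i ∈ s, c i * x ^ L i = 0} ∪
      ⋃ p ∈ Q ×ˢ ({0, 1, -1} : Finset ℤ), {x : ℂ | x ≠ 0 ∧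
        x ^ (genericContent m Y J p.1.1 - genericContent m Y J p.1.2) = x ^ p.2} := by
    by_contra hcon
    push Not at hcon
    exact Set.infinite_range_of_injective hinj ((fin1.union fin2).subset (by
      rintro _ ⟨k, rfl⟩
      exact hcon k))
  rw [Set.mem_union, not_or] at hk
  obtain ⟨hk1, hk2⟩ := hk
  have hzk := hz (Dk k)
  have hz0 := (z (Dk k)).ne_zero
  refine ⟨Dk k, hDS k, σ k, ?_, ?_⟩
  · intro q hq
    have hw : ∀ j, (σ k).toPT.weight (z (Dk k)) j = (z (Dk k) : ℂ) ^ genericContent m Y J j :=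
      hσ k _ hzk
    have far : ∀ ε ∈ ({0, 1, -1} : Finset ℤ), (z (Dk k) : ℂ) ^ (genericContent m Y J q.1
        - genericContent m Y J q.2) ≠ (z (Dk k) : ℂ) ^ ε := fun ε hε h => by
      apply hk2
      simp only [Set.mem_iUnion]
      exact ⟨(q, ε), Finset.mem_product.2 ⟨hq, hε⟩, hz0, h⟩
    have e := zpow_sub₀ hz0 (genericContent m Y J q.1) (genericContent m Y J q.2)
    have hne := zpow_ne_zero (genericContent m Y J q.1) hz0
    have hne' := zpow_ne_zero (genericContent m Y J q.2) hz0
    rw [hw, hw]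
    refine ⟨fun h => far 0 (by simp) ?_, fun h => far (-1) (by simp) ?_, fun h => far 1 (by simp) ?_⟩
    · rw [e, h, div_self hne', zpow_zero]
    · rw [e, h, zpow_neg_one, div_eq_iff (mul_ne_zero hz0 hne), inv_mul_cancel_left₀ hz0]
    · rw [e, h, zpow_one, mul_div_cancel_right₀ _ hne']
  · have hval : ∀ e, monoVal (eigen (z (Dk k)) (PT.act w.1 (σ k).toPT)) e = (z (Dk k) : ℂ) ^ L e := by
      intro e
      rw [hL, ← monoVal_zpow hz0]
      congr 1
      funext a
      rcases a with i | b | b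
      · change (PT.act w.1 (σ k).toPT).weight _ _ = _
        rw [PT.weight_act hzk]
        exact hσ k _ hzk _
      · exact (zpow_one _).symm
      · exact (hDt k _ hzk).trans (zpow_natCast _ _).symm
    simp only [hval]
    exact fun h => hk1 ⟨hz0, h⟩

/-- The direct sum of the tableau modules over a transversal is faithful. -/
theorem actBigW_injective {S : Set (Datum m)} (hS : IsTransversal S) {z : Datum m → ℂˣ}
    (hz : ∀ D : Datum m, IsPrimitiveRoot (z D : ℂ) (D.K + D.N).toNat) :
    Function.Injective (actBigW hz S) := by
  classical
  rw [injective_iff_map_eq_zero]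
  intro y hy
  obtain ⟨c, rfl⟩ := exists_eq_linearCombination y
  by_contra hne
  have hc : c.support.Nonempty := by
    rw [Finsupp.support_nonempty_iff]
    rintro rfl
    simp at hne
  -- Maximal length of `w` isolates the coefficient of wσ, and `e₀` witnesses that its Laurent
  -- polynomial is nonzero.
  obtain ⟨⟨e₀, w⟩, hp, hmax⟩ := c.support.exists_max_image (fun p => len p.2) hc
  obtain ⟨Q, hQ, key⟩ := exists_leading w
  obtain ⟨D, hD, σ, hnd, hval⟩ := exists_generic_tableau hS hz w (c.support.image Prod.fst)
    (fun e => c (e, w)) ⟨e₀, Finset.mem_image_of_mem _ hp, Finsupp.mem_support_iff.1 hp⟩ Q hQ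
  obtain ⟨κ, hκ, hmem⟩ := key D (z D) (hz D) σ
  have hcoef := emb_actW_coeff (hz D) hmax σ hmem (c.support.image Prod.fst)
    fun e he => Finset.mem_image_of_mem Prod.fst he
  rw [actW_eq_zero hz hy hD, LinearMap.zero_apply, map_zero, Finsupp.zero_apply] at hcoef
  exact mul_ne_zero (hκ hnd) hval hcoef.symm

end Choice

end

end DoublyPeriodic

theorem mainTheorem2 (m : ℕ) (hm : 2 ≤ m)
    (S : Set (DoublyPeriodic.Datum m)) (hS : DoublyPeriodic.IsTransversal S)
    (ζ : DoublyPeriodic.Datum m → ℂ)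
    (hζ : ∀ D : DoublyPeriodic.Datum m, IsPrimitiveRoot (ζ D) (D.K + D.N).toNat) :
    ∃ ρ : DoublyPeriodic.DAHA m →ₐ[ℂ] Module.End ℂ (DoublyPeriodic.BigW S),
      DoublyPeriodic.IsTableauAction S ζ ρ ∧ Function.Injective ρ := by
  have : Fact (2 ≤ m) := ⟨hm⟩
  let z : DoublyPeriodic.Datum m → ℂˣ := fun D =>
    Units.mk0 (ζ D) (DoublyPeriodic.zeta_ne_zero (hζ D))
  have hz : ∀ D : DoublyPeriodic.Datum m, IsPrimitiveRoot (z D : ℂ) (D.K + D.N).toNat := hζ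
  exact ⟨DoublyPeriodic.actBigW hz S, DoublyPeriodic.actBigW_isTableauAction hz fun _ => rfl,
    DoublyPeriodic.actBigW_injective hS hz⟩
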